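/- An instance of the Ad Types Problem without gap rules consists of $n\ge 1$ ordered slots and $k\ge 1$ ad types $\theta_1,\dots,\theta_k$; each type $\theta$ has exactly $n$ ads, with real values $v^{(\theta)}_1\ge v^{(\theta)}_2\ge\dots\ge v^{(\theta)}_n\ge 0$, and a discount curve $\alpha^{(\theta)}_1\ge\alpha^{(\theta)}_2\ge\dots\ge\alpha^{(\theta)}_n\ge 0$. Showing the $i$-th ad of type $\theta$ in slot $j$ has value $\alpha^{(\theta)}_j v^{(\theta)}_i$. An allocation is a matching of ads to slots (each slot shows at most one ad, each ad is shown in at most one slot), its welfare is the total value of the shown ads, and it is optimal if its welfare is maximal. Given an optimal allocation $M$, the VCG price of an ad $a$ is the maximal welfare of an allocation that does not show $a$, minus the total value that the ads other than $a$ get in $M$. Theorem. There is a single algorithm (a real RAM program, with unit-cost arithmetic and comparisons on reals, and on integers of $O(\log(n+k))$ bits) that, given any such instance with $k\ge 1$ types and $n\ge 1$ slots, computes an optimal allocation $M$ together with the VCG prices of all ads with respect to $M$ in time $O(n^2(k+\log n))$, where the constant in the $O$ is absolute (independent of $k$, $n$, the values and the discounts). -/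

import Mathlib

/-! ## The Ad Types Problem without gap rules -/

namespace AdTypes

/-- An instance with `k` ad types, `n` slots and `n` ads of each type. The ads of a type are indexed
in non-increasing order of value, and every discount curve is non-increasing along the slots. -/
structure Instance (k n : ℕ) where
  /-- `value θ i` is the value-per-conversion of the `i`-th ad of type `θ`. -/
  value : Fin k → Fin n → ℝ
  /-- `discount θ j` is the discount of slot `j` for ads of type `θ`. -/
  discount : Fin k → Fin n → ℝ
  value_antitone : ∀ θ, Antitone (value θ)
  value_nonneg : ∀ θ i, 0 ≤ value θ i
  discount_antitone : ∀ θ, Antitone (discount θ)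
  discount_nonneg : ∀ θ j, 0 ≤ discount θ j

/-- An ad is a pair (type, index within the type). -/
abbrev Ad (k n : ℕ) : Type := Fin k × Fin n

/-- An allocation is a matching of slots and ads: every slot shows at most one ad, and every ad is
shown in at most one slot. -/
abbrev Allocation (k n : ℕ) : Type := Fin n ≃. Ad k n

namespace Instance

variable {k n : ℕ}

/-- The value `v_{aj}` of showing ad `a` in slot `j`. -/
def weight (I : Instance k n) (a : Ad k n) (j : Fin n) : ℝ :=
  I.discount a.1 j * I.value a.1 a.2

/-- The value that ad `a` gets from the allocation `M`. -/
def adValue (I : Instance k n) (M : Allocation k n) (a : Ad k n) : ℝ :=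
  match M.symm a with
  | none => 0
  | some j => I.weight a j

/-- Social welfare. -/
def welfare (I : Instance k n) (M : Allocation k n) : ℝ :=
  ∑ a, I.adValue M a

/-- `M` maximizes social welfare among all allocations. -/
def IsOptimal (I : Instance k n) (M : Allocation k n) : Prop :=
  ∀ M' : Allocation k n, I.welfare M' ≤ I.welfare M

/-- `M` maximizes social welfare among the allocations that do not show ad `a`, that is, `M` is
optimal for the instance from which `a` is removed. -/
def IsOptimalWithout (I : Instance k n) (a : Ad k n) (M : Allocation k n) : Prop :=
  M.symm a = none ∧ ∀ M' : Allocation k n, M'.symm a = none → I.welfare M' ≤ I.welfare M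

/-- `p` is the VCG price of ad `a` when `M` is the chosen (optimal) allocation: the externality
of `a`, namely the optimal welfare of the others in the absence of `a`, minus the welfare of the
others under `M`. -/
def IsVCGPrice (I : Instance k n) (M : Allocation k n) (a : Ad k n) (p : ℝ) : Prop :=
  ∃ M₀ : Allocation k n, I.IsOptimalWithout a M₀ ∧
    p = I.welfare M₀ - ∑ b ∈ Finset.univ.erase a, I.adValue M b

end Instance

/-! ## Real RAM programs

Memory consists of natural-number variables, real variables, and finitely many (per program)
natural-number and real arrays. Indices are natural numbers. The only operations on reals are the
constants `0`, `1`, addition, subtraction, multiplication and comparison; there is no conversion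
between reals and natural numbers. Every node of an expression and every executed command costs
one step. Natural numbers live in words: a number is stored (and a cell is addressed for writing)
only if it does not exceed the word bound `W`; a run that violates this is not a run. -/

/-- Memory. Variables and arrays are named by natural numbers. -/
structure State where
  nvar : ℕ → ℕ
  rvar : ℕ → ℝ
  narr : ℕ → ℕ → ℕ
  rarr : ℕ → ℕ → ℝ

/-- Natural-number expressions. -/
inductive NExp where
  | lit (m : ℕ)
  | var (x : ℕ)
  | get (A : ℕ) (i : NExp)
  | add (e f : NExp)
  | sub (e f : NExp)
  | mul (e f : NExp)
  | div (e f : NExp)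

/-- Value of a natural-number expression (`sub` truncates at `0`, `div` rounds down). -/
def NExp.eval (s : State) : NExp → ℕ
  | .lit m => m
  | .var x => s.nvar x
  | .get A i => s.narr A (i.eval s)
  | .add e f => e.eval s + f.eval s
  | .sub e f => e.eval s - f.eval s
  | .mul e f => e.eval s * f.eval s
  | .div e f => e.eval s / f.eval s

/-- Number of steps for evaluating a natural-number expression. -/
def NExp.cost : NExp → ℕ
  | .lit _ => 1
  | .var _ => 1
  | .get _ i => i.cost + 1
  | .add e f => e.cost + f.cost + 1
  | .sub e f => e.cost + f.cost + 1
  | .mul e f => e.cost + f.cost + 1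
  | .div e f => e.cost + f.cost + 1

/-- Real expressions. -/
inductive RExp where
  | zero
  | one
  | var (x : ℕ)
  | get (A : ℕ) (i : NExp)
  | add (e f : RExp)
  | sub (e f : RExp)
  | mul (e f : RExp)

/-- Value of a real expression. -/
noncomputable def RExp.eval (s : State) : RExp → ℝ
  | .zero => 0
  | .one => 1
  | .var x => s.rvar x
  | .get A i => s.rarr A (i.eval s)
  | .add e f => e.eval s + f.eval s
  | .sub e f => e.eval s - f.eval s
  | .mul e f => e.eval s * f.eval s

/-- Number of steps for evaluating a real expression. -/
def RExp.cost : RExp → ℕ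
  | .zero => 1
  | .one => 1
  | .var _ => 1
  | .get _ i => i.cost + 1
  | .add e f => e.cost + f.cost + 1
  | .sub e f => e.cost + f.cost + 1
  | .mul e f => e.cost + f.cost + 1

/-- Tests. -/
inductive BExp where
  | nle (e f : NExp)
  | rle (e f : RExp)
  | not (b : BExp)
  | and (b c : BExp)

/-- Truth of a test. -/
def BExp.holds (s : State) : BExp → Prop
  | .nle e f => e.eval s ≤ f.eval s
  | .rle e f => e.eval s ≤ f.eval s
  | .not b => ¬ b.holds s
  | .and b c => b.holds s ∧ c.holds s

/-- Number of steps for evaluating a test. -/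
def BExp.cost : BExp → ℕ
  | .nle e f => e.cost + f.cost + 1
  | .rle e f => e.cost + f.cost + 1
  | .not b => b.cost + 1
  | .and b c => b.cost + c.cost + 1

/-- Programs. -/
inductive Program where
  | skip
  /-- `x := e` for a natural-number variable `x` -/
  | nassign (x : ℕ) (e : NExp)
  /-- `A[i] := e` for a natural-number array `A` -/
  | nstore (A : ℕ) (i e : NExp)
  /-- `x := e` for a real variable `x` -/
  | rassign (x : ℕ) (e : RExp)
  /-- `A[i] := e` for a real array `A` -/
  | rstore (A : ℕ) (i : NExp) (e : RExp)
  | seq (p q : Program)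
  /-- if `b` then `p` else `q` -/
  | branch (b : BExp) (p q : Program)
  /-- while `b` do `p` -/
  | loop (b : BExp) (p : Program)

/-- Overwrite entry `i` of array `A`. -/
def setArr {α : Type} (m : ℕ → ℕ → α) (A i : ℕ) (v : α) : ℕ → ℕ → α :=
  Function.update m A (Function.update (m A) i v)

/-- `Run W p s t s'`: with word bound `W`, the program `p` started in memory `s` halts after
exactly `t` steps with memory `s'`. -/
inductive Run (W : ℕ) : Program → State → ℕ → State → Prop
  | skip (s : State) : Run W .skip s 1 s
  | nassign (x : ℕ) (e : NExp) (s : State) (h : e.eval s ≤ W) :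
      Run W (.nassign x e) s (e.cost + 1) { s with nvar := Function.update s.nvar x (e.eval s) }
  | nstore (A : ℕ) (i e : NExp) (s : State) (hi : i.eval s ≤ W) (h : e.eval s ≤ W) :
      Run W (.nstore A i e) s (i.cost + e.cost + 1)
        { s with narr := setArr s.narr A (i.eval s) (e.eval s) }
  | rassign (x : ℕ) (e : RExp) (s : State) :
      Run W (.rassign x e) s (e.cost + 1) { s with rvar := Function.update s.rvar x (e.eval s) }
  | rstore (A : ℕ) (i : NExp) (e : RExp) (s : State) (hi : i.eval s ≤ W) :
      Run W (.rstore A i e) s (i.cost + e.cost + 1)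
        { s with rarr := setArr s.rarr A (i.eval s) (e.eval s) }
  | seq {p q : Program} {s s' s'' : State} {t t' : ℕ} (h : Run W p s t s')
      (h' : Run W q s' t' s'') : Run W (.seq p q) s (t + t') s''
  | branch_true {b : BExp} {p q : Program} {s s' : State} {t : ℕ} (hb : b.holds s)
      (h : Run W p s t s') : Run W (.branch b p q) s (b.cost + 1 + t) s'
  | branch_false {b : BExp} {p q : Program} {s s' : State} {t : ℕ} (hb : ¬ b.holds s)
      (h : Run W q s t s') : Run W (.branch b p q) s (b.cost + 1 + t) s'
  | loop_false {b : BExp} {p : Program} {s : State} (hb : ¬ b.holds s) :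
      Run W (.loop b p) s (b.cost + 1) s
  | loop_true {b : BExp} {p : Program} {s s' s'' : State} {t t' : ℕ} (hb : b.holds s)
      (h : Run W p s t s') (h' : Run W (.loop b p) s' t' s'') :
      Run W (.loop b p) s (b.cost + 1 + t + t') s''

/-! ## Input and output conventions -/

/-- The index `n * θ + i` of the ad `(θ, i)` in the row-major numbering. -/
def adIndex {k n : ℕ} (a : Ad k n) : ℕ := n * a.1 + a.2

/-- Row-major storage of a `k × n` table of reals, `0` outside. -/
noncomputable def tableArray {k n : ℕ} (f : Fin k → Fin n → ℝ) (m : ℕ) : ℝ :=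
  if h : m < k * n then f (Fin.divNat ⟨m, h⟩) (Fin.modNat ⟨m, h⟩) else 0

/-- Initial memory: the natural-number variables `0` and `1` hold `k` and `n`, the real arrays `0`
and `1` hold the values and the discounts, and everything else is `0`. -/
noncomputable def Instance.inputState {k n : ℕ} (I : Instance k n) : State where
  nvar := fun x => if x = 0 then k else if x = 1 then n else 0
  rvar := fun _ => 0
  narr := fun _ _ => 0
  rarr := fun A => if A = 0 then tableArray I.value else
    if A = 1 then tableArray I.discount else fun _ => 0

/-- The memory `s` presents the allocation `M` and the prices `p`: entry `j` of the natural-number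
array `0` is `0` if slot `j` is empty and `1 +` the index of its ad otherwise; the real array `2`
holds the prices of the ads. -/
def IsOutput {k n : ℕ} (s : State) (M : Allocation k n) (p : Ad k n → ℝ) : Prop :=
  (∀ j : Fin n, s.narr 0 j = match M j with
    | none => 0
    | some a => adIndex a + 1) ∧
  ∀ a : Ad k n, s.rarr 2 (adIndex a) = p a

end AdTypes

namespace AdTypes

open Finset Function

/-! The optimal allocation is found by successive augmentation: slots are inserted one at a time and
each insertion follows a best exchange path. A placement is recorded only by the type of each slot
(`0` for an empty slot), because by `val_le_val_pos` the ads of a type may be shown in order.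

A vacant slot `j` can take the first unused ad of some type (`fresh`), or take the ad of a filled
slot `s`, which then becomes vacant itself (`swap`). The label `L j` is the largest total gain along
such a path. Labels are optimal slot prices: with utility `w - L` for the used ads and `0` for the
others they form a tight feasible dual (`Labels.exists_dual`). Augmenting from a new slot `x` raises
the value by `L x`, exactly as much as the dual objective grows when `x` joins the filled slots. The
same dual therefore certifies the new placement, even after reordering, and `L` is a potential for
the next exchange graph (`Dual.potential_of_val`). A potential makes the reduced lengths of
exchanges nonnegative, so the next labels come from Dijkstra's method (`Search.step`).

Once all slots are filled, one more search yields the prices. Removing the ad of slot `y` vacates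
`y`; an exchange path that avoids the ad regains `L y` (`Labels.exists_alternative`), and the dual
without the ad's utility shows that nothing more can be regained. Hence the VCG price is `L y`, and
an ad that is not shown has price `0` (`exists_optimal`).

For the running time, monotonicity lets an exchange pass through intermediate slots of the same type
without loss (`swap_le_of_adj`), so a slot needs to relax only the slots up to its nearest
neighbours of its own type. This leaves `O(nk)` relaxations per search (`sum_width_le`). The targets
of one slot form an interval, so a tournament tree is repaired in time linear in its length plus
`O(log n)` (`pullUp_ok`). There are `n + 1` searches.

In the program, the natural-number arrays `1` to `6` hold types, positions, type sizes, tree names,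
`pt` and `ps`; the real arrays `3`, `4`, `5` hold potential, labels and tree keys. Variable `2`
counts inserted slots, `5` is the extracted slot, `11` counts extractions. Stored slot names are
shifted by one so that `0` means none. -/

/-- An instance with slots, ads and types indexed by natural numbers; the types are `1, …, k`, and
`A c j`, `V c i` are the discount of slot `j` and the value of ad `i` for type `c`. -/
structure Market where
  n : ℕ
  k : ℕ
  A : ℕ → ℕ → ℝ
  V : ℕ → ℕ → ℝ
  A_anti : ∀ c, 1 ≤ c → c ≤ k → ∀ i j, i ≤ j → j < n → A c j ≤ A c i
  V_anti : ∀ c, 1 ≤ c → c ≤ k → ∀ i j, i ≤ j → j < n → V c j ≤ V c i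
  A_nonneg : ∀ c, 1 ≤ c → c ≤ k → ∀ j, j < n → 0 ≤ A c j
  V_nonneg : ∀ c, 1 ≤ c → c ≤ k → ∀ j, j < n → 0 ≤ V c j

/-! ### Type counts and positions -/

/-- Number of slots before `m` of type `c` under the type map `τ`. -/
def cnt (τ : ℕ → ℕ) (m c : ℕ) : ℕ := Nat.count (fun j => τ j = c) m

/-- Number of slots before `j` of the same type as `j`. -/
def pos (τ : ℕ → ℕ) (j : ℕ) : ℕ := cnt τ j (τ j)

theorem cnt_zero (τ : ℕ → ℕ) (c : ℕ) : cnt τ 0 c = 0 := Nat.count_zero _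

theorem cnt_succ (τ : ℕ → ℕ) (m c : ℕ) :
    cnt τ (m + 1) c = cnt τ m c + if τ m = c then 1 else 0 := Nat.count_succ _ _

theorem cnt_le (τ : ℕ → ℕ) (m c : ℕ) : cnt τ m c ≤ m := Nat.count_le _

theorem pos_lt_cnt (τ : ℕ → ℕ) {j m : ℕ} (h : j < m) : pos τ j < cnt τ m (τ j) :=
  Nat.count_strict_mono (p := fun i => τ i = τ j) rfl h

theorem pos_le (τ : ℕ → ℕ) (j : ℕ) : pos τ j ≤ j := cnt_le _ _ _

theorem pos_lt_pos (τ : ℕ → ℕ) {i j : ℕ} (h : i < j) (hc : τ i = τ j) : pos τ i < pos τ j := by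
  have := pos_lt_cnt τ h
  rwa [hc] at this

theorem pos_inj (τ : ℕ → ℕ) {i j : ℕ} (hc : τ i = τ j) (h : pos τ i = pos τ j) : i = j := by
  rcases lt_trichotomy i j with h' | h' | h'
  · have := pos_lt_pos τ h' hc; omega
  · exact h'
  · have := pos_lt_pos τ h' hc.symm; omega

theorem exists_pos_eq (τ : ℕ → ℕ) (c : ℕ) : ∀ m i, i < cnt τ m c → ∃ s < m, τ s = c ∧ pos τ s = i
  | 0, i, h => by simp [cnt_zero] at h
  | m + 1, i, h => by
    rw [cnt_succ] at h
    by_cases hi : i < cnt τ m c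
    · obtain ⟨s, hs, h1, h2⟩ := exists_pos_eq τ c m i hi
      exact ⟨s, by omega, h1, h2⟩
    · split_ifs at h with hm
      · refine ⟨m, by omega, hm, ?_⟩
        rw [pos, hm]; omega
      · omega

/-! ### Placements and rearrangement -/

namespace Market

variable (M : Market)

/-- Value of showing ad `a.2` of type `a.1` in slot `j`. -/
def w (a : ℕ × ℕ) (j : ℕ) : ℝ := M.A a.1 j * M.V a.1 a.2

/-- The first `m` slots show distinct ads: slot `j` shows the `p j`-th ad of type `τ j`, or
nothing if `τ j = 0`. -/
structure Placement (m : ℕ) (τ p : ℕ → ℕ) : Prop where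
  le : ∀ j < m, τ j ≤ M.k
  lt : ∀ j < m, τ j ≠ 0 → p j < M.n
  inj : ∀ i < m, ∀ j < m, τ i ≠ 0 → τ i = τ j → p i = p j → i = j

/-- Total value of the first `m` slots. -/
def val (m : ℕ) (τ p : ℕ → ℕ) : ℝ :=
  ∑ j ∈ range m, if τ j = 0 then 0 else M.w (τ j, p j) j

variable {M}

theorem placement_pos {τ : ℕ → ℕ} {m : ℕ} (hm : m ≤ M.n) (hk : ∀ j < m, τ j ≤ M.k) :
    M.Placement m τ (pos τ) where
  le := hk
  lt j hj _ := by have := pos_le τ j; omega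
  inj _ _ _ _ _ hc h := pos_inj τ hc h

theorem val_eq_of_eq_off {m y : ℕ} (hy : y < m) {τ τ' p p' : ℕ → ℕ}
    (h : ∀ j < m, j ≠ y → τ j = τ' j ∧ (τ j ≠ 0 → p j = p' j)) :
    M.val m τ' p' = M.val m τ p + ((if τ' y = 0 then 0 else M.w (τ' y, p' y) y) -
      (if τ y = 0 then 0 else M.w (τ y, p y) y)) := by
  unfold val
  rw [← add_sum_erase _ _ (mem_range.2 hy), ← add_sum_erase (range m) _ (mem_range.2 hy)]
  have : ∑ x ∈ (range m).erase y, (if τ' x = 0 then 0 else M.w (τ' x, p' x) x) =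
      ∑ x ∈ (range m).erase y, (if τ x = 0 then 0 else M.w (τ x, p x) x) := by
    refine sum_congr rfl fun j hj => ?_
    rw [mem_erase, mem_range] at hj
    obtain ⟨h1, h2⟩ := h j hj.2 hj.1
    rw [← h1]
    split_ifs with h0
    · rfl
    · rw [h2 h0]
  rw [this]; ring

/-- Rearrangement: for a given type map it is best to show the ads of a type in order. -/
theorem val_le_val_pos {τ : ℕ → ℕ} : ∀ m ≤ M.n, ∀ p, M.Placement m τ p →
    M.val m τ p ≤ M.val m τ (pos τ)
  | 0, _, p, _ => by simp [val]
  | m + 1, hm, p, hp => by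
    have key : ∀ p', M.Placement m τ p' → M.val m τ p' ≤ M.val m τ (pos τ) :=
      val_le_val_pos m (by omega)
    have hpm : M.Placement m τ p :=
      ⟨fun j hj => hp.le j (by omega), fun j hj => hp.lt j (by omega),
        fun i hi j hj => hp.inj i (by omega) j (by omega)⟩
    have hs : ∀ q, M.val (m + 1) τ q =
        M.val m τ q + if τ m = 0 then 0 else M.w (τ m, q m) m := fun q => sum_range_succ _ _
    rw [hs, hs]
    by_cases h0 : τ m = 0
    · simpa [h0] using key p hpm
    simp only [h0, if_false]
    set c := τ m with hc
    have hc1 : 1 ≤ c := by omega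
    have hck : c ≤ M.k := hp.le m (by omega)
    have hpn : p m < M.n := hp.lt m (by omega) h0
    have hAm := M.A_nonneg c hc1 hck m (by omega)
    by_cases hr : pos τ m ≤ p m
    · have := M.V_anti c hc1 hck _ _ hr hpn
      have h2 := mul_le_mul_of_nonneg_left this hAm
      have := key p hpm
      simp only [w]
      linarith
    push Not at hr
    -- Pigeonhole: the `pos τ m + 1` slots of type `c` up to `m` show distinct ads, so their indices
    -- cannot all be below `pos τ m`. The index in slot `m` is, hence some earlier one is not.
    obtain ⟨y, hy, hyc, hyr⟩ : ∃ y < m, τ y = c ∧ pos τ m ≤ p y := by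
      by_contra! hcon
      have hcard : ((range (m + 1)).filter (fun j => τ j = c)).card ≤ (range (pos τ m)).card := by
        refine card_le_card_of_injOn p ?_ ?_
        · intro j hj
          simp only [coe_filter, mem_range, Set.mem_ofPred_eq] at hj
          simp only [coe_range, Set.mem_Iio]
          rcases Nat.lt_succ_iff_lt_or_eq.1 hj.1 with h | h
          · exact hcon j h hj.2
          · rw [h]; exact hr
        · intro i hi j hj hij
          simp only [coe_filter, mem_range, Set.mem_ofPred_eq] at hi hj
          exact hp.inj i hi.1 j hj.1 (by omega) (by omega) hij
      rw [← Nat.count_eq_card_filter_range, card_range] at hcard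
      have : cnt τ (m + 1) c = pos τ m + 1 := by rw [cnt_succ, if_pos hc.symm]; rfl
      unfold cnt at this
      omega
    have hpy : p y < M.n := hp.lt y (by omega) (by omega)
    have hp' : M.Placement m τ (update p y (p m)) := by
      refine ⟨hpm.le, fun j hj h => ?_, fun i hi j hj h hij h' => ?_⟩
      · by_cases hjy : j = y
        · subst hjy; simpa using hpn
        · simpa [hjy] using hpm.lt j hj h
      · by_cases hiy : i = y <;> by_cases hjy : j = y
        · omega
        · subst hiy
          simp only [update_self, update_of_ne hjy] at h'
          have := hp.inj m (by omega) j (by omega) h0 (by omega) h'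
          omega
        · subst hjy
          simp only [update_self, update_of_ne hiy] at h'
          have := hp.inj i (by omega) m (by omega) h (by omega) h'
          omega
        · simp only [update_of_ne hjy, update_of_ne hiy] at h'
          exact hpm.inj i hi j hj h hij h'
    have h1 := key _ hp'
    rw [val_eq_of_eq_off (p := p) (τ := τ) hy
      (fun j _ hj => ⟨rfl, fun _ => by rw [update_of_ne hj]⟩)] at h1
    have hc0 : c ≠ 0 := h0
    simp only [hc0, if_false, update_self, w, hyc] at h1
    simp only [w]
    have hV1 := M.V_anti c hc1 hck _ _ (le_trans hr.le hyr) hpy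
    have hV2 := M.V_anti c hc1 hck _ _ hyr hpy
    have hA := M.A_anti c hc1 hck y m hy.le (by omega)
    -- Moving the better ad `p m` to `y` gains at least as much as slot `m` loses by falling from `p
    -- m` to `pos τ m`: the discount at `y` is no smaller, and the ad that `y` gives up is no better
    -- than `pos τ m`.
    nlinarith [mul_nonneg (sub_nonneg.2 hA) (sub_nonneg.2 hV1),
      mul_nonneg hAm (sub_nonneg.2 hV2)]

/-! ### Linear programming duality -/

variable (M)

/-- All ads. -/
def ads : Finset (ℕ × ℕ) := Icc 1 M.k ×ˢ range M.n

variable {M}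

theorem mem_ads {a : ℕ × ℕ} : a ∈ M.ads ↔ (1 ≤ a.1 ∧ a.1 ≤ M.k) ∧ a.2 < M.n := by
  simp [ads, mem_product]

theorem Placement.mem_ads {τ p : ℕ → ℕ} (h : M.Placement M.n τ p) {j : ℕ} (hj : j < M.n)
    (h0 : τ j ≠ 0) : (τ j, p j) ∈ M.ads :=
  Market.mem_ads.2 ⟨⟨by dsimp only; omega, h.le j hj⟩, h.lt j hj h0⟩

/-- The slots that show an ad. -/
def filled (M : Market) (τ : ℕ → ℕ) : Finset ℕ := (range M.n).filter (fun j => τ j ≠ 0)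

theorem mem_filled {τ : ℕ → ℕ} {j : ℕ} : j ∈ M.filled τ ↔ j < M.n ∧ τ j ≠ 0 := by
  simp [filled]

theorem val_eq_sum_filled (τ p : ℕ → ℕ) :
    M.val M.n τ p = ∑ j ∈ M.filled τ, M.w (τ j, p j) j := by
  rw [val, filled, sum_filter]
  refine sum_congr rfl fun j _ => ?_
  by_cases h : τ j = 0 <;> simp [h]

theorem Placement.sum_image {τ p : ℕ → ℕ} (h : M.Placement M.n τ p) (U : ℕ × ℕ → ℝ) :
    ∑ a ∈ (M.filled τ).image (fun j => (τ j, p j)), U a = ∑ j ∈ M.filled τ, U (τ j, p j) := by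
  refine Finset.sum_image ?_
  intro i hi j hj hij
  rw [mem_coe, mem_filled] at hi hj
  simp only [Prod.mk.injEq] at hij
  exact h.inj i hi.1 j hj.1 hi.2 hij.1 hij.2

theorem Placement.image_subset {τ p : ℕ → ℕ} (h : M.Placement M.n τ p) :
    (M.filled τ).image (fun j => (τ j, p j)) ⊆ M.ads := by
  intro a ha
  obtain ⟨j, hj, rfl⟩ := mem_image.1 ha
  rw [mem_filled] at hj
  exact h.mem_ads hj.1 hj.2

variable (M)

/-- Slot prices `π` and ad utilities `U` that are dual feasible. -/
structure DualFeasible (π : ℕ → ℝ) (U : ℕ × ℕ → ℝ) : Prop where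
  nonneg : ∀ a ∈ M.ads, 0 ≤ U a
  le : ∀ a ∈ M.ads, ∀ j < M.n, M.w a j ≤ π j + U a

variable {M}

/-- Weak duality. The set `X` of permitted ads is all of `M.ads` for optimality, and `M.ads` without
one ad for the VCG price. -/
theorem DualFeasible.val_le {π : ℕ → ℝ} {U : ℕ × ℕ → ℝ} (h : M.DualFeasible π U) {τ p : ℕ → ℕ}
    (hp : M.Placement M.n τ p) (X : Finset (ℕ × ℕ)) (hX : X ⊆ M.ads)
    (hpX : ∀ j < M.n, τ j ≠ 0 → (τ j, p j) ∈ X) :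
    M.val M.n τ p ≤ ∑ j ∈ M.filled τ, π j + ∑ a ∈ X, U a := by
  rw [val_eq_sum_filled]
  calc _ ≤ ∑ j ∈ M.filled τ, (π j + U (τ j, p j)) := by
        refine sum_le_sum fun j hj => ?_
        rw [mem_filled] at hj
        exact h.le _ (hp.mem_ads hj.1 hj.2) j hj.1
    _ = ∑ j ∈ M.filled τ, π j + ∑ a ∈ (M.filled τ).image (fun j => (τ j, p j)), U a := by
        rw [hp.sum_image, sum_add_distrib]
    _ ≤ _ := by
        refine add_le_add le_rfl
          (sum_le_sum_of_subset_of_nonneg (fun a ha => ?_) fun a ha _ => h.nonneg a (hX ha))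
        obtain ⟨j, hj, rfl⟩ := mem_image.1 ha
        rw [mem_filled] at hj
        exact hpX j hj.1 hj.2

/-- Complementary slackness. -/
theorem DualFeasible.slackness {π : ℕ → ℝ} {U : ℕ × ℕ → ℝ} (h : M.DualFeasible π U)
    {τ p : ℕ → ℕ} (hp : M.Placement M.n τ p)
    (hval : ∑ j ∈ M.filled τ, π j + ∑ a ∈ M.ads, U a ≤ M.val M.n τ p) :
    (∀ j < M.n, τ j ≠ 0 → M.w (τ j, p j) j = π j + U (τ j, p j)) ∧
    ∀ a ∈ M.ads, (∀ j < M.n, τ j ≠ 0 → a ≠ (τ j, p j)) → U a = 0 := by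
  rw [val_eq_sum_filled, ← sum_sdiff hp.image_subset, hp.sum_image] at hval
  have h1 : ∀ j ∈ M.filled τ, 0 ≤ π j + U (τ j, p j) - M.w (τ j, p j) j := by
    intro j hj
    rw [mem_filled] at hj
    have := h.le _ (hp.mem_ads hj.1 hj.2) j hj.1
    linarith
  have h2 : ∀ a ∈ M.ads \ (M.filled τ).image (fun j => (τ j, p j)), 0 ≤ U a :=
    fun a ha => h.nonneg a (mem_sdiff.1 ha).1
  have e1 := sum_nonneg h1
  have e2 := sum_nonneg h2
  have e3 : ∑ j ∈ M.filled τ, (π j + U (τ j, p j) - M.w (τ j, p j) j) =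
      ∑ j ∈ M.filled τ, π j + ∑ j ∈ M.filled τ, U (τ j, p j) -
        ∑ j ∈ M.filled τ, M.w (τ j, p j) j := by
    rw [sum_sub_distrib, sum_add_distrib]
  have z1 := (sum_eq_zero_iff_of_nonneg h1).1 (by linarith)
  have z2 := (sum_eq_zero_iff_of_nonneg h2).1 (by linarith)
  refine ⟨fun j hj h0 => ?_, fun a ha hne => ?_⟩
  · have := z1 j (mem_filled.2 ⟨hj, h0⟩)
    linarith
  · refine z2 a (mem_sdiff.2 ⟨ha, fun hmem => ?_⟩)
    obtain ⟨j, hj, rfl⟩ := mem_image.1 hmem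
    rw [mem_filled] at hj
    exact hne j hj.1 hj.2 rfl

/-! ### The exchange graph, its potentials and labels -/

variable (M)

/-- Value that slot `j` gets from the first unused ad of type `c`. -/
noncomputable def fresh (τ : ℕ → ℕ) (c j : ℕ) : ℝ :=
  if cnt τ M.n c < M.n then M.A c j * M.V c (cnt τ M.n c) else 0

/-- Gain if `j` takes the ad of slot `s`, which afterwards gains `L s`. -/
def swap (τ : ℕ → ℕ) (L : ℕ → ℝ) (s j : ℕ) : ℝ :=
  (M.A (τ s) j - M.A (τ s) s) * M.V (τ s) (pos τ s) + L s

/-- No slot strictly between `s` and `j` has the type of `s`. -/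
def Adj (τ : ℕ → ℕ) (s j : ℕ) : Prop := ∀ t, (s < t ∧ t < j) ∨ (j < t ∧ t < s) → τ t ≠ τ s

/-- `π` is a potential for the exchange graph of `τ`. -/
structure Potential (τ : ℕ → ℕ) (π : ℕ → ℝ) : Prop where
  swap_le : ∀ s < M.n, τ s ≠ 0 → ∀ j < M.n, M.swap τ π s j ≤ π j
  le : ∀ s < M.n, τ s ≠ 0 → π s ≤ M.w (τ s, pos τ s) s
  fresh_le : ∀ s < M.n, τ s ≠ 0 → ∀ c, 1 ≤ c → c ≤ M.k → M.fresh τ c s ≤ π s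

/-- The result of the search: `L j` is the largest gain on a path from `j` in the exchange graph,
and `pt j`, `ps j` describe the first step of such a path, along which `rk` decreases. -/
structure Labels (τ : ℕ → ℕ) (L : ℕ → ℝ) (pt ps rk : ℕ → ℕ) : Prop where
  fresh_le : ∀ j < M.n, ∀ c, 1 ≤ c → c ≤ M.k → M.fresh τ c j ≤ L j
  swap_le : ∀ s < M.n, τ s ≠ 0 → ∀ j < M.n, Adj τ s j → M.swap τ L s j ≤ L j
  parent : ∀ j < M.n, (ps j = 0 ∧ 1 ≤ pt j ∧ pt j ≤ M.k ∧ L j = M.fresh τ (pt j) j) ∨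
    ∃ s < M.n, ps j = s + 1 ∧ τ s ≠ 0 ∧ pt j = τ s ∧ L j = M.swap τ L s j ∧ rk s < rk j
  rk_lt : ∀ j < M.n, rk j < M.n

variable {M}

theorem fresh_nonneg {τ : ℕ → ℕ} {c j : ℕ} (h1 : 1 ≤ c) (hk : c ≤ M.k) (hj : j < M.n) :
    0 ≤ M.fresh τ c j := by
  unfold fresh
  split_ifs with h
  · exact mul_nonneg (M.A_nonneg c h1 hk j hj) (M.V_nonneg c h1 hk _ h)
  · exact le_rfl

/-- Feasibility between adjacent slots implies feasibility between all slots. -/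
theorem swap_le_of_adj {τ : ℕ → ℕ} (hτ : ∀ j < M.n, τ j ≤ M.k) {L : ℕ → ℝ}
    (h : ∀ s < M.n, τ s ≠ 0 → ∀ j < M.n, Adj τ s j → M.swap τ L s j ≤ L j) :
    ∀ d, ∀ s < M.n, τ s ≠ 0 → ∀ j < M.n, (s - j) + (j - s) ≤ d → M.swap τ L s j ≤ L j := by
  intro d
  induction d with
  | zero =>
    intro s hs h0 j hj hd
    exact h s hs h0 j hj fun t ht => by omega
  | succ d ih =>
    intro s hs h0 j hj hd
    by_cases hadj : Adj τ s j
    · exact h s hs h0 j hj hadj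
    simp only [Adj, not_forall, not_not] at hadj
    obtain ⟨t, ht, htc⟩ := hadj
    have htn : t < M.n := by omega
    have e1 := ih s hs h0 t htn (by omega)
    have e2 := ih t htn (by omega) j hj (by omega)
    have hc1 : 1 ≤ τ s := by omega
    have hck := hτ s hs
    simp only [swap, htc] at e1 e2 ⊢
    rcases ht with ht | ht
    · have hV := M.V_anti (τ s) hc1 hck _ _ (pos_lt_pos τ ht.1 htc.symm).le
        (by have := pos_le τ t; omega)
      have hA := M.A_anti (τ s) hc1 hck t j ht.2.le hj
      -- The detour through `t` exceeds the direct exchange by the product of a drop in discount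
      -- from `t` to `j` and a drop in value from the ad of `s` to that of `t`. In the other
      -- direction both factors change sign.
      nlinarith [mul_nonneg (sub_nonneg.2 hA) (sub_nonneg.2 hV)]
    · have hV := M.V_anti (τ s) hc1 hck _ _ (pos_lt_pos τ ht.2 htc).le
        (by have := pos_le τ s; omega)
      have hA := M.A_anti (τ s) hc1 hck j t ht.1.le htn
      nlinarith [mul_nonneg (sub_nonneg.2 hA) (sub_nonneg.2 hV)]

theorem Labels.swap_le_all {τ : ℕ → ℕ} (hτ : ∀ j < M.n, τ j ≤ M.k) {L : ℕ → ℝ} {pt ps rk : ℕ → ℕ}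
    (hL : M.Labels τ L pt ps rk) {s : ℕ} (hs : s < M.n) (h0 : τ s ≠ 0) {j : ℕ} (hj : j < M.n) :
    M.swap τ L s j ≤ L j :=
  swap_le_of_adj hτ hL.swap_le _ s hs h0 j hj le_rfl

/-- A label is the gain of an actual path, and the potential dominates every step of it; the
induction follows the parents, whose ranks decrease. -/
theorem Labels.le_potential {τ : ℕ → ℕ} {π L : ℕ → ℝ} {pt ps rk : ℕ → ℕ}
    (hL : M.Labels τ L pt ps rk) (hπ : M.Potential τ π) :
    ∀ r, ∀ j < M.n, τ j ≠ 0 → rk j < r → L j ≤ π j := by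
  intro r
  induction r with
  | zero => intro j _ _ h; omega
  | succ r ih =>
    intro j hj h0 hr
    rcases hL.parent j hj with ⟨_, h1, hk, h⟩ | ⟨s, hs, _, hs0, _, h, hrk⟩
    · rw [h]; exact hπ.fresh_le j hj h0 _ h1 hk
    · have h1 := ih s hs hs0 (by omega)
      have h2 := hπ.swap_le s hs hs0 j hj
      rw [h]
      unfold swap at h2 ⊢
      linarith

variable (M)

/-- Optimal duals for the placement given by `τ`. -/
structure Dual (τ : ℕ → ℕ) (π : ℕ → ℝ) (U : ℕ × ℕ → ℝ) : Prop extends M.DualFeasible π U where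
  tight : ∀ j < M.n, τ j ≠ 0 → M.w (τ j, pos τ j) j = π j + U (τ j, pos τ j)
  unused : ∀ a ∈ M.ads, cnt τ M.n a.1 ≤ a.2 → U a = 0

variable {M}

/-- Utilities are `w - L` on used ads and `0` elsewhere. They are nonnegative since `L ≤ π ≤ w` on
filled slots. Feasibility for a used ad is the `swap` inequality, and for an unused ad the `fresh`
inequality, because the first unused ad of a type is the best unused one. -/
theorem Labels.exists_dual {τ : ℕ → ℕ} (hτ : ∀ j < M.n, τ j ≤ M.k) {π L : ℕ → ℝ}
    {pt ps rk : ℕ → ℕ} (hL : M.Labels τ L pt ps rk) (hπ : M.Potential τ π) :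
    ∃ U, M.Dual τ L U := by
  classical
  let P : ℕ × ℕ → Prop := fun a => ∃ s < M.n, τ s = a.1 ∧ pos τ s = a.2
  let U : ℕ × ℕ → ℝ := fun a => if h : P a then M.w a h.choose - L h.choose else 0
  have hU : ∀ s < M.n, U (τ s, pos τ s) = M.w (τ s, pos τ s) s - L s := by
    intro s hs
    have h : P (τ s, pos τ s) := ⟨s, hs, rfl, rfl⟩
    have hs' : h.choose = s := pos_inj τ h.choose_spec.2.1 h.choose_spec.2.2
    simp only [U, dif_pos h, hs']
  have hU0 : ∀ a, ¬ P a → U a = 0 := fun a h => by simp only [U, dif_neg h]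
  have hP : ∀ a, a.2 < cnt τ M.n a.1 → P a := fun a h => by
    obtain ⟨s, hs, h1, h2⟩ := exists_pos_eq τ a.1 M.n a.2 h
    exact ⟨s, hs, h1, h2⟩
  have hP' : ∀ a, P a → a.2 < cnt τ M.n a.1 := by
    rintro a ⟨s, hs, h1, h2⟩
    rw [← h1, ← h2]
    exact pos_lt_cnt τ hs
  refine ⟨U, ⟨⟨fun a ha => ?_, fun a ha j hj => ?_⟩, fun j hj h0 => ?_, fun a ha h => ?_⟩⟩
  · by_cases h : P a
    · obtain ⟨s, hs, h1, h2⟩ := h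
      have h0 : τ s ≠ 0 := by have := (mem_ads.1 ha).1.1; omega
      have := hU s hs
      rw [h1, h2] at this
      have e1 := hL.le_potential hπ _ s hs h0 (Nat.lt_succ_self _)
      have e2 := hπ.le s hs h0
      rw [h1, h2] at e2
      rw [show a = (a.1, a.2) from rfl, this]
      linarith
    · rw [hU0 a h]
  · obtain ⟨⟨ha1, hak⟩, han⟩ := mem_ads.1 ha
    by_cases h : P a
    · obtain ⟨s, hs, h1, h2⟩ := h
      have h0 : τ s ≠ 0 := by omega
      have e := hU s hs
      have e2 := hL.swap_le_all hτ hs h0 hj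
      rw [h1, h2] at e
      rw [show a = (a.1, a.2) from rfl, e]
      simp only [swap, h1, h2, w] at e2 ⊢
      linarith
    · have hge : cnt τ M.n a.1 ≤ a.2 := by
        by_contra hcon
        exact h (hP a (by omega))
      have e := hL.fresh_le j hj a.1 ha1 hak
      rw [fresh, if_pos (by omega)] at e
      rw [hU0 a h, w]
      have := mul_le_mul_of_nonneg_left (M.V_anti a.1 ha1 hak _ _ hge han)
        (M.A_nonneg a.1 ha1 hak j hj)
      linarith
  · rw [hU j hj]; ring
  · refine hU0 a fun hcon => ?_
    have := hP' a hcon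
    omega

/-- Strong duality: shown ads are tight and ads that are not shown have utility `0`. -/
theorem Dual.val_eq {τ : ℕ → ℕ} (hτ : ∀ j < M.n, τ j ≤ M.k) {π : ℕ → ℝ} {U : ℕ × ℕ → ℝ}
    (h : M.Dual τ π U) :
    M.val M.n τ (pos τ) = ∑ j ∈ M.filled τ, π j + ∑ a ∈ M.ads, U a := by
  have hp := placement_pos le_rfl hτ
  rw [val_eq_sum_filled, ← sum_sdiff hp.image_subset, hp.sum_image]
  have : ∑ a ∈ M.ads \ (M.filled τ).image (fun j => (τ j, pos τ j)), U a = 0 := by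
    refine sum_eq_zero fun a ha => ?_
    rw [mem_sdiff] at ha
    refine h.unused a ha.1 ?_
    by_contra hcon
    obtain ⟨s, hs, h1, h2⟩ := exists_pos_eq τ a.1 M.n a.2 (by omega)
    refine ha.2 (mem_image.2 ⟨s, mem_filled.2 ⟨hs, ?_⟩, ?_⟩)
    · have := (mem_ads.1 ha.1).1.1; omega
    · rw [h1, h2]
  rw [this, zero_add, ← sum_add_distrib]
  refine sum_congr rfl fun j hj => ?_
  rw [mem_filled] at hj
  exact h.tight j hj.1 hj.2

/-! ### Exchanges along a path -/

variable (M)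

/-- An intermediate state of the exchanges along a path: slot `y` is vacant, the slots that come
later on a path still show what `τ` prescribes, and only ads used by `τ` are shown. -/
structure Exchange (τ rk σ p : ℕ → ℕ) (y : ℕ) : Prop where
  lt : y < M.n
  place : M.Placement M.n (update σ y 0) p
  eq : ∀ z < M.n, rk z < rk y → σ z = τ z ∧ (τ z ≠ 0 → p z = pos τ z)
  used : ∀ j < M.n, j ≠ y → σ j ≠ 0 → p j < cnt τ M.n (σ j)

variable {M}

/-- The ad with index `cnt τ M.n c` is shown nowhere, since every ad in an exchange state is one
that `τ` uses. -/
theorem Exchange.finish {τ rk σ p : ℕ → ℕ} {y c : ℕ} (h : M.Exchange τ rk σ p y) (h1 : 1 ≤ c)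
    (hk : c ≤ M.k) (hc : cnt τ M.n c < M.n) :
    M.Placement M.n (update σ y c) (update p y (cnt τ M.n c)) ∧
    M.val M.n (update σ y c) (update p y (cnt τ M.n c)) =
      M.val M.n (update σ y 0) p + M.fresh τ c y := by
  constructor
  · refine ⟨fun j hj => ?_, fun j hj h0 => ?_, fun i hi j hj h0 hij hp => ?_⟩
    · by_cases hjy : j = y
      · simpa [hjy] using hk
      · have := h.place.le j hj
        simpa [hjy] using this
    · by_cases hjy : j = y
      · simpa [hjy] using hc
      · have := h.place.lt j hj
        simp only [update_of_ne hjy] at this h0 ⊢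
        exact this h0
    · by_cases hiy : i = y <;> by_cases hjy : j = y
      · omega
      · subst hiy
        simp only [update_self, update_of_ne hjy] at hij hp
        have := h.used j hj hjy (by omega)
        rw [← hij] at this
        omega
      · subst hjy
        simp only [update_self, update_of_ne hiy] at hij hp h0
        have := h.used i hi hiy h0
        rw [hij] at this
        omega
      · have := h.place.inj i hi j hj
        simp only [update_of_ne hiy, update_of_ne hjy] at this h0 hij hp
        exact this h0 hij hp
  · rw [val_eq_of_eq_off (τ := update σ y 0) (p := p) h.lt]
    · have : c ≠ 0 := by omega
      simp [this, fresh, hc, w]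
    · intro j _ hjy
      simp [hjy]

/-- The vacancy moves from `y` to `z`, which still shows its original ad because its rank is lower.
When `z` is the parent of `y`, the value plus the label of the vacant slot is conserved. -/
theorem Exchange.step {τ rk σ p : ℕ → ℕ} {y z : ℕ} (h : M.Exchange τ rk σ p y) (hz : z < M.n)
    (h0 : τ z ≠ 0) (hrk : rk z < rk y) (L : ℕ → ℝ) :
    M.Exchange τ rk (update σ y (τ z)) (update p y (pos τ z)) z ∧
    M.val M.n (update (update σ y (τ z)) z 0) (update p y (pos τ z)) + L z =
      M.val M.n (update σ y 0) p + M.swap τ L z y := by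
  have hzy : z ≠ y := by rintro rfl; omega
  obtain ⟨ez, ep⟩ := h.eq z hz hrk
  have ep := ep h0
  constructor
  · refine ⟨hz, ⟨fun j hj => ?_, fun j hj hj0 => ?_, fun i hi j hj hi0 hij hp => ?_⟩,
      fun x hx hxz => ?_, fun j hj hjz hj0 => ?_⟩
    · by_cases hjz : j = z
      · simp [hjz]
      · by_cases hjy : j = y
        · have := h.place.le z hz
          simp only [update_of_ne hzy, ez] at this
          simpa [hjz, hjy, Ne.symm hzy] using this
        · have := h.place.le j hj
          simpa [hjz, hjy] using this
    · by_cases hjz : j = z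
      · simp [hjz] at hj0
      · by_cases hjy : j = y
        · subst hjy
          have := pos_le τ z
          simp only [update_self]
          omega
        · have := h.place.lt j hj
          simp only [update_of_ne hjy, update_of_ne hjz] at this hj0 ⊢
          exact this hj0
    · have hiz : i ≠ z := by rintro rfl; simp at hi0
      have hjz : j ≠ z := by
        rintro rfl
        rw [hij] at hi0; simp at hi0
      by_cases hiy : i = y <;> by_cases hjy : j = y
      · omega
      · subst hiy
        simp only [update_self, update_of_ne hiz, update_of_ne hjz, update_of_ne hjy] at hij hp
        have := h.place.inj z hz j hj
        simp only [update_of_ne hzy, update_of_ne hjy] at this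
        have := this (by omega) (by omega) (by omega)
        omega
      · subst hjy
        simp only [update_self, update_of_ne hiz, update_of_ne hjz, update_of_ne hiy] at hij hp hi0
        have := h.place.inj i hi z hz
        simp only [update_of_ne hzy, update_of_ne hiy] at this
        have := this (by omega) (by omega) (by omega)
        omega
      · have := h.place.inj i hi j hj
        simp only [update_of_ne hiy, update_of_ne hjy, update_of_ne hiz, update_of_ne hjz]
          at this hi0 hij hp
        exact this hi0 hij hp
    · have hxy : x ≠ y := by rintro rfl; omega
      simp only [update_of_ne hxy]
      exact h.eq x hx (by omega)
    · by_cases hjy : j = y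
      · subst hjy
        simpa using pos_lt_cnt τ hz
      · simp only [update_of_ne hjy] at hj0 ⊢
        exact h.used j hj hjy hj0
  · rw [val_eq_of_eq_off (τ := update σ y (τ z)) (p := update p y (pos τ z)) hz
        (fun j _ hjz => by simp [hjz]),
      val_eq_of_eq_off (τ := update σ y 0) (p := p) h.lt (fun j _ hjy => by simp [hjy])]
    simp only [update_self, update_of_ne hzy, h0, ez, ep, if_false, if_true, w, swap]
    ring

/-- Following the parents from the vacant slot `y` realizes the gain `L y`. The ad `a` never
reappears: it is used by `τ`, so it is not fresh, and the exchanges only move ads that are shown in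
other slots. -/
theorem Labels.exists_alternative {τ : ℕ → ℕ} {L : ℕ → ℝ} {pt ps rk : ℕ → ℕ}
    (hL : M.Labels τ L pt ps rk) (a : ℕ × ℕ) (ha : a.2 < cnt τ M.n a.1) :
    ∀ r, ∀ σ p y, M.Exchange τ rk σ p y → rk y < r →
    (∀ j < M.n, j ≠ y → σ j ≠ 0 → (σ j, p j) ≠ a) →
    ∃ σ' p', M.Placement M.n σ' p' ∧ M.val M.n σ' p' = M.val M.n (update σ y 0) p + L y ∧
      ∀ j < M.n, σ' j ≠ 0 → (σ' j, p' j) ≠ a := by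
  intro r
  induction r with
  | zero => intro σ p y _ h; omega
  | succ r ih =>
    intro σ p y h hr hav
    rcases hL.parent y h.lt with ⟨_, h1, hk, e⟩ | ⟨z, hz, _, hz0, _, e, hrk⟩
    · by_cases hc : cnt τ M.n (pt y) < M.n
      · obtain ⟨e1, e2⟩ := h.finish h1 hk hc
        refine ⟨_, _, e1, by rw [e2, e], fun j hj hj0 => ?_⟩
        by_cases hjy : j = y
        · subst hjy
          simp only [update_self]
          rintro rfl
          exact absurd ha (lt_irrefl _)
        · simp only [update_of_ne hjy] at hj0 ⊢
          exact hav j hj hjy hj0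
      -- The type is exhausted, so `fresh` is `0` and the slot stays vacant.
      · refine ⟨_, _, h.place, by rw [e, fresh, if_neg hc, add_zero], fun j hj hj0 => ?_⟩
        have hjy : j ≠ y := by rintro rfl; simp at hj0
        simp only [update_of_ne hjy] at hj0 ⊢
        exact hav j hj hjy hj0
    · obtain ⟨e1, e2⟩ := h.step hz hz0 hrk L
      have hzy : z ≠ y := by rintro rfl; omega
      obtain ⟨σ', p', f1, f2, f3⟩ := ih _ _ z e1 (by omega) (by
        intro j hj hjz hj0
        by_cases hjy : j = y
        · subst hjy
          simp only [update_self]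
          have := hav z hz hzy
          rw [(h.eq z hz hrk).1, (h.eq z hz hrk).2 hz0] at this
          exact this hz0
        · simp only [update_of_ne hjy] at hj0 ⊢
          exact hav j hj hjy hj0)
      exact ⟨σ', p', f1, by rw [f2, e2, e], f3⟩

theorem exchange_start {τ : ℕ → ℕ} (hτ : ∀ j < M.n, τ j ≤ M.k) (rk : ℕ → ℕ) {y : ℕ}
    (hy : y < M.n) : M.Exchange τ rk τ (pos τ) y := by
  refine ⟨hy, ⟨fun j hj => ?_, fun j hj h0 => ?_, fun i hi j hj h0 hij hp => ?_⟩,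
    fun z hz _ => ⟨rfl, fun _ => rfl⟩, fun j hj _ _ => pos_lt_cnt τ hj⟩
  · by_cases hjy : j = y
    · simp [hjy]
    · simpa [hjy] using hτ j hj
  · have := pos_le τ j; omega
  · have hiy : i ≠ y := by rintro rfl; simp at h0
    have hjy : j ≠ y := by
      rintro rfl
      rw [hij] at h0; simp at h0
    simp only [update_of_ne hiy, update_of_ne hjy] at hij
    exact pos_inj τ hij hp

/-- After augmenting, the labels are a potential for the new exchange graph. -/
theorem Dual.potential_of_val {τ τ' p : ℕ → ℕ} (hτ : ∀ j < M.n, τ j ≤ M.k) {L : ℕ → ℝ}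
    {U : ℕ × ℕ → ℝ} (h : M.Dual τ L U) (hL : ∀ j < M.n, 0 ≤ L j) {x : ℕ} (hx : x < M.n) (hx0 : τ x = 0)
    (hτ' : ∀ j < M.n, τ' j ≠ 0 ↔ j = x ∨ τ j ≠ 0) (hp : M.Placement M.n τ' p)
    (hval : M.val M.n τ' p = M.val M.n τ (pos τ) + L x) : M.Potential τ' L := by
  have hτk := hp.le
  -- Reordering the ads does not lower the value, and the dual objective grows by just `L x` when
  -- `x` joins the filled slots. So the ordered placement of `τ'` attains the dual bound, and
  -- slackness applies to it.
  have hs := h.toDualFeasible.slackness (placement_pos le_rfl hτk) (by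
    have h1 := val_le_val_pos M.n le_rfl p hp
    have hf : M.filled τ' = insert x (M.filled τ) := by
      ext j
      simp only [mem_filled, mem_insert]
      constructor
      · rintro ⟨hj, hj0⟩
        rcases (hτ' j hj).1 hj0 with h | h
        · exact Or.inl h
        · exact Or.inr ⟨hj, h⟩
      · rintro (rfl | ⟨hj, hj0⟩)
        · exact ⟨hx, (hτ' j hx).2 (Or.inl rfl)⟩
        · exact ⟨hj, (hτ' j hj).2 (Or.inr hj0)⟩
    rw [hf, sum_insert (by simp [mem_filled, hx0])]
    rw [hval, h.val_eq hτ] at h1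
    linarith)
  have hpl := placement_pos (M := M) le_rfl hτk
  refine ⟨fun s hs' h0 j hj => ?_, fun s hs' h0 => ?_, fun s hs' _ c h1 hk => ?_⟩
  · have e1 := hs.1 s hs' h0
    have e2 := h.le _ (hpl.mem_ads hs' h0) j hj
    simp only [w, swap] at e1 e2 ⊢
    linarith
  · have e1 := hs.1 s hs' h0
    have := h.nonneg _ (hpl.mem_ads hs' h0)
    linarith
  · unfold fresh
    by_cases hc : cnt τ' M.n c < M.n
    · rw [if_pos hc]
      have ha : (c, cnt τ' M.n c) ∈ M.ads := mem_ads.2 ⟨⟨h1, hk⟩, hc⟩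
      have e := h.le _ ha s hs'
      rw [hs.2 _ ha] at e
      · simpa [w] using e
      · rintro j hj hj0 hcon
        simp only [Prod.mk.injEq] at hcon
        have := pos_lt_cnt τ' hj
        rw [← hcon.1, ← hcon.2] at this
        exact absurd this (lt_irrefl _)
    · rw [if_neg hc]; exact hL s hs'

/-! ### Dijkstra's search for the labels -/

variable (M)

/-- State of the search after the slots in `D` have been extracted, in the order given by `rk`. -/
structure Search (τ : ℕ → ℕ) (π L : ℕ → ℝ) (pt ps rk : ℕ → ℕ) (D : Finset ℕ) : Prop where
  fresh_le : ∀ j < M.n, ∀ c, 1 ≤ c → c ≤ M.k → M.fresh τ c j ≤ L j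
  swap_le : ∀ s ∈ D, τ s ≠ 0 → ∀ j < M.n, Adj τ s j → M.swap τ L s j ≤ L j
  parent : ∀ j < M.n, (ps j = 0 ∧ 1 ≤ pt j ∧ pt j ≤ M.k ∧ L j = M.fresh τ (pt j) j) ∨
    ∃ s ∈ D, ps j = s + 1 ∧ τ s ≠ 0 ∧ pt j = τ s ∧ L j = M.swap τ L s j ∧
      (j ∈ D → rk s < rk j)
  key_le : ∀ i ∈ D, ∀ j < M.n, j ∉ D → π i - L i ≤ π j - L j
  rk_lt : ∀ j ∈ D, rk j < D.card
  subset : D ⊆ range M.n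

variable {M}

theorem Search.labels {τ : ℕ → ℕ} {π L : ℕ → ℝ} {pt ps rk : ℕ → ℕ} {D : Finset ℕ}
    (h : M.Search τ π L pt ps rk D) (hD : M.n ≤ D.card) : M.Labels τ L pt ps rk := by
  have hDe : D = range M.n := eq_of_subset_of_card_le h.subset (by simpa using hD)
  subst hDe
  refine ⟨h.fresh_le, fun s hs => h.swap_le s (mem_range.2 hs), fun j hj => ?_, fun j hj => ?_⟩
  · rcases h.parent j hj with e | ⟨s, hs, h1, h2, h3, h4, h5⟩
    · exact Or.inl e
    · exact Or.inr ⟨s, mem_range.1 hs, h1, h2, h3, h4, h5 (mem_range.2 hj)⟩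
  · simpa using h.rk_lt j (mem_range.2 hj)

/-- The key `π j - L j` is a distance for reduced lengths. The potential makes every exchange step
nonnegative in these lengths, so relaxing from the least key creates no smaller key and extracted
labels are final. Fresh ads only provide the initial distances, so it does no harm if some keys are
negative. -/
theorem Search.step {τ : ℕ → ℕ} {π L L' : ℕ → ℝ} {pt ps rk pt' ps' : ℕ → ℕ} {D : Finset ℕ}
    (h : M.Search τ π L pt ps rk D)
    (hπ : ∀ s < M.n, τ s ≠ 0 → ∀ j < M.n, M.swap τ π s j ≤ π j)
    {s : ℕ} (hs : s < M.n) (hsD : s ∉ D)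
    (hmin : ∀ j < M.n, j ∉ D → π s - L s ≤ π j - L j)
    (hch : ∀ j < M.n, (j ∉ insert s D ∧ τ s ≠ 0 ∧ L j < M.swap τ L s j ∧
        L' j = M.swap τ L s j ∧ pt' j = τ s ∧ ps' j = s + 1) ∨
      (L' j = L j ∧ pt' j = pt j ∧ ps' j = ps j ∧
        (τ s ≠ 0 → Adj τ s j → j ∉ insert s D → M.swap τ L s j ≤ L j))) :
    M.Search τ π L' pt' ps' (update rk s D.card) (insert s D) := by
  have hcard : (insert s D).card = D.card + 1 := card_insert_of_notMem hsD
  have hDn : ∀ j ∈ D, j < M.n := fun j hj => mem_range.1 (h.subset hj)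
  have hsame : ∀ j ∈ insert s D, L' j = L j ∧ pt' j = pt j ∧ ps' j = ps j := by
    intro j hj
    have hj' : j < M.n := by
      rcases mem_insert.1 hj with rfl | hj
      · exact hs
      · exact hDn j hj
    rcases hch j hj' with e | e
    · exact absurd hj e.1
    · exact ⟨e.1, e.2.1, e.2.2.1⟩
  have hswap : ∀ i ∈ insert s D, ∀ j, M.swap τ L' i j = M.swap τ L i j := by
    intro i hi j
    unfold swap
    rw [(hsame i hi).1]
  have hLs := (hsame s (mem_insert_self _ _)).1
  have hle : ∀ j < M.n, L j ≤ L' j := by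
    intro j hj
    rcases hch j hj with e | e
    · rw [e.2.2.2.1]; exact e.2.2.1.le
    · exact e.1.ge
  have hbound : τ s ≠ 0 → ∀ j < M.n, π s - L s ≤ π j - M.swap τ L s j := by
    intro h0 j hj
    have := hπ s hs h0 j hj
    unfold swap at this ⊢
    linarith
  have hrk : ∀ j ∈ D, update rk s D.card j = rk j := by
    intro j hj
    rw [update_of_ne]
    rintro rfl
    exact hsD hj
  refine ⟨fun j hj c h1 hk => (h.fresh_le j hj c h1 hk).trans (hle j hj), fun i hi h0 j hj hadj => ?_,
    fun j hj => ?_, fun i hi j hj hjD => ?_, fun j hj => ?_, fun j hj => ?_⟩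
  · rw [hswap i hi]
    rcases mem_insert.1 hi with rfl | hi
    · by_cases hjD : j ∈ insert i D
      · rcases mem_insert.1 hjD with rfl | hjD
        · rw [hLs]; unfold swap; simp
        -- An extracted `j` has a key no larger than that of `i`, so the relaxation that is skipped
        -- could not have raised its label.
        · have e1 := h.key_le j hjD i hs hsD
          have e2 := hbound h0 j hj
          have := hle j hj
          linarith
      · rcases hch j hj with e | e
        · exact e.2.2.2.1.ge
        · exact (e.2.2.2 h0 hadj hjD).trans (hle j hj)
    · exact (h.swap_le i hi h0 j hj hadj).trans (hle j hj)
  · rcases hch j hj with e | e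
    · refine Or.inr ⟨s, mem_insert_self _ _, e.2.2.2.2.2, e.2.1, e.2.2.2.2.1, ?_,
        fun hc => absurd hc e.1⟩
      rw [hswap s (mem_insert_self _ _), e.2.2.2.1]
    · rcases h.parent j hj with f | ⟨i, hi, f1, f2, f3, f4, f5⟩
      · left
        rw [e.1, e.2.1, e.2.2.1]
        exact f
      · refine Or.inr ⟨i, mem_insert_of_mem hi, by rw [e.2.2.1, f1], f2, by rw [e.2.1, f3], ?_,
          fun hc => ?_⟩
        · rw [hswap i (mem_insert_of_mem hi), e.1, f4]
        · rw [hrk i hi]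
          rcases mem_insert.1 hc with rfl | hjD
          · rw [update_self]; exact h.rk_lt i hi
          · rw [hrk j hjD]; exact f5 hjD
  · have hjD' : j ∉ D := fun hc => hjD (mem_insert_of_mem hc)
    rw [(hsame i hi).1]
    have h1 : π i - L i ≤ π s - L s := by
      rcases mem_insert.1 hi with rfl | hi
      · exact le_rfl
      · exact h.key_le i hi s hs hsD
    rcases hch j hj with e | e
    · rw [e.2.2.2.1]
      exact h1.trans (hbound e.2.1 j hj)
    · rw [e.1]
      exact h1.trans (hmin j hj hjD')
  · rw [hcard]
    rcases mem_insert.1 hj with rfl | hj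
    · rw [update_self]; omega
    · rw [hrk j hj]
      have := h.rk_lt j hj
      omega
  · rcases mem_insert.1 hj with rfl | hj
    · exact mem_range.2 hs
    · exact h.subset hj

/-! ### Counting the relaxations of a search -/

open Classical in
/-- Number of slots to relax when `s` is extracted. -/
noncomputable def width (M : Market) (τ : ℕ → ℕ) (s : ℕ) : ℕ :=
  if τ s = 0 then 0 else ((range M.n).filter (Adj τ s)).card

/-- Double counting by target: for each slot `j` and each type, at most three slots of that type are
adjacent to `j`, namely the nearest before `j`, `j` itself and the nearest after `j`. -/
theorem sum_width_le {τ : ℕ → ℕ} (hτ : ∀ j < M.n, τ j ≤ M.k) :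
    ∑ s ∈ range M.n, M.width τ s ≤ 3 * M.n * M.k := by
  classical
  have h1 : ∑ s ∈ range M.n, M.width τ s =
      ∑ s ∈ M.filled τ, ((range M.n).filter (Adj τ s)).card := by
    rw [filled, sum_filter]
    refine sum_congr rfl fun s _ => ?_
    unfold width
    by_cases h : τ s = 0
    · simp [h]
    · simp only [h, if_false, ne_eq, not_false_eq_true, if_true]
  have h2 : ∑ s ∈ M.filled τ, ((range M.n).filter (Adj τ s)).card =
      ∑ j ∈ range M.n, ((M.filled τ).filter (fun s => Adj τ s j)).card := by
    simp only [card_filter]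
    exact sum_comm
  rw [h1, h2]
  have h3 : ∀ j ∈ range M.n, ((M.filled τ).filter (fun s => Adj τ s j)).card ≤ 3 * M.k := by
    intro j _
    have : ((M.filled τ).filter (fun s => Adj τ s j)).card ≤ (range 3 ×ˢ Icc 1 M.k).card := by
      refine card_le_card_of_injOn
        (fun s => (if s < j then 0 else if s = j then 1 else 2, τ s)) ?_ ?_
      · intro s hs
        rw [mem_coe, mem_filter, mem_filled] at hs
        have := hτ s hs.1.1
        simp only [coe_product, Set.mem_prod, mem_coe, mem_range, mem_Icc]
        refine ⟨?_, by omega, this⟩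
        split_ifs <;> omega
      · intro s hs t ht hst
        rw [mem_coe, mem_filter, mem_filled] at hs ht
        simp only [Prod.mk.injEq] at hst
        by_contra hne
        have e1 := hs.2 t
        have e2 := ht.2 s
        have : ((s < t ∧ t < j) ∨ (j < t ∧ t < s)) ∨ ((t < s ∧ s < j) ∨ (j < s ∧ s < t)) := by
          have := hst.1
          split_ifs at this <;> omega
        rcases this with h | h
        · exact e1 h hst.2.symm
        · exact e2 h hst.2
    simpa [card_product] using this
  calc _ ≤ ∑ j ∈ range M.n, 3 * M.k := sum_le_sum h3
    _ = _ := by simp; ring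

end Market

/-! ### Program logic -/

/-- `p` writes to name `x` of sort `i`: natural-number variables, natural-number arrays, real
variables and real arrays are the sorts `0`, `1`, `2`, `3`. -/
def Program.writes : Program → ℕ → ℕ → Bool
  | .skip, _, _ => false
  | .nassign y _, i, x => i == 0 && x == y
  | .nstore A _ _, i, x => i == 1 && x == A
  | .rassign y _, i, x => i == 2 && x == y
  | .rstore A _ _, i, x => i == 3 && x == A
  | .seq p q, i, x => p.writes i x || q.writes i x
  | .branch _ p q, i, x => p.writes i x || q.writes i x
  | .loop _ p, i, x => p.writes i x

/-- `s'` agrees with `s` outside the names that `p` writes to. -/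
structure Frame (p : Program) (s s' : State) : Prop where
  nvar : ∀ x, p.writes 0 x = false → s'.nvar x = s.nvar x
  narr : ∀ x, p.writes 1 x = false → s'.narr x = s.narr x
  rvar : ∀ x, p.writes 2 x = false → s'.rvar x = s.rvar x
  rarr : ∀ x, p.writes 3 x = false → s'.rarr x = s.rarr x

theorem Frame.refl (p : Program) (s : State) : Frame p s s :=
  ⟨fun _ _ => rfl, fun _ _ => rfl, fun _ _ => rfl, fun _ _ => rfl⟩

theorem Frame.trans {p q r : Program} {s s' s'' : State} (h : Frame p s s') (h' : Frame q s' s'')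
    (hr : ∀ i x, r.writes i x = false → p.writes i x = false ∧ q.writes i x = false) :
    Frame r s s'' :=
  ⟨fun x hx => (h'.nvar x (hr _ _ hx).2).trans (h.nvar x (hr _ _ hx).1),
    fun x hx => (h'.narr x (hr _ _ hx).2).trans (h.narr x (hr _ _ hx).1),
    fun x hx => (h'.rvar x (hr _ _ hx).2).trans (h.rvar x (hr _ _ hx).1),
    fun x hx => (h'.rarr x (hr _ _ hx).2).trans (h.rarr x (hr _ _ hx).1)⟩

theorem setArr_of_ne {α : Type} (m : ℕ → ℕ → α) {A B : ℕ} (i : ℕ) (v : α) (h : B ≠ A) :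
    setArr m A i v B = m B := update_of_ne h _ _

theorem setArr_self {α : Type} (m : ℕ → ℕ → α) (A i : ℕ) (v : α) :
    setArr m A i v A = update (m A) i v := update_self _ _ _

theorem setArr_apply {α : Type} (m : ℕ → ℕ → α) (A i : ℕ) (v : α) (B : ℕ) :
    setArr m A i v B = if B = A then update (m A) i v else m B := by
  by_cases h : B = A
  · subst h; simp [setArr_self]
  · simp [setArr_of_ne m i v h, h]

/-- What a program leaves unchanged is read off its syntax; preservation of a named cell then
reduces to `decide`. -/
theorem Run.frame {W : ℕ} {p : Program} {s s' : State} {t : ℕ} (h : Run W p s t s') :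
    Frame p s s' := by
  induction h with
  | skip s => exact Frame.refl _ _
  | nassign x e s h =>
    refine ⟨fun y hy => ?_, fun _ _ => rfl, fun _ _ => rfl, fun _ _ => rfl⟩
    simp only [Program.writes, beq_self_eq_true, Bool.true_and, beq_eq_false_iff_ne] at hy
    exact update_of_ne hy _ _
  | nstore A i e s hi h =>
    refine ⟨fun _ _ => rfl, fun y hy => ?_, fun _ _ => rfl, fun _ _ => rfl⟩
    simp only [Program.writes, beq_self_eq_true, Bool.true_and, beq_eq_false_iff_ne] at hy
    exact setArr_of_ne _ _ _ hy
  | rassign x e s =>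
    refine ⟨fun _ _ => rfl, fun _ _ => rfl, fun y hy => ?_, fun _ _ => rfl⟩
    simp only [Program.writes, beq_self_eq_true, Bool.true_and, beq_eq_false_iff_ne] at hy
    exact update_of_ne hy _ _
  | rstore A i e s hi =>
    refine ⟨fun _ _ => rfl, fun _ _ => rfl, fun _ _ => rfl, fun y hy => ?_⟩
    simp only [Program.writes, beq_self_eq_true, Bool.true_and, beq_eq_false_iff_ne] at hy
    exact setArr_of_ne _ _ _ hy
  | seq h h' ih ih' =>
    exact ih.trans ih' fun i x hx => by simpa [Program.writes] using hx
  | branch_true hb h ih =>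
    exact (Frame.refl _ _).trans ih fun i x hx => by
      simp only [Program.writes, Bool.or_eq_false_iff] at hx
      exact ⟨hx.1, hx.1⟩
  | branch_false hb h ih =>
    exact (Frame.refl _ _).trans ih fun i x hx => by
      simp only [Program.writes, Bool.or_eq_false_iff] at hx
      exact ⟨hx.2, hx.2⟩
  | loop_false hb => exact Frame.refl _ _
  | loop_true hb h h' ih ih' =>
    exact ih.trans ih' fun i x hx => by simpa [Program.writes] using hx

/-- With word bound `W`, the program `p` started in `s` halts within `B` steps in a memory that
satisfies `Q`. -/
def Ok (W : ℕ) (p : Program) (s : State) (B : ℕ) (Q : State → Prop) : Prop :=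
  ∃ t s', Run W p s t s' ∧ t ≤ B ∧ Q s'

variable {W : ℕ}

theorem Ok.mono {p : Program} {s : State} {B B' : ℕ} {Q Q' : State → Prop} (h : Ok W p s B Q)
    (hB : B ≤ B') (hQ : ∀ s', Frame p s s' → Q s' → Q' s') : Ok W p s B' Q' := by
  obtain ⟨t, s', h1, h2, h3⟩ := h
  exact ⟨t, s', h1, h2.trans hB, hQ s' h1.frame h3⟩

theorem Ok.seq {p q : Program} {s : State} {B B' : ℕ} {Q Q' : State → Prop} (h : Ok W p s B Q)
    (h' : ∀ s', Frame p s s' → Q s' → Ok W q s' B' Q') : Ok W (.seq p q) s (B + B') Q' := by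
  obtain ⟨t, s', h1, h2, h3⟩ := h
  obtain ⟨t', s'', h1', h2', h3'⟩ := h' s' h1.frame h3
  exact ⟨t + t', s'', .seq h1 h1', by omega, h3'⟩

theorem Ok.branch {b : BExp} {p q : Program} {s : State} {B : ℕ} {Q : State → Prop}
    (h : b.holds s → Ok W p s B Q) (h' : ¬ b.holds s → Ok W q s B Q) :
    Ok W (.branch b p q) s (b.cost + 1 + B) Q := by
  by_cases hb : b.holds s
  · obtain ⟨t, s', h1, h2, h3⟩ := h hb
    exact ⟨_, s', .branch_true hb h1, by omega, h3⟩
  · obtain ⟨t, s', h1, h2, h3⟩ := h' hb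
    exact ⟨_, s', .branch_false hb h1, by omega, h3⟩

/-- A loop with invariant `Inv r`, where `r` is the remaining time budget. -/
theorem Ok.loop {b : BExp} {p : Program} {s₀ : State} {Inv : ℕ → State → Prop}
    {Q : State → Prop}
    (hstep : ∀ r s, Frame (.loop b p) s₀ s → Inv r s → b.holds s →
      ∃ B r', b.cost + 1 + B + r' ≤ r ∧ Ok W p s B (Inv r'))
    (hexit : ∀ r s, Frame (.loop b p) s₀ s → Inv r s → ¬ b.holds s → b.cost + 1 ≤ r ∧ Q s)
    {r : ℕ} (h0 : Inv r s₀) : Ok W (.loop b p) s₀ r Q := by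
  have main : ∀ r s, Frame (.loop b p) s₀ s → Inv r s → Ok W (.loop b p) s r Q := by
    intro r
    -- Every iteration pays for its test, so the remaining budget strictly decreases; this also
    -- gives termination.
    induction r using Nat.strong_induction_on with
    | _ r ih =>
      intro s hF hI
      by_cases hb : b.holds s
      · obtain ⟨B, r', h1, t, s', h2, h3, h4⟩ := hstep r s hF hI hb
        have hF' : Frame (.loop b p) s₀ s' := hF.trans h2.frame fun i x hx => ⟨hx, hx⟩
        obtain ⟨t', s'', g1, g2, g3⟩ := ih r' (by omega) s' hF' h4
        exact ⟨_, s'', .loop_true hb h2 g1, by omega, g3⟩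
      · obtain ⟨h1, h2⟩ := hexit r s hF hI hb
        exact ⟨_, s, .loop_false hb, h1, h2⟩
  exact main r s₀ (Frame.refl _ _) h0

/-- Weakest precondition of loop-free programs. -/
def wp (W : ℕ) : Program → (State → Prop) → State → Prop
  | .skip, Q, s => Q s
  | .nassign x e, Q, s => e.eval s ≤ W ∧ Q { s with nvar := update s.nvar x (e.eval s) }
  | .nstore A i e, Q, s => i.eval s ≤ W ∧ e.eval s ≤ W ∧
      Q { s with narr := setArr s.narr A (i.eval s) (e.eval s) }
  | .rassign x e, Q, s => Q { s with rvar := update s.rvar x (e.eval s) }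
  | .rstore A i e, Q, s => i.eval s ≤ W ∧
      Q { s with rarr := setArr s.rarr A (i.eval s) (e.eval s) }
  | .seq p q, Q, s => wp W p (wp W q Q) s
  | .branch b p q, Q, s => (b.holds s → wp W p Q s) ∧ (¬ b.holds s → wp W q Q s)
  | .loop _ _, _, _ => False

/-- Running time bound for loop-free programs. -/
def Program.maxCost : Program → ℕ
  | .skip => 1
  | .nassign _ e => e.cost + 1
  | .nstore _ i e => i.cost + e.cost + 1
  | .rassign _ e => e.cost + 1
  | .rstore _ i e => i.cost + e.cost + 1
  | .seq p q => p.maxCost + q.maxCost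
  | .branch b p q => b.cost + 1 + (p.maxCost + q.maxCost)
  | .loop _ _ => 0

/-- The cost of a branch is bounded by the sum over both sides. The bound `0` for loops is harmless
because their `wp` is `False`. -/
theorem Ok.of_wp : ∀ {p : Program} {Q : State → Prop} {s : State}, wp W p Q s →
    Ok W p s p.maxCost Q
  | .skip, _, s, h => ⟨_, _, .skip s, le_rfl, h⟩
  | .nassign x e, _, s, h => ⟨_, _, .nassign x e s h.1, le_rfl, h.2⟩
  | .nstore A i e, _, s, h => ⟨_, _, .nstore A i e s h.1 h.2.1, le_rfl, h.2.2⟩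
  | .rassign x e, _, s, h => ⟨_, _, .rassign x e s, le_rfl, h⟩
  | .rstore A i e, _, s, h => ⟨_, _, .rstore A i e s h.1, le_rfl, h.2⟩
  | .seq _ q, Q, _, h => (Ok.of_wp (Q := wp W q Q) h).seq fun _ _ h' => Ok.of_wp h'
  | .branch _ _ _, _, _, h =>
    Ok.branch (fun hb => (Ok.of_wp (h.1 hb)).mono (Nat.le_add_right _ _) fun _ _ => id)
      (fun hb => (Ok.of_wp (h.2 hb)).mono (Nat.le_add_left _ _) fun _ _ => id)

theorem Ok.of_wp_le {p : Program} {Q : State → Prop} {s : State} {B : ℕ} (hB : p.maxCost ≤ B)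
    (h : wp W p Q s) : Ok W p s B Q :=
  (Ok.of_wp h).mono hB fun _ _ => id

/-- `while x < e do p; x := x + 1` -/
def forUp (x : ℕ) (e : NExp) (p : Program) : Program :=
  .loop (.not (.nle e (.var x))) (.seq p (.nassign x (.add (.var x) (.lit 1))))

theorem Ok.forUp {x : ℕ} {e : NExp} {p : Program} {s₀ : State} {I : ℕ → State → Prop}
    {N c i₀ : ℕ} (hN : N ≤ W) (hx : p.writes 0 x = false)
    (hI : ∀ i s, Frame (forUp x e p) s₀ s → I i s → s.nvar x = i ∧ e.eval s = N)
    (hbody : ∀ i s, i₀ ≤ i → i < N → Frame (AdTypes.forUp x e p) s₀ s → I i s →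
      Ok W p s c (fun s' => I (i + 1) { s' with nvar := update s'.nvar x (i + 1) }))
    (hi : i₀ ≤ N) (h0 : I i₀ s₀) :
    Ok W (AdTypes.forUp x e p) s₀ ((N - i₀) * (c + e.cost + 8) + e.cost + 4) (I N) := by
  -- One iteration costs `e.cost + 4` for the test, `c` for the body and `4` for the increment; the
  -- failing last test costs `e.cost + 4`.
  refine Ok.loop (Inv := fun r s => ∃ i, i₀ ≤ i ∧ i ≤ N ∧ I i s ∧
    r = (N - i) * (c + e.cost + 8) + e.cost + 4) ?_ ?_ ⟨i₀, le_rfl, hi, h0, rfl⟩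
  · rintro r s hF ⟨i, hi0, hiN, hIi, rfl⟩ hb
    obtain ⟨h1, h2⟩ := hI i s hF hIi
    simp only [BExp.holds, NExp.eval, h1, h2, not_le] at hb
    refine ⟨c + 4, (N - (i + 1)) * (c + e.cost + 8) + e.cost + 4, ?_, ?_⟩
    · obtain ⟨d, rfl⟩ : ∃ d, N = i + 1 + d := ⟨N - (i + 1), by omega⟩
      rw [show i + 1 + d - i = d + 1 by omega, show i + 1 + d - (i + 1) = d by omega]
      simp only [BExp.cost, NExp.cost]
      ring_nf
      omega
    · refine (hbody i s hi0 hb hF hIi).seq fun s' hF' hs' => ?_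
      have hxi : s'.nvar x = i := (hF'.nvar x hx).trans h1
      refine Ok.of_wp_le (by simp [Program.maxCost, NExp.cost]) ?_
      simp only [wp, NExp.eval, hxi]
      exact ⟨by omega, i + 1, by omega, by omega, hs', rfl⟩
  · rintro r s hF ⟨i, hi0, hiN, hIi, rfl⟩ hb
    obtain ⟨h1, h2⟩ := hI i s hF hIi
    simp only [BExp.holds, NExp.eval, h1, h2, not_not] at hb
    obtain rfl : i = N := le_antisymm hiN hb
    refine ⟨?_, hIi⟩
    simp only [BExp.cost, NExp.cost]
    omega

/-! ### Tournament trees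

The tree has leaves `n, …, 2 n - 1` and inner nodes `1, …, n - 1`; node `i` has children `2 i` and
`2 i + 1`. Node `i` holds the name `T i` (`0` if there is none) and the key `K i` of its winner. -/

/-- Node `i` holds the winner of its children. -/
def NodeOk (T : ℕ → ℕ) (K : ℕ → ℝ) (i : ℕ) : Prop :=
  (1 ≤ T (2 * i) ∧ ¬ (1 ≤ T (2 * i + 1) ∧ ¬ K (2 * i) ≤ K (2 * i + 1)) →
    T i = T (2 * i) ∧ K i = K (2 * i)) ∧
  (¬ (1 ≤ T (2 * i) ∧ ¬ (1 ≤ T (2 * i + 1) ∧ ¬ K (2 * i) ≤ K (2 * i + 1))) →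
    T i = T (2 * i + 1) ∧ K i = K (2 * i + 1))

/-- Climbing from a node to its parent keeps a name present and never raises the key. -/
theorem NodeOk.root_le {T : ℕ → ℕ} {K : ℕ → ℝ} {n : ℕ} (h : ∀ i, 1 ≤ i → i < n → NodeOk T K i) :
    ∀ i, 1 ≤ i → i < 2 * n → 1 ≤ T i → 1 ≤ T 1 ∧ K 1 ≤ K i := by
  intro i
  induction i using Nat.strong_induction_on with
  | _ i ih =>
    intro h1 h2 hT
    rcases Nat.eq_or_lt_of_le h1 with rfl | h1
    · exact ⟨hT, le_rfl⟩
    have hp := h (i / 2) (by omega) (by omega)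
    have key : 1 ≤ T (i / 2) ∧ K (i / 2) ≤ K i := by
      obtain ⟨e1, e2⟩ := hp
      rcases Nat.even_or_odd' i with ⟨d, rfl | rfl⟩
      · rw [show 2 * d / 2 = d by omega] at *
        by_cases hc : 1 ≤ T (2 * d) ∧ ¬ (1 ≤ T (2 * d + 1) ∧ ¬ K (2 * d) ≤ K (2 * d + 1))
        · rw [(e1 hc).1, (e1 hc).2]; exact ⟨hT, le_rfl⟩
        · rw [(e2 hc).1, (e2 hc).2]
          have : 1 ≤ T (2 * d + 1) ∧ ¬ K (2 * d) ≤ K (2 * d + 1) := by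
            by_contra hcon; exact hc ⟨hT, hcon⟩
          exact ⟨this.1, (not_le.1 this.2).le⟩
      · rw [show (2 * d + 1) / 2 = d by omega] at *
        by_cases hc : 1 ≤ T (2 * d) ∧ ¬ (1 ≤ T (2 * d + 1) ∧ ¬ K (2 * d) ≤ K (2 * d + 1))
        · rw [(e1 hc).1, (e1 hc).2]
          refine ⟨hc.1, ?_⟩
          by_contra hcon
          exact hc.2 ⟨hT, hcon⟩
        · rw [(e2 hc).1, (e2 hc).2]; exact ⟨hT, le_rfl⟩
    have := ih (i / 2) (by omega) (by omega) (by omega) key.1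
    exact ⟨this.1, this.2.trans key.2⟩

/-- Descend to the winning child until a leaf is reached. -/
theorem NodeOk.exists_leaf {T : ℕ → ℕ} {K : ℕ → ℝ} {n : ℕ}
    (h : ∀ i, 1 ≤ i → i < n → NodeOk T K i) :
    ∀ d i, 2 * n - i ≤ d → 1 ≤ i → i < 2 * n → ∃ l, n ≤ l ∧ l < 2 * n ∧ T l = T i ∧ K l = K i := by
  intro d
  induction d with
  | zero => intro i h1 _ h2; omega
  | succ d ih =>
    intro i h1 h2 h3
    by_cases hi : n ≤ i
    · exact ⟨i, hi, h3, rfl, rfl⟩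
    obtain ⟨e1, e2⟩ := h i h2 (by omega)
    by_cases hc : 1 ≤ T (2 * i) ∧ ¬ (1 ≤ T (2 * i + 1) ∧ ¬ K (2 * i) ≤ K (2 * i + 1))
    · rw [(e1 hc).1, (e1 hc).2]; exact ih _ (by omega) (by omega) (by omega)
    · rw [(e2 hc).1, (e2 hc).2]; exact ih _ (by omega) (by omega) (by omega)

theorem NodeOk.congr {T T' : ℕ → ℕ} {K K' : ℕ → ℝ} {i : ℕ} (h : NodeOk T K i)
    (hT : ∀ x, x = i ∨ x = 2 * i ∨ x = 2 * i + 1 → T' x = T x ∧ K' x = K x) : NodeOk T' K' i := by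
  have h1 := hT i (Or.inl rfl)
  have h2 := hT (2 * i) (Or.inr (Or.inl rfl))
  have h3 := hT (2 * i + 1) (Or.inr (Or.inr rfl))
  unfold NodeOk at h ⊢
  rw [h1.1, h1.2, h2.1, h2.2, h3.1, h3.2]
  exact h

/-- Recompute the node whose number is in variable `10`. -/
def pullNode : Program :=
  .branch (.and (.nle (.lit 1) (.get 4 (.mul (.lit 2) (.var 10))))
      (.not (.and (.nle (.lit 1) (.get 4 (.add (.mul (.lit 2) (.var 10)) (.lit 1))))
        (.not (.rle (.get 5 (.mul (.lit 2) (.var 10)))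
          (.get 5 (.add (.mul (.lit 2) (.var 10)) (.lit 1))))))))
    (.seq (.nstore 4 (.var 10) (.get 4 (.mul (.lit 2) (.var 10))))
      (.rstore 5 (.var 10) (.get 5 (.mul (.lit 2) (.var 10)))))
    (.seq (.nstore 4 (.var 10) (.get 4 (.add (.mul (.lit 2) (.var 10)) (.lit 1))))
      (.rstore 5 (.var 10) (.get 5 (.add (.mul (.lit 2) (.var 10)) (.lit 1)))))

theorem pullNode_ok {s : State} {n : ℕ} (hi : s.nvar 10 ≤ W) (hT : ∀ i, s.narr 4 i ≤ n)
    (hn : n ≤ W) :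
    Ok W pullNode s 58 (fun s' => (1 ≤ s.nvar 10 → NodeOk (s'.narr 4) (s'.rarr 5) (s.nvar 10)) ∧
      (∀ x, x ≠ s.nvar 10 → s'.narr 4 x = s.narr 4 x ∧ s'.rarr 5 x = s.rarr 5 x) ∧
      (∀ i, s'.narr 4 i ≤ n) ∧ s'.nvar = s.nvar) := by
  refine Ok.of_wp_le (by decide) ?_
  simp only [pullNode, wp, BExp.holds, NExp.eval, RExp.eval, setArr_apply, if_true]
  have hup : ∀ v, v ≤ n → ∀ i, update (s.narr 4) (s.nvar 10) v i ≤ n := by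
    intro v hv i
    by_cases h : i = s.nvar 10
    · subst h; simpa using hv
    · simpa [h] using hT i
  refine ⟨fun hc => ⟨hi, (hT _).trans hn, hi, fun h1 => ?_, fun x hx => ?_, hup _ (hT _), trivial⟩,
    fun hc => ⟨hi, (hT _).trans hn, hi, fun h1 => ?_, fun x hx => ?_, hup _ (hT _), trivial⟩⟩
  -- Node `0` would be its own left child, hence the restriction to positive nodes.
  · have e1 : 2 * s.nvar 10 ≠ s.nvar 10 := by omega
    have e2 : 2 * s.nvar 10 + 1 ≠ s.nvar 10 := by omega
    unfold NodeOk
    rw [update_of_ne e1, update_of_ne e2, update_of_ne e1, update_of_ne e2, update_self, update_self]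
    exact ⟨fun _ => ⟨rfl, rfl⟩, fun h => absurd hc h⟩
  · rw [update_of_ne hx, update_of_ne hx]; exact ⟨rfl, rfl⟩
  · have e1 : 2 * s.nvar 10 ≠ s.nvar 10 := by omega
    have e2 : 2 * s.nvar 10 + 1 ≠ s.nvar 10 := by omega
    unfold NodeOk
    rw [update_of_ne e1, update_of_ne e2, update_of_ne e1, update_of_ne e2, update_self, update_self]
    exact ⟨fun h => absurd h hc, fun _ => ⟨rfl, rfl⟩⟩
  · rw [update_of_ne hx, update_of_ne hx]; exact ⟨rfl, rfl⟩

/-- Recompute all proper ancestors of the nodes from variable `8` to variable `9`. -/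
def pullUp : Program :=
  .loop (.nle (.lit 2) (.var 9))
    (.seq (.nassign 8 (.div (.var 8) (.lit 2))) (.seq (.nassign 9 (.div (.var 9) (.lit 2)))
      (.seq (.nassign 10 (.var 8)) (forUp 10 (.add (.var 9) (.lit 1)) pullNode))))

/-- Changes in an interval of nodes can only spoil their parents, which form an interval of about
half the length. Repairing those spoils only the next interval of parents. The lengths decrease
geometrically, so the total is linear in `b - a` plus a constant for each level. -/
theorem pullUp_ok {s₀ : State} {n a b : ℕ} (ha : s₀.nvar 8 = a) (hb : s₀.nvar 9 = b) (hab : a ≤ b)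
    (hbn : b < 2 * n) (hn : 2 * n ≤ W) (hT : ∀ i, s₀.narr 4 i ≤ n)
    (hok : ∀ i, 1 ≤ i → i < n → i < a / 2 ∨ b / 2 < i → NodeOk (s₀.narr 4) (s₀.rarr 5) i) :
    Ok W pullUp s₀ (69 * (b - a) + 200 * (Nat.log 2 b + 1)) (fun s =>
      (∀ i, 1 ≤ i → i < n → NodeOk (s.narr 4) (s.rarr 5) i) ∧
      (∀ i, n ≤ i → s.narr 4 i = s₀.narr 4 i ∧ s.rarr 5 i = s₀.rarr 5 i) ∧
      ∀ i, s.narr 4 i ≤ n) := by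
  refine Ok.loop (Inv := fun r s => ∃ a b, s.nvar 8 = a ∧ s.nvar 9 = b ∧ a ≤ b ∧ b < 2 * n ∧
    (∀ i, s.narr 4 i ≤ n) ∧
    (∀ i, 1 ≤ i → i < n → i < a / 2 ∨ b / 2 < i → NodeOk (s.narr 4) (s.rarr 5) i) ∧
    (∀ i, n ≤ i → s.narr 4 i = s₀.narr 4 i ∧ s.rarr 5 i = s₀.rarr 5 i) ∧
    r = 69 * (b - a) + 200 * (Nat.log 2 b + 1)) ?_ ?_
    ⟨a, b, ha, hb, hab, hbn, hT, hok, fun _ _ => ⟨rfl, rfl⟩, rfl⟩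
  · rintro r s - ⟨a, b, ha, hb, hab, hbn, hT, hok, hle, rfl⟩ hc
    simp only [BExp.holds, NExp.eval, hb] at hc
    have hlog : Nat.log 2 b = Nat.log 2 (b / 2) + 1 := Nat.log_of_one_lt_of_le (by norm_num) hc
    refine ⟨4 + (4 + (2 + ((b / 2 + 1 - a / 2) * (58 + 3 + 8) + 3 + 4))),
      69 * (b / 2 - a / 2) + 200 * (Nat.log 2 (b / 2) + 1), ?_, ?_⟩
    · rw [hlog]
      simp only [BExp.cost, NExp.cost]
      omega
    refine Ok.seq (Q := fun s' => s' = { s with nvar := update s.nvar 8 (a / 2) })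
      (Ok.of_wp_le (by decide) ?_) ?_
    · simp only [wp, NExp.eval, ha]; exact ⟨by omega, trivial⟩
    rintro s' - rfl
    refine Ok.seq (Q := fun s' => s' =
        { s with nvar := update (update s.nvar 8 (a / 2)) 9 (b / 2) })
      (Ok.of_wp_le (by decide) ?_) ?_
    · simp [wp, NExp.eval, hb]; omega
    rintro s' - rfl
    refine Ok.seq (Q := fun s' => s' =
        { s with nvar := update (update (update s.nvar 8 (a / 2)) 9 (b / 2)) 10 (a / 2) })
      (Ok.of_wp_le (by decide) ?_) ?_
    · simp [wp, NExp.eval]; omega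
    rintro s' - rfl
    refine (Ok.forUp (N := b / 2 + 1) (i₀ := a / 2) (c := 58)
      (I := fun i t => t.nvar 10 = i ∧ t.nvar 8 = a / 2 ∧ t.nvar 9 = b / 2 ∧
        (∀ x, t.narr 4 x ≤ n) ∧
        -- Nodes of the next interval are exempt: they may have a child that this pass has yet to
        -- change.
        (∀ x, 1 ≤ x → x < n → x < i ∨ b / 2 < x → x < a / 2 / 2 ∨ b / 2 / 2 < x →
          NodeOk (t.narr 4) (t.rarr 5) x) ∧
        (∀ x, n ≤ x → t.narr 4 x = s₀.narr 4 x ∧ t.rarr 5 x = s₀.rarr 5 x))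
      (by omega) (by decide) ?_ ?_ (by omega) ?_).mono le_rfl ?_
    · rintro i t - ⟨h1, -, h2, -⟩
      exact ⟨h1, by simp [NExp.eval, h2]⟩
    · rintro i t hi0 hi1 - ⟨h1, h8, h9, hT', hok', hle'⟩
      refine (pullNode_ok (n := n) (by omega) hT' (by omega)).mono le_rfl ?_
      rintro t' - ⟨g1, g2, g3, g4⟩
      rw [h1] at g1 g2
      refine ⟨by simp, by simp [g4, h8], by simp [g4, h9], g3, fun x hx1 hxn hx hx' => ?_,
        fun x hx => ?_⟩
      · by_cases hxi : x = i
        · subst hxi; exact g1 hx1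
        · refine (hok' x hx1 hxn (by omega) hx').congr fun y hy => g2 y ?_
          omega
      · have := g2 x (by omega)
        rw [this.1, this.2]
        exact hle' x hx
    · refine ⟨by simp, by simp, by simp, hT, fun x hx1 hxn hx hx' => hok x hx1 hxn (by omega), hle⟩
    · rintro t - ⟨h1, h8, h9, hT', hok', hle'⟩
      exact ⟨a / 2, b / 2, h8, h9, by omega, by omega, hT',
        fun x hx1 hxn hx => hok' x hx1 hxn (by omega) hx, hle', rfl⟩
  · rintro r s - ⟨a, b, ha, hb, hab, hbn, hT, hok, hle, rfl⟩ hc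
    simp only [BExp.holds, NExp.eval, hb] at hc
    refine ⟨?_, fun i h1 h2 => hok i h1 h2 (by omega), hle, hT⟩
    simp only [BExp.cost, NExp.cost]
    omega

variable {M : Market}

/-! ### The search -/

/-- The memory holds the instance `M`. -/
structure Reads (M : Market) (s : State) : Prop where
  k : s.nvar 0 = M.k
  n : s.nvar 1 = M.n
  V : ∀ c i, s.rarr 0 (M.n * (c - 1) + i) = M.V c i
  A : ∀ c j, s.rarr 1 (M.n * (c - 1) + j) = M.A c j

theorem Reads.frame {s s' : State} {p : Program} (h : Reads M s) (hF : Frame p s s')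
    (hp : (p.writes 0 0 || p.writes 0 1 || p.writes 3 0 || p.writes 3 1) = false) :
    Reads M s' := by
  simp only [Bool.or_eq_false_iff] at hp
  obtain ⟨⟨⟨h0, h1⟩, h2⟩, h3⟩ := hp
  refine ⟨?_, ?_, fun c i => ?_, fun c i => ?_⟩
  · rw [hF.nvar 0 h0, h.k]
  · rw [hF.nvar 1 h1, h.n]
  · rw [hF.rarr 0 h2, h.V]
  · rw [hF.rarr 1 h3, h.A]

/-- The word bound suffices for `M`. -/
structure Fits (M : Market) (W : ℕ) : Prop where
  k_pos : 1 ≤ M.k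
  n_pos : 1 ≤ M.n
  k_le : M.k + 1 ≤ W
  n_le : 2 * M.n + 1 ≤ W
  ad_le : M.n * M.k + 1 ≤ W

/-- Expression for `M.V c i`. -/
def valAt (c i : NExp) : RExp := .get 0 (.add (.mul (.var 1) (.sub c (.lit 1))) i)

/-- Expression for `M.A c j`. -/
def discAt (c j : NExp) : RExp := .get 1 (.add (.mul (.var 1) (.sub c (.lit 1))) j)

theorem Reads.valAt {s : State} (h : Reads M s) (c i : NExp) :
    (valAt c i).eval s = M.V (c.eval s) (i.eval s) := by
  simp only [AdTypes.valAt, RExp.eval, NExp.eval, h.n, h.V]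

theorem Reads.discAt {s : State} (h : Reads M s) (c i : NExp) :
    (discAt c i).eval s = M.A (c.eval s) (i.eval s) := by
  simp only [AdTypes.discAt, RExp.eval, NExp.eval, h.n, h.A]

/-- Compute the positions of the slots within their types and the sizes of the types. -/
def countSlots : Program :=
  .seq (.nassign 4 (.lit 0)) (.seq (forUp 4 (.add (.var 0) (.lit 1)) (.nstore 3 (.var 4) (.lit 0)))
    (.seq (.nassign 3 (.lit 0)) (forUp 3 (.var 1)
      (.seq (.nstore 2 (.var 3) (.get 3 (.get 1 (.var 3))))
        (.nstore 3 (.get 1 (.var 3)) (.add (.get 3 (.get 1 (.var 3))) (.lit 1)))))))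

theorem countSlots_ok {s₀ : State} (hR : Reads M s₀) (hW : Fits M W)
    (hτ : ∀ j < M.n, s₀.narr 1 j ≤ M.k) :
    Ok W countSlots s₀ (40 * (M.k + M.n + 1)) (fun s =>
      (∀ j < M.n, s.narr 2 j = pos (s₀.narr 1) j) ∧
      ∀ c ≤ M.k, s.narr 3 c = cnt (s₀.narr 1) M.n c) := by
  obtain ⟨hW1, hW2, hW3, hW4, hW5⟩ := hW
  have main : Ok W countSlots s₀ (2 + (((M.k + 1 - 0) * (5 + 3 + 8) + 3 + 4) +
      (2 + ((M.n - 0) * (20 + 1 + 8) + 1 + 4)))) (fun s =>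
      (∀ j < M.n, s.narr 2 j = pos (s₀.narr 1) j) ∧
      ∀ c ≤ M.k, s.narr 3 c = cnt (s₀.narr 1) M.n c) := by
    refine Ok.seq (Q := fun s => s.nvar 4 = 0) (Ok.of_wp_le (by decide) ?_) ?_
    · simp [wp, NExp.eval]
    intro s1 hF1 h1
    have hR1 := hR.frame hF1 (by decide)
    refine Ok.seq (Ok.forUp (N := M.k + 1) (i₀ := 0) (c := 5)
      (I := fun i t => t.nvar 4 = i ∧ ∀ c < i, t.narr 3 c = 0) hW3 (by decide) ?_ ?_ (by omega) ?_) ?_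
    · rintro i t hF ⟨h, -⟩
      exact ⟨h, by simp [NExp.eval, hF.nvar 0 (by decide), hR1.k]⟩
    · rintro i t - hi hF ⟨h, ht⟩
      refine Ok.of_wp_le (by decide) ?_
      simp only [wp, NExp.eval, h, setArr_self, update_self, Nat.zero_le, true_and]
      refine ⟨by omega, fun c hc => ?_⟩
      by_cases hci : c = i
      · simp [hci]
      · rw [update_of_ne hci]; exact ht c (by omega)
    · exact ⟨h1, fun c hc => by omega⟩
    rintro s2 hF2 ⟨-, h2⟩
    have hR2 := hR1.frame hF2 (by decide)
    refine Ok.seq (Q := fun s => s.nvar 3 = 0 ∧ s.narr = s2.narr) (Ok.of_wp_le (by decide) ?_) ?_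
    · simp [wp, NExp.eval]
    rintro s3 hF3 ⟨h3, h3'⟩
    have hR3 := hR2.frame hF3 (by decide)
    have hτ3 : s3.narr 1 = s₀.narr 1 := by
      rw [h3', hF2.narr 1 (by decide), hF1.narr 1 (by decide)]
    refine (Ok.forUp (N := M.n) (i₀ := 0) (c := 20)
      (I := fun i t => t.nvar 3 = i ∧ (∀ j < i, t.narr 2 j = pos (s₀.narr 1) j) ∧
        ∀ c ≤ M.k, t.narr 3 c = cnt (s₀.narr 1) i c) (by omega) (by decide) ?_ ?_ (by omega) ?_).mono
        le_rfl ?_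
    · rintro i t hF ⟨h, -⟩
      exact ⟨h, by simp [NExp.eval, hF.nvar 1 (by decide), hR3.n]⟩
    · rintro i t - hi hF ⟨h, ht1, ht2⟩
      refine Ok.of_wp_le (by decide) ?_
      have e1 : t.narr 1 = s₀.narr 1 := by rw [hF.narr 1 (by decide), hτ3]
      have hk := hτ i hi
      have e2 := ht2 _ hk
      have e3 : cnt (s₀.narr 1) i (s₀.narr 1 i) ≤ i := cnt_le _ _ _
      simp only [wp, NExp.eval, h, e1, setArr_apply, e2, update_self]
      norm_num only [if_false, if_true, e1, e2]
      refine ⟨by omega, by omega, by omega, by omega, by simp, fun j hj => ?_, fun c hc => ?_⟩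
      · by_cases hji : j = i
        · subst hji; rw [update_self]; rfl
        · rw [update_of_ne hji]; exact ht1 j (by omega)
      · rw [cnt_succ]
        by_cases hci : c = s₀.narr 1 i
        · subst hci; rw [update_self, if_pos rfl]
        · rw [update_of_ne hci, if_neg (Ne.symm hci)]; exact ht2 c hc
    · refine ⟨h3, fun j hj => by omega, fun c hc => ?_⟩
      rw [h3', h2 c (by omega), cnt_zero]
    · rintro t - ⟨-, h⟩
      exact h
  refine main.mono ?_ fun _ _ => id
  omega

/-- Find the type whose first unused ad has the largest value in the slot of variable `3`. -/
def bestFresh : Program :=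
  .seq (.rassign 1 .zero) (.seq (.nassign 13 (.lit 1)) (.seq (.nassign 4 (.lit 1))
    (forUp 4 (.add (.var 0) (.lit 1))
      (.seq (.branch (.nle (.add (.get 3 (.var 4)) (.lit 1)) (.var 1))
          (.rassign 0 (.mul (discAt (.var 4) (.var 3)) (valAt (.var 4) (.get 3 (.var 4)))))
          (.rassign 0 .zero))
        (.branch (.rle (.var 1) (.var 0))
          (.seq (.rassign 1 (.var 0)) (.nassign 13 (.var 4))) .skip)))))

theorem bestFresh_ok {s₀ : State} {τ : ℕ → ℕ} (hR : Reads M s₀) (hW : Fits M W)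
    (hcnt : ∀ c ≤ M.k, s₀.narr 3 c = cnt τ M.n c) {j : ℕ} (hj : s₀.nvar 3 = j) (hjn : j < M.n) :
    Ok W bestFresh s₀ (71 * M.k + 13) (fun s =>
      1 ≤ s.nvar 13 ∧ s.nvar 13 ≤ M.k ∧ s.rvar 1 = M.fresh τ (s.nvar 13) j ∧
      ∀ c, 1 ≤ c → c ≤ M.k → M.fresh τ c j ≤ s.rvar 1) := by
  obtain ⟨hW1, hW2, hW3, hW4, hW5⟩ := hW
  refine Ok.mono (B := 2 + (2 + (2 + ((M.k + 1 - 1) * (60 + 3 + 8) + 3 + 4)))) ?_ (by omega)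
    fun _ _ => id
  refine Ok.seq (Q := fun s => s.rvar 1 = 0) (Ok.of_wp_le (by decide) ?_) ?_
  · simp [wp, RExp.eval]
  intro s1 hF1 h1
  refine Ok.seq (Q := fun s => s.nvar 13 = 1) (Ok.of_wp_le (by decide) ?_) ?_
  · simp [wp, NExp.eval]; omega
  intro s2 hF2 h2
  refine Ok.seq (Q := fun s => s.nvar 4 = 1) (Ok.of_wp_le (by decide) ?_) ?_
  · simp [wp, NExp.eval]; omega
  intro s3 hF3 h3
  have hR3 := ((hR.frame hF1 (by decide)).frame hF2 (by decide)).frame hF3 (by decide)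
  have hj3 : s3.nvar 3 = j := by
    rw [hF3.nvar 3 (by decide), hF2.nvar 3 (by decide), hF1.nvar 3 (by decide), hj]
  have hc3 : s3.narr 3 = s₀.narr 3 := by
    rw [hF3.narr 3 (by decide), hF2.narr 3 (by decide), hF1.narr 3 (by decide)]
  refine (Ok.forUp (N := M.k + 1) (i₀ := 1) (c := 60)
    (I := fun i t => t.nvar 4 = i ∧ ((i = 1 ∧ t.rvar 1 = 0 ∧ t.nvar 13 = 1) ∨
      (1 ≤ t.nvar 13 ∧ t.nvar 13 < i ∧ t.rvar 1 = M.fresh τ (t.nvar 13) j)) ∧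
      ∀ c, 1 ≤ c → c < i → M.fresh τ c j ≤ t.rvar 1) (by omega) (by decide) ?_ ?_ (by omega) ?_).mono
      le_rfl ?_
  · rintro i t hF ⟨h, -⟩
    exact ⟨h, by simp [NExp.eval, hF.nvar 0 (by decide), hR3.k]⟩
  · rintro i t hi1 hi hF ⟨h, ht, hle⟩
    have hRt := hR3.frame hF (by decide)
    have hjt : t.nvar 3 = j := by rw [hF.nvar 3 (by decide), hj3]
    have hct : t.narr 3 i = cnt τ M.n i := by
      rw [hF.narr 3 (by decide), hc3, hcnt i (by omega)]
    have hfr := Market.fresh_nonneg (M := M) (τ := τ) hi1 (show i ≤ M.k by omega) hjn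
    refine Ok.mono (B := 39 + 20) ?_ (by omega) fun _ _ => id
    refine Ok.seq (Q := fun t' => t'.rvar 0 = M.fresh τ i j ∧ t'.rvar 1 = t.rvar 1 ∧
      t'.nvar = t.nvar) (Ok.of_wp_le (by decide) ?_) ?_
    · simp only [wp, BExp.holds, NExp.eval, h, hct, hRt.n, RExp.eval, hRt.discAt, hRt.valAt, hjt]
      refine ⟨fun hc => ?_, fun hc => ?_⟩
      · simp [Market.fresh, show cnt τ M.n i < M.n by omega]
      · simp [Market.fresh, show ¬ cnt τ M.n i < M.n by omega]
    rintro t' hF' ⟨g0, g1, g2⟩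
    refine Ok.of_wp_le (by decide) ?_
    simp only [wp, BExp.holds, RExp.eval, NExp.eval, g0, g1, g2, h]
    refine ⟨fun hc => ⟨by omega, by simp, Or.inr ?_, fun c h1 hc' => ?_⟩,
      fun hc => ⟨by simp, Or.inr ?_, fun c h1 hc' => ?_⟩⟩
    · simp [hi1]
    · simp only [update_self]
      rcases Nat.lt_succ_iff_lt_or_eq.1 hc' with h' | rfl
      · exact (hle c h1 h').trans hc
      · exact le_rfl
    · rcases ht with ⟨-, e, -⟩ | ⟨e1, e2, e3⟩
      · rw [e] at hc; exact absurd hfr hc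
      · refine ⟨?_, ?_, ?_⟩ <;> simp [e1, e3]
        omega
    · rcases Nat.lt_succ_iff_lt_or_eq.1 hc' with h' | rfl
      · exact hle c h1 h'
      · exact (not_le.1 hc).le
  · refine ⟨h3, Or.inl ⟨rfl, ?_, ?_⟩, fun c h1 hc => by omega⟩
    · rw [hF3.rvar 1 (by decide), hF2.rvar 1 (by decide), h1]
    · rw [hF3.nvar 13 (by decide), h2]
  · rintro t - ⟨-, h, hle⟩
    rcases h with ⟨h, -⟩ | ⟨e1, e2, e3⟩
    · omega
    · exact ⟨e1, by omega, e3, fun c h1 hc => hle c h1 (by omega)⟩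

/-- Give every slot the label of its best fresh ad and enter it as a leaf of the tree. -/
def initLabels : Program :=
  .seq (.nassign 3 (.lit 0)) (forUp 3 (.var 1) (.seq bestFresh
    (.seq (.rstore 4 (.var 3) (.var 1)) (.seq (.nstore 5 (.var 3) (.var 13))
      (.seq (.nstore 6 (.var 3) (.lit 0))
        (.seq (.nstore 4 (.add (.var 1) (.var 3)) (.add (.var 3) (.lit 1)))
          (.rstore 5 (.add (.var 1) (.var 3)) (.sub (.get 3 (.var 3)) (.var 1)))))))))

theorem initLabels_ok {s₀ : State} {τ : ℕ → ℕ} (hR : Reads M s₀) (hW : Fits M W)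
    (hcnt : ∀ c ≤ M.k, s₀.narr 3 c = cnt τ M.n c) (hT : ∀ i, s₀.narr 4 i ≤ M.n) :
    Ok W initLabels s₀ (M.n * (71 * M.k + 60) + 7) (fun s =>
      (∀ j < M.n, s.narr 6 j = 0 ∧ 1 ≤ s.narr 5 j ∧ s.narr 5 j ≤ M.k ∧
        s.rarr 4 j = M.fresh τ (s.narr 5 j) j ∧
        (∀ c, 1 ≤ c → c ≤ M.k → M.fresh τ c j ≤ s.rarr 4 j) ∧
        s.narr 4 (M.n + j) = j + 1 ∧ s.rarr 5 (M.n + j) = s₀.rarr 3 j - s.rarr 4 j) ∧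
      ∀ i, s.narr 4 i ≤ M.n) := by
  have hW' := hW
  obtain ⟨hW1, hW2, hW3, hW4, hW5⟩ := hW
  refine Ok.mono (B := 2 + ((M.n - 0) * ((71 * M.k + 13 + 30) + 1 + 8) + 1 + 4)) ?_ (by
    have : M.n * (71 * M.k + 60) = (M.n - 0) * ((71 * M.k + 13 + 30) + 1 + 8) + 8 * M.n := by
      rw [Nat.sub_zero]; ring
    omega) fun _ _ => id
  refine Ok.seq (Q := fun s => s.nvar 3 = 0 ∧ s.narr = s₀.narr) (Ok.of_wp_le (by decide) ?_) ?_
  · simp [wp, NExp.eval]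
  rintro s1 hF1 ⟨h1, hA1⟩
  have hR1 := hR.frame hF1 (by decide)
  refine (Ok.forUp (N := M.n) (i₀ := 0) (c := 71 * M.k + 13 + 30)
    (I := fun i t => t.nvar 3 = i ∧
      (∀ j < i, t.narr 6 j = 0 ∧ 1 ≤ t.narr 5 j ∧ t.narr 5 j ≤ M.k ∧
        t.rarr 4 j = M.fresh τ (t.narr 5 j) j ∧
        (∀ c, 1 ≤ c → c ≤ M.k → M.fresh τ c j ≤ t.rarr 4 j) ∧
        t.narr 4 (M.n + j) = j + 1 ∧ t.rarr 5 (M.n + j) = s₀.rarr 3 j - t.rarr 4 j) ∧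
      ∀ i, t.narr 4 i ≤ M.n) (by omega) (by decide) ?_ ?_ (by omega) ?_).mono le_rfl ?_
  · rintro i t hF ⟨h, -⟩
    exact ⟨h, by simp [NExp.eval, hF.nvar 1 (by decide), hR1.n]⟩
  · rintro i t - hi hF ⟨h, ht, hTt⟩
    have hRt := hR1.frame hF (by decide)
    refine Ok.seq (bestFresh_ok (τ := τ) hRt hW' (fun c hc => ?_) h hi) ?_
    · rw [hF.narr 3 (by decide), hA1]; exact hcnt c hc
    rintro t' hF' ⟨e1, e2, e3, e4⟩
    have hRt' := hRt.frame hF' (by decide)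
    have h3 : t'.nvar 3 = i := by rw [hF'.nvar 3 (by decide), h]
    have a4 : t'.narr 4 = t.narr 4 := hF'.narr 4 (by decide)
    have a5 : t'.narr 5 = t.narr 5 := hF'.narr 5 (by decide)
    have a6 : t'.narr 6 = t.narr 6 := hF'.narr 6 (by decide)
    have r4 : t'.rarr 4 = t.rarr 4 := hF'.rarr 4 (by decide)
    have r5 : t'.rarr 5 = t.rarr 5 := hF'.rarr 5 (by decide)
    have r3 : t'.rarr 3 = s₀.rarr 3 := by
      rw [hF'.rarr 3 (by decide), hF.rarr 3 (by decide), hF1.rarr 3 (by decide)]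
    refine Ok.of_wp_le (by decide) ?_
    simp only [wp, NExp.eval, RExp.eval, h3, hRt'.n, setArr_apply]
    norm_num only [if_false, if_true]
    refine ⟨by omega, by omega, by omega, by omega, by omega, by omega, by omega, by omega, by simp,
      fun j hj => ?_, fun x => ?_⟩
    · rw [a4, a5, a6, r4, r5, r3]
      by_cases hji : j = i
      · subst hji
        simp only [update_self]
        exact ⟨trivial, e1, e2, e3, e4, trivial, trivial⟩
      · have : M.n + j ≠ M.n + i := by omega
        simp only [update_of_ne hji, update_of_ne this]
        exact ht j (by omega)
    · rw [a4]
      by_cases hx : x = M.n + i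
      · subst hx; simpa using hi
      · rw [update_of_ne hx]; exact hTt x
  · exact ⟨h1, fun j hj => by omega, by rw [hA1]; exact hT⟩
  · rintro t - ⟨-, h⟩
    exact h

/-! ### Relaxation and extraction -/

/-- Relax the slot of variable `3` by the slot of variable `5`. -/
def relaxNode : Program :=
  .seq (.rassign 0 (.add (.mul (.sub (discAt (.get 1 (.var 5)) (.var 3))
      (discAt (.get 1 (.var 5)) (.var 5))) (valAt (.get 1 (.var 5)) (.get 2 (.var 5))))
      (.get 4 (.var 5))))
    (.branch (.and (.nle (.lit 1) (.get 4 (.add (.var 1) (.var 3))))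
        (.not (.rle (.var 0) (.get 4 (.var 3)))))
      (.seq (.rstore 4 (.var 3) (.var 0))
        (.seq (.rstore 5 (.add (.var 1) (.var 3)) (.sub (.get 3 (.var 3)) (.var 0)))
          (.seq (.nstore 5 (.var 3) (.get 1 (.var 5)))
            (.nstore 6 (.var 3) (.add (.var 5) (.lit 1))))))
      .skip)

/-- How the labels change when slot `j` is relaxed by slot `s`, if it is in the range `R`. -/
def RelaxedAt (M : Market) (s : ℕ) (R : ℕ → Prop) (t₀ t : State) (j : ℕ) : Prop :=
  (1 ≤ t₀.narr 4 (M.n + j) ∧ t₀.narr 1 s ≠ 0 ∧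
    t₀.rarr 4 j < M.swap (t₀.narr 1) (t₀.rarr 4) s j ∧
    t.rarr 4 j = M.swap (t₀.narr 1) (t₀.rarr 4) s j ∧ t.narr 5 j = t₀.narr 1 s ∧
    t.narr 6 j = s + 1 ∧ t.rarr 5 (M.n + j) = t₀.rarr 3 j - t.rarr 4 j) ∨
  (t.rarr 4 j = t₀.rarr 4 j ∧ t.narr 5 j = t₀.narr 5 j ∧ t.narr 6 j = t₀.narr 6 j ∧
    t.rarr 5 (M.n + j) = t₀.rarr 5 (M.n + j) ∧
    (t₀.narr 1 s ≠ 0 → R j → 1 ≤ t₀.narr 4 (M.n + j) →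
      M.swap (t₀.narr 1) (t₀.rarr 4) s j ≤ t₀.rarr 4 j))

theorem RelaxedAt.mono {s : ℕ} {R R' : ℕ → Prop} {t₀ t : State} {j : ℕ}
    (h : RelaxedAt M s R t₀ t j) (hR : R' j → R j) : RelaxedAt M s R' t₀ t j := by
  rcases h with h | ⟨h1, h2, h3, h4, h5⟩
  · exact Or.inl h
  · exact Or.inr ⟨h1, h2, h3, h4, fun h0 hj => h5 h0 (hR hj)⟩

/-- Relax the slots from variable `6` to variable `7`. -/
def relaxRange : Program :=
  .seq (.nassign 3 (.var 6)) (forUp 3 (.add (.var 7) (.lit 1)) relaxNode)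

theorem relaxRange_ok {t₀ : State} {s lo hi : ℕ} (hR : Reads M t₀) (hW : Fits M W)
    (hs : t₀.nvar 5 = s) (hlo : t₀.nvar 6 = lo) (hhi : t₀.nvar 7 = hi) (hle : lo ≤ hi)
    (hin : hi < M.n) (hsn : s < M.n) (hpos : t₀.narr 2 s = pos (t₀.narr 1) s)
    (h0 : t₀.narr 1 s ≠ 0) (hk : t₀.narr 1 s ≤ M.k) (hTs : t₀.narr 4 (M.n + s) = 0) :
    Ok W relaxRange t₀ (111 * (hi + 1 - lo) + 9) (fun t =>
      (∀ j < M.n, RelaxedAt M s (fun j => lo ≤ j ∧ j ≤ hi) t₀ t j) ∧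
      ∀ x, ¬ (M.n + lo ≤ x ∧ x ≤ M.n + hi) → t.rarr 5 x = t₀.rarr 5 x) := by
  obtain ⟨hW1, hW2, hW3, hW4, hW5⟩ := hW
  refine Ok.mono (B := 2 + ((hi + 1 - lo) * (100 + 3 + 8) + 3 + 4)) ?_ (by omega) fun _ _ => id
  refine Ok.seq (Q := fun t => t = { t₀ with nvar := update t₀.nvar 3 lo })
    (Ok.of_wp_le (by decide) ?_) ?_
  · simp [wp, NExp.eval, hlo]; omega
  rintro t1 hF1 rfl
  have hR1 := hR.frame hF1 (by decide)
  refine (Ok.forUp (N := hi + 1) (i₀ := lo) (c := 100)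
    (I := fun i t => t.nvar 3 = i ∧
      (∀ j < M.n, RelaxedAt M s (fun j => lo ≤ j ∧ j < i) t₀ t j) ∧
      (∀ j, i ≤ j → t.rarr 4 j = t₀.rarr 4 j ∧ t.narr 5 j = t₀.narr 5 j ∧
        t.narr 6 j = t₀.narr 6 j ∧ t.rarr 5 (M.n + j) = t₀.rarr 5 (M.n + j)) ∧
      ∀ x, ¬ (M.n + lo ≤ x ∧ x ≤ M.n + hi) → t.rarr 5 x = t₀.rarr 5 x)
    (by omega) (by decide) ?_ ?_ (by omega) ?_).mono le_rfl ?_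
  · rintro i t hF ⟨h, -⟩
    exact ⟨h, by simp [NExp.eval, hF.nvar 7 (by decide), hhi]⟩
  · rintro i t hi1 hi2 hF ⟨h3, ht, hge, hK⟩
    have hRt := hR1.frame hF (by decide)
    have a1 : t.narr 1 = t₀.narr 1 := hF.narr 1 (by decide)
    have a2 : t.narr 2 = t₀.narr 2 := hF.narr 2 (by decide)
    have a4 : t.narr 4 = t₀.narr 4 := hF.narr 4 (by decide)
    have r3 : t.rarr 3 = t₀.rarr 3 := hF.rarr 3 (by decide)
    have v5 : t.nvar 5 = s := by rw [hF.nvar 5 (by decide)]; simpa using hs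
    -- The range may contain `s`, but its leaf is cleared, so its label is never overwritten and all
    -- candidates use the same value.
    have hLs : t.rarr 4 s = t₀.rarr 4 s := by
      rcases ht s hsn with e | e
      · have := e.1; omega
      · exact e.1
    have hcand : (M.A (t₀.narr 1 s) i - M.A (t₀.narr 1 s) s) * M.V (t₀.narr 1 s) (pos (t₀.narr 1) s)
        + t₀.rarr 4 s = M.swap (t₀.narr 1) (t₀.rarr 4) s i := rfl
    obtain ⟨g1, g2, g3, g4⟩ := hge i le_rfl
    refine Ok.of_wp_le (by decide) ?_
    simp only [relaxNode, wp, BExp.holds, RExp.eval, NExp.eval, hRt.discAt, hRt.valAt, h3, v5, a1,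
      a2, a4, r3, hpos, hLs, hcand, hRt.n, update_self, g1, setArr_apply]
    norm_num only [if_false, if_true]
    refine ⟨fun hc => ⟨by omega, by omega, by omega, by omega, by omega, by omega, by simp,
      fun j hj => ?_, fun j hj => ?_, fun x hx => ?_⟩,
      fun hc => ⟨by simp, fun j hj => ?_, fun j hj => hge j (by omega), hK⟩⟩
    · by_cases hji : j = i
      · subst hji
        left
        simp only [setArr_apply, if_true, update_self]
        norm_num only [if_false, if_true]
        rw [update_self, update_self]
        exact ⟨hc.1, h0, not_le.1 hc.2, by simp⟩
      · have hne : M.n + j ≠ M.n + i := by omega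
        have := (ht j hj).mono (R' := fun j => lo ≤ j ∧ j < i + 1) (fun h => by omega)
        unfold RelaxedAt at this ⊢
        simp only [setArr_apply]
        norm_num only [if_false, if_true]
        rw [update_of_ne hji, update_of_ne hji, update_of_ne hji, update_of_ne hne]
        exact this
    · have hji : j ≠ i := by omega
      have hne : M.n + j ≠ M.n + i := by omega
      rw [update_of_ne hji, update_of_ne hji, update_of_ne hji, update_of_ne hne]
      exact hge j (by omega)
    · have hne : x ≠ M.n + i := by rintro rfl; exact hx (by omega)
      rw [update_of_ne hne]
      exact hK x hx
    · by_cases hji : j = i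
      · subst hji
        right
        refine ⟨g1, g2, g3, g4, fun _ _ hT => ?_⟩
        by_contra hcon
        exact hc ⟨hT, hcon⟩
      · have := (ht j hj).mono (R' := fun j => lo ≤ j ∧ j < i + 1)
          fun h => ⟨h.1, lt_of_le_of_ne (Nat.lt_succ_iff.1 h.2) hji⟩
        exact this
  · refine ⟨by simp, fun j hj => Or.inr ⟨rfl, rfl, rfl, rfl, fun _ h => by omega⟩,
      fun j hj => ⟨rfl, rfl, rfl, rfl⟩, fun x hx => rfl⟩
  · rintro t - ⟨-, ht, -, hK⟩
    exact ⟨fun j hj => (ht j hj).mono fun h => ⟨h.1, Nat.lt_succ_of_le h.2⟩, hK⟩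

/-- Move variable `6` down to the previous slot of the same type, or to `0`. -/
def scanDown : Program :=
  .loop (.and (.nle (.lit 1) (.var 6)) (.not (.and (.nle (.add (.var 6) (.lit 1)) (.var 5))
      (.and (.nle (.get 1 (.var 6)) (.get 1 (.var 5)))
        (.nle (.get 1 (.var 5)) (.get 1 (.var 6)))))))
    (.nassign 6 (.sub (.var 6) (.lit 1)))

/-- Move variable `7` up to the next slot of the same type, or to the last slot. -/
def scanUp : Program :=
  .loop (.and (.nle (.add (.var 7) (.lit 2)) (.var 1))
      (.not (.and (.nle (.add (.var 5) (.lit 1)) (.var 7))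
      (.and (.nle (.get 1 (.var 7)) (.get 1 (.var 5)))
        (.nle (.get 1 (.var 5)) (.get 1 (.var 7)))))))
    (.nassign 7 (.add (.var 7) (.lit 1)))

theorem exists_prev (τ : ℕ → ℕ) (s : ℕ) : ∃ lo ≤ s, (∀ t, lo < t → t < s → τ t ≠ τ s) ∧
    (lo = 0 ∨ (lo < s ∧ τ lo = τ s)) := by
  have : ∀ d ≤ s, (∃ lo ≤ s, (∀ t, lo < t → t < s → τ t ≠ τ s) ∧
      (lo = 0 ∨ (lo < s ∧ τ lo = τ s))) ∨ ∀ t, s - d ≤ t → t < s → τ t ≠ τ s := by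
    intro d
    induction d with
    | zero => intro _; right; intro t _ _; omega
    | succ d ih =>
      intro hd
      rcases ih (by omega) with h | h
      · exact Or.inl h
      by_cases hc : τ (s - (d + 1)) = τ s
      · exact Or.inl ⟨s - (d + 1), by omega, fun t h1 h2 => h t (by omega) h2,
          Or.inr ⟨by omega, hc⟩⟩
      · right
        intro t h1 h2
        by_cases ht : t = s - (d + 1)
        · rwa [ht]
        · exact h t (by omega) h2
  rcases this s le_rfl with h | h
  · exact h
  · exact ⟨0, by omega, fun t _ h2 => h t (by omega) h2, Or.inl rfl⟩

theorem exists_next (τ : ℕ → ℕ) {s n : ℕ} (hs : s < n) :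
    ∃ hi, s ≤ hi ∧ hi < n ∧ (∀ t, s < t → t < hi → τ t ≠ τ s) ∧
    (hi + 1 = n ∨ (s < hi ∧ τ hi = τ s)) := by
  by_cases h : ∃ t, s < t ∧ t < n ∧ τ t = τ s
  · classical
    have hf := Nat.find_spec h
    refine ⟨Nat.find h, hf.1.le, hf.2.1, fun t h1 h2 hc => ?_, Or.inr ⟨hf.1, hf.2.2⟩⟩
    exact Nat.find_min h h2 ⟨h1, by omega, hc⟩
  · push Not at h
    exact ⟨n - 1, by omega, by omega, fun t h1 h2 => h t h1 (by omega), Or.inl (by omega)⟩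

theorem scanDown_ok {t₀ : State} {s lo : ℕ} (hs : t₀.nvar 5 = s) (h6 : t₀.nvar 6 = s) (hsW : s ≤ W)
    (hlo : lo ≤ s) (hne : ∀ t, lo < t → t < s → t₀.narr 1 t ≠ t₀.narr 1 s)
    (hend : lo = 0 ∨ (lo < s ∧ t₀.narr 1 lo = t₀.narr 1 s)) :
    Ok W scanDown t₀ (30 * (s - lo) + 30) (fun t => t.nvar 6 = lo) := by
  refine Ok.loop (Inv := fun r t => ∃ x, t.nvar 6 = x ∧ lo ≤ x ∧ x ≤ s ∧
    r = 30 * (x - lo) + 30) ?_ ?_ ⟨s, h6, hlo, le_rfl, rfl⟩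
  · rintro r t hF ⟨x, hx, h1, h2, rfl⟩ hc
    have a1 : t.narr 1 = t₀.narr 1 := hF.narr 1 (by decide)
    have v5 : t.nvar 5 = s := by rw [hF.nvar 5 (by decide), hs]
    simp only [BExp.holds, NExp.eval, hx, v5, a1] at hc
    have hlt : lo < x := by
      rcases hend with h | ⟨h, h'⟩
      · omega
      · rcases Nat.eq_or_lt_of_le h1 with rfl | h3
        · exact absurd ⟨h, h'.le, h'.ge⟩ hc.2
        · exact h3
    refine ⟨4, 30 * (x - 1 - lo) + 30, ?_, ?_⟩
    · simp only [BExp.cost, NExp.cost]; omega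
    · refine Ok.of_wp_le (by decide) ?_
      simp only [wp, NExp.eval, hx, update_self]
      exact ⟨by omega, x - 1, rfl, by omega, by omega, rfl⟩
  · rintro r t hF ⟨x, hx, h1, h2, rfl⟩ hc
    have a1 : t.narr 1 = t₀.narr 1 := hF.narr 1 (by decide)
    have v5 : t.nvar 5 = s := by rw [hF.nvar 5 (by decide), hs]
    simp only [BExp.holds, NExp.eval, hx, v5, a1] at hc
    refine ⟨by simp only [BExp.cost, NExp.cost]; omega, ?_⟩
    rw [hx]
    by_contra hcon
    by_cases hxs : x = s
    · exact hc ⟨by omega, fun h => by omega⟩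
    · exact hc ⟨by omega, fun h => hne x (by omega) (by omega) (le_antisymm h.2.1 h.2.2)⟩

theorem scanUp_ok {t₀ : State} {s hi : ℕ} (hR : Reads M t₀) (hs : t₀.nvar 5 = s)
    (h7 : t₀.nvar 7 = s) (hnW : M.n ≤ W)
    (hhi : s ≤ hi) (hin : hi < M.n) (hne : ∀ t, s < t → t < hi → t₀.narr 1 t ≠ t₀.narr 1 s)
    (hend : hi + 1 = M.n ∨ (s < hi ∧ t₀.narr 1 hi = t₀.narr 1 s)) :
    Ok W scanUp t₀ (30 * (hi - s) + 30) (fun t => t.nvar 7 = hi) := by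
  refine Ok.loop (Inv := fun r t => ∃ x, t.nvar 7 = x ∧ s ≤ x ∧ x ≤ hi ∧
    r = 30 * (hi - x) + 30) ?_ ?_ ⟨s, h7, le_rfl, hhi, rfl⟩
  · rintro r t hF ⟨x, hx, h1, h2, rfl⟩ hc
    have a1 : t.narr 1 = t₀.narr 1 := hF.narr 1 (by decide)
    have v5 : t.nvar 5 = s := by rw [hF.nvar 5 (by decide), hs]
    have hRt := hR.frame hF (by decide)
    simp only [BExp.holds, NExp.eval, hx, v5, a1, hRt.n] at hc
    have hlt : x < hi := by
      rcases hend with h | ⟨h, h'⟩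
      · omega
      · rcases Nat.eq_or_lt_of_le h2 with rfl | h3
        · exact absurd ⟨h, h'.le, h'.ge⟩ hc.2
        · exact h3
    refine ⟨4, 30 * (hi - (x + 1)) + 30, ?_, ?_⟩
    · simp only [BExp.cost, NExp.cost]; omega
    · refine Ok.of_wp_le (by decide) ?_
      simp only [wp, NExp.eval, hx, update_self]
      exact ⟨by omega, x + 1, rfl, by omega, by omega, rfl⟩
  · rintro r t hF ⟨x, hx, h1, h2, rfl⟩ hc
    have a1 : t.narr 1 = t₀.narr 1 := hF.narr 1 (by decide)
    have v5 : t.nvar 5 = s := by rw [hF.nvar 5 (by decide), hs]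
    have hRt := hR.frame hF (by decide)
    simp only [BExp.holds, NExp.eval, hx, v5, a1, hRt.n] at hc
    refine ⟨by simp only [BExp.cost, NExp.cost]; omega, ?_⟩
    rw [hx]
    by_contra hcon
    by_cases hxs : x = s
    · exact hc ⟨by omega, fun h => by omega⟩
    · exact hc ⟨by omega, fun h => hne x (by omega) (by omega) (le_antisymm h.2.1 h.2.2)⟩

/-- Relax all slots that are adjacent to the slot of variable `5`. -/
def relaxAdj : Program :=
  .branch (.nle (.lit 1) (.get 1 (.var 5))) (.seq scanDown (.seq scanUp relaxRange)) .skip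

/-- The slots adjacent to `s` form the interval bounded by its nearest slots of the same type, both
included, or by the ends. Scans, relaxations and changed keys are therefore all paid for by `width`.
-/
theorem relaxAdj_ok {t₀ : State} {s : ℕ} (hR : Reads M t₀) (hW : Fits M W)
    (hs : t₀.nvar 5 = s) (h6 : t₀.nvar 6 = s) (h7 : t₀.nvar 7 = s) (hsn : s < M.n)
    (hpos : t₀.narr 2 s = pos (t₀.narr 1) s) (hk : t₀.narr 1 s ≤ M.k)
    (hTs : t₀.narr 4 (M.n + s) = 0) :
    Ok W relaxAdj t₀ (141 * M.width (t₀.narr 1) s + 75) (fun t =>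
      ∃ lo hi, t.nvar 6 = lo ∧ t.nvar 7 = hi ∧ lo ≤ s ∧ s ≤ hi ∧ hi < M.n ∧
      hi - lo ≤ M.width (t₀.narr 1) s ∧
      (∀ j < M.n, RelaxedAt M s (Market.Adj (t₀.narr 1) s) t₀ t j) ∧
      ∀ x, ¬ (M.n + lo ≤ x ∧ x ≤ M.n + hi) → t.rarr 5 x = t₀.rarr 5 x) := by
  have hW' := hW
  obtain ⟨hW1, hW2, hW3, hW4, hW5⟩ := hW
  refine Ok.mono (B := 4 + 1 + (141 * M.width (t₀.narr 1) s + 69)) ?_ (by omega) fun _ _ => id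
  refine Ok.branch (fun hc => ?_) (fun hc => ?_)
  · simp only [BExp.holds, NExp.eval, hs] at hc
    have h0 : t₀.narr 1 s ≠ 0 := by omega
    obtain ⟨lo, hlo, hlone, hloend⟩ := exists_prev (t₀.narr 1) s
    obtain ⟨hi, hhi, hin, hhine, hhiend⟩ := exists_next (t₀.narr 1) hsn
    have hadj : ∀ j < M.n, Market.Adj (t₀.narr 1) s j → lo ≤ j ∧ j ≤ hi := by
      intro j hj hadj
      constructor
      · by_contra hcon
        rcases hloend with h | ⟨h, h'⟩
        · omega
        · exact hadj lo (Or.inr (by omega)) h'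
      · by_contra hcon
        rcases hhiend with h | ⟨h, h'⟩
        · omega
        · exact hadj hi (Or.inl (by omega)) h'
    have hwidth : hi + 1 - lo ≤ M.width (t₀.narr 1) s := by
      classical
      rw [Market.width, if_neg h0, ← Nat.card_Icc]
      refine card_le_card fun j hj => ?_
      rw [mem_Icc] at hj
      rw [mem_filter, mem_range]
      refine ⟨by omega, ?_⟩
      rintro t (ht | ht)
      · exact hhine t ht.1 (by omega)
      · exact hlone t (by omega) ht.2
    refine Ok.mono (B := (30 * (s - lo) + 30) + ((30 * (hi - s) + 30) +
      (111 * (hi + 1 - lo) + 9))) ?_ (by omega) fun _ _ => id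
    refine Ok.seq (scanDown_ok hs h6 (by omega) hlo hlone hloend) fun t1 hF1 h1 => ?_
    have hR1 := hR.frame hF1 (by decide)
    have a1 : t1.narr = t₀.narr := funext fun x => hF1.narr x rfl
    refine Ok.seq (scanUp_ok (s := s) (hi := hi) hR1 (by rw [hF1.nvar 5 (by decide), hs])
      (by rw [hF1.nvar 7 (by decide), h7]) (by omega) hhi hin (by rwa [a1]) (by rwa [a1]))
      fun t2 hF2 h2 => ?_
    have hR2 := hR1.frame hF2 (by decide)
    have a2 : t2.narr = t₀.narr := (funext fun x => hF2.narr x rfl).trans a1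
    have r2 : t2.rarr = t₀.rarr :=
      funext fun x => (hF2.rarr x rfl).trans (hF1.rarr x rfl)
    have v6 : t2.nvar 6 = lo := by rw [hF2.nvar 6 (by decide), h1]
    refine (relaxRange_ok (s := s) (lo := lo) (hi := hi) hR2 hW'
      (by rw [hF2.nvar 5 (by decide), hF1.nvar 5 (by decide), hs]) v6 h2 (by omega) hin hsn
      (by rwa [a2]) (by rwa [a2]) (by rwa [a2]) (by rwa [a2])).mono le_rfl ?_
    rintro t hF ⟨e1, e2⟩
    refine ⟨lo, hi, by rw [hF.nvar 6 (by decide), v6], by rw [hF.nvar 7 (by decide), h2], hlo, hhi,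
      hin, by omega, fun j hj => ?_, fun x hx => ?_⟩
    · have := (e1 j hj).mono (hadj j hj)
      unfold RelaxedAt at this ⊢
      rwa [a2, r2] at this
    · rw [e2 x hx, r2]
  · simp only [BExp.holds, NExp.eval, hs] at hc
    have h0 : t₀.narr 1 s = 0 := by omega
    refine Ok.of_wp_le (by simp [Program.maxCost]) ?_
    refine ⟨s, s, h6, h7, le_rfl, le_rfl, hsn, by omega, fun j hj => Or.inr ⟨rfl, rfl, rfl, rfl,
      fun h => absurd h0 h⟩, fun _ _ => rfl⟩

/-- Extract the slot with the least key. -/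
def extract : Program :=
  .seq (.nassign 5 (.sub (.get 4 (.lit 1)) (.lit 1)))
    (.seq (.nstore 4 (.add (.var 1) (.var 5)) (.lit 0))
    (.seq (.nassign 6 (.var 5)) (.seq (.nassign 7 (.var 5)) (.seq relaxAdj
    (.seq (.nassign 8 (.add (.var 1) (.var 6))) (.seq (.nassign 9 (.add (.var 1) (.var 7)))
    (.seq pullUp (.nassign 11 (.add (.var 11) (.lit 1))))))))))

/-- Invariant of the search for the type map `τ` and the potential `π`. -/
structure Searching (M : Market) (τ : ℕ → ℕ) (π : ℕ → ℝ) (D : Finset ℕ) (rk : ℕ → ℕ) (t : State) :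
    Prop where
  search : M.Search τ π (t.rarr 4) (t.narr 5) (t.narr 6) rk D
  count : t.nvar 11 = D.card
  leaf_out : ∀ j ∈ D, t.narr 4 (M.n + j) = 0
  leaf_in : ∀ j < M.n, j ∉ D →
    t.narr 4 (M.n + j) = j + 1 ∧ t.rarr 5 (M.n + j) = π j - t.rarr 4 j
  node : ∀ i, 1 ≤ i → i < M.n → NodeOk (t.narr 4) (t.rarr 5) i
  le : ∀ i, t.narr 4 i ≤ M.n

/-- The root of the tree is the slot with the least key. -/
theorem Searching.exists_min {τ : ℕ → ℕ} {π : ℕ → ℝ} {D : Finset ℕ} {rk : ℕ → ℕ} {t : State}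
    (h : Searching M τ π D rk t) (hD : D.card < M.n) :
    ∃ s < M.n, s ∉ D ∧ t.narr 4 1 = s + 1 ∧
      ∀ j < M.n, j ∉ D → π s - t.rarr 4 s ≤ π j - t.rarr 4 j := by
  have hn : 1 ≤ M.n := by omega
  obtain ⟨x, hx, hxD⟩ : ∃ x ∈ range M.n, x ∉ D := by
    by_contra! hcon
    have := card_le_card (show range M.n ⊆ D from hcon)
    rw [card_range] at this
    omega
  have hxn := mem_range.1 hx
  have hx1 := h.leaf_in x hxn hxD
  have hroot : 1 ≤ t.narr 4 1 :=
    (NodeOk.root_le h.node (M.n + x) (by omega) (by omega) (by omega)).1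
  obtain ⟨l, hl1, hl2, hl3, hl4⟩ := NodeOk.exists_leaf h.node _ 1 le_rfl le_rfl (by omega)
  obtain ⟨s, rfl⟩ : ∃ s, l = M.n + s := ⟨l - M.n, by omega⟩
  have hs : s < M.n := by omega
  have hsD : s ∉ D := by
    intro hc
    have := h.leaf_out s hc
    omega
  have hs1 := h.leaf_in s hs hsD
  refine ⟨s, hs, hsD, by omega, fun j hj hjD => ?_⟩
  have hj1 := h.leaf_in j hj hjD
  have := (NodeOk.root_le h.node (M.n + j) (by omega) (by omega) (by omega)).2
  rw [← hl4, hs1.2, hj1.2] at this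
  exact this

theorem extract_ok {t₀ : State} {τ : ℕ → ℕ} {π : ℕ → ℝ} {D : Finset ℕ} {rk : ℕ → ℕ}
    (hR : Reads M t₀) (hW : Fits M W) (hτ : t₀.narr 1 = τ) (hπ : t₀.rarr 3 = π)
    (hpos : ∀ j < M.n, t₀.narr 2 j = pos τ j) (hk : ∀ j < M.n, τ j ≤ M.k)
    (hswap : ∀ s < M.n, τ s ≠ 0 → ∀ j < M.n, M.swap τ π s j ≤ π j)
    (h : Searching M τ π D rk t₀) (hD : D.card < M.n) :
    ∃ s < M.n, s ∉ D ∧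
      Ok W extract t₀ (210 * M.width τ s + 200 * (Nat.log 2 (2 * M.n) + 1) + 110)
        (Searching M τ π (insert s D) (update rk s D.card)) := by
  obtain ⟨s, hs, hsD, hroot, hmin⟩ := h.exists_min hD
  refine ⟨s, hs, hsD, ?_⟩
  have hW' := hW
  obtain ⟨hW1, hW2, hW3, hW4, hW5⟩ := hW
  have hcard : (insert s D).card = D.card + 1 := card_insert_of_notMem hsD
  refine Ok.mono (B := 17 + ((141 * M.width τ s + 75) + (8 +
    ((69 * M.width τ s + 200 * (Nat.log 2 (2 * M.n) + 1)) + 4)))) ?_ (by omega) fun _ _ => id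
  -- Reassociation groups consecutive assignments into one loop-free block for `wp`.
  have hassoc : ∀ {p q r : Program} {B : ℕ} {Q : State → Prop} {t : State},
      Ok W (.seq (.seq p q) r) t B Q → Ok W (.seq p (.seq q r)) t B Q := by
    rintro p q r B Q t ⟨n, t', hrun, h1, h2⟩
    cases hrun with
    | seq h h' =>
      cases h with
      | seq g g' => exact ⟨_, _, .seq g (.seq g' h'), by omega, h2⟩
  refine hassoc (hassoc (hassoc (Ok.seq (Q := fun t => t.nvar 5 = s ∧ t.nvar 6 = s ∧ t.nvar 7 = s ∧
    t.narr 4 = update (t₀.narr 4) (M.n + s) 0) (Ok.of_wp_le (by decide) ?_) ?_)))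
  · simp [wp, NExp.eval, hroot, hR.n, setArr_apply]; omega
  rintro t1 hF1 ⟨v5, v6, v7, a4⟩
  have hR1 := hR.frame hF1 (by decide)
  have a1 : t1.narr 1 = τ := (hF1.narr 1 (by decide)).trans hτ
  have a2 : t1.narr 2 = t₀.narr 2 := hF1.narr 2 (by decide)
  have a5 : t1.narr 5 = t₀.narr 5 := hF1.narr 5 (by decide)
  have a6 : t1.narr 6 = t₀.narr 6 := hF1.narr 6 (by decide)
  have r3 : t1.rarr 3 = π := (hF1.rarr 3 (by decide)).trans hπ
  have r4 : t1.rarr 4 = t₀.rarr 4 := hF1.rarr 4 (by decide)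
  have r5 : t1.rarr 5 = t₀.rarr 5 := hF1.rarr 5 (by decide)
  have hw := relaxAdj_ok (s := s) hR1 hW' v5 v6 v7 hs (by rw [a2, a1]; exact hpos s hs)
    (by rw [a1]; exact hk s hs) (by rw [a4, update_self])
  rw [a1] at hw
  refine Ok.seq hw ?_
  rintro t2 hF2 ⟨lo, hi, w6, w7, hlo, hhi, hin, hlen, hrel, hK⟩
  have hR2 := hR1.frame hF2 (by decide)
  have b4 : t2.narr 4 = update (t₀.narr 4) (M.n + s) 0 := (hF2.narr 4 (by decide)).trans a4
  have v11 : t2.nvar 11 = D.card := by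
    rw [hF2.nvar 11 (by decide), hF1.nvar 11 (by decide), h.count]
  refine hassoc (Ok.seq (Q := fun t => t.nvar 8 = M.n + lo ∧ t.nvar 9 = M.n + hi)
    (Ok.of_wp_le (by decide) ?_) ?_)
  · simp [wp, NExp.eval, hR2.n, w6, w7]; omega
  rintro t3 hF3 ⟨v8, v9⟩
  have c4 : t3.narr 4 = update (t₀.narr 4) (M.n + s) 0 := (hF3.narr 4 (by decide)).trans b4
  have q5 : t3.rarr 5 = t2.rarr 5 := hF3.rarr 5 (by decide)
  have hTle : ∀ i, t3.narr 4 i ≤ M.n := by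
    intro i
    rw [c4]
    by_cases hi : i = M.n + s
    · subst hi; rw [update_self]; omega
    · rw [update_of_ne hi]; exact h.le i
  -- Besides the relaxed keys, only the leaf of `s` has changed; it lies in the same interval since
  -- `lo ≤ s ≤ hi`.
  have hpull := pullUp_ok (W := W) (s₀ := t3) v8 v9 (by omega) (by omega) (by omega) hTle (by
    intro i h1 h2 h3
    refine (h.node i h1 h2).congr fun x hx => ?_
    rw [c4, q5, hK x (by omega), r5, update_of_ne (by omega)]
    exact ⟨rfl, rfl⟩)
  have hlog : Nat.log 2 (M.n + hi) ≤ Nat.log 2 (2 * M.n) := Nat.log_mono_right (by omega)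
  refine Ok.seq (hpull.mono (by omega) fun _ _ => id) ?_
  rintro t4 hF4 ⟨e1, e2, e3⟩
  refine Ok.of_wp_le (by decide) ?_
  have v11' : t4.nvar 11 = D.card := by
    rw [hF4.nvar 11 (by decide), hF3.nvar 11 (by decide), v11]
  simp only [wp, NExp.eval, v11']
  have d5 : t4.narr 5 = t2.narr 5 := by rw [hF4.narr 5 (by decide), hF3.narr 5 (by decide)]
  have d6 : t4.narr 6 = t2.narr 6 := by rw [hF4.narr 6 (by decide), hF3.narr 6 (by decide)]
  have p4 : t4.rarr 4 = t2.rarr 4 := by rw [hF4.rarr 4 (by decide), hF3.rarr 4 (by decide)]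
  have hleaf : ∀ j, t4.narr 4 (M.n + j) = update (t₀.narr 4) (M.n + s) 0 (M.n + j) ∧
      t4.rarr 5 (M.n + j) = t2.rarr 5 (M.n + j) := by
    intro j
    have := e2 (M.n + j) (by omega)
    rw [c4, q5] at this
    exact this
  have hDn : ∀ j ∈ D, j < M.n := fun j hj => mem_range.1 (h.search.subset hj)
  have hdead : ∀ j ∈ insert s D, update (t₀.narr 4) (M.n + s) 0 (M.n + j) = 0 := by
    intro j hj
    by_cases hjs : j = s
    · subst hjs; rw [update_self]
    · rw [update_of_ne (by omega)]
      exact h.leaf_out j ((mem_insert.1 hj).resolve_left hjs)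
  have halive : ∀ j < M.n, j ∉ insert s D →
      update (t₀.narr 4) (M.n + s) 0 (M.n + j) = j + 1 ∧ t₀.rarr 5 (M.n + j) = π j - t₀.rarr 4 j := by
    intro j hj hjD
    rw [mem_insert, not_or] at hjD
    rw [update_of_ne (by omega)]
    exact h.leaf_in j hj hjD.2
  refine ⟨by omega, ?_⟩
  constructor
  · refine h.search.step hswap hs hsD hmin fun j hj => ?_
    simp only [p4, d5, d6]
    rcases hrel j hj with ⟨g1, g2, g3, g4, g5, g6, g7⟩ | ⟨g1, g2, g3, g4, g5⟩
    · left
      rw [a4] at g1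
      rw [a1] at g2 g3 g4 g5
      rw [r4] at g3 g4
      refine ⟨fun hc => ?_, g2, g3, g4, g5, g6⟩
      have := hdead j hc
      omega
    · right
      rw [a4, a1, r4] at g5
      rw [g1, g2, g3, r4, a5, a6]
      refine ⟨rfl, rfl, rfl, fun h0 hadj hjD => g5 h0 hadj ?_⟩
      have := (halive j hj hjD).1
      omega
  · simp [hcard]
  · intro j hj
    rw [(hleaf j).1]
    exact hdead j hj
  · intro j hj hjD
    have hal := halive j hj hjD
    simp only [(hleaf j).1, (hleaf j).2, p4]
    refine ⟨hal.1, ?_⟩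
    rcases hrel j hj with ⟨g1, g2, g3, g4, g5, g6, g7⟩ | ⟨g1, g2, g3, g4, g5⟩
    · rw [g7, r3]
    · rw [g4, g1, r4, r5]
      exact hal.2
  · exact e1
  · exact e3

/-- Compute all labels. -/
def findLabels : Program :=
  .seq countSlots (.seq initLabels (.seq (.nassign 8 (.lit 0))
    (.seq (.nassign 9 (.sub (.mul (.lit 2) (.var 1)) (.lit 1))) (.seq pullUp
      (.seq (.nassign 11 (.lit 0))
        (.loop (.nle (.add (.var 11) (.lit 1)) (.var 1)) extract))))))

theorem findLabels_ok {t₀ : State} {τ : ℕ → ℕ} {π : ℕ → ℝ} (hR : Reads M t₀) (hW : Fits M W)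
    (hτ : t₀.narr 1 = τ) (hπ : t₀.rarr 3 = π) (hk : ∀ j < M.n, τ j ≤ M.k)
    (hT : ∀ i, t₀.narr 4 i ≤ M.n)
    (hswap : ∀ s < M.n, τ s ≠ 0 → ∀ j < M.n, M.swap τ π s j ≤ π j) :
    Ok W findLabels t₀ (2000 * (M.n * (M.k + Nat.log 2 (2 * M.n) + 1))) (fun t =>
      (∃ rk, M.Labels τ (t.rarr 4) (t.narr 5) (t.narr 6) rk) ∧
      (∀ j < M.n, t.narr 2 j = pos τ j) ∧ ∀ i, t.narr 4 i ≤ M.n) := by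
  have hW' := hW
  obtain ⟨hW1, hW2, hW3, hW4, hW5⟩ := hW
  set ℓ := Nat.log 2 (2 * M.n) with hℓ
  have hnk : 1 * 1 ≤ M.n * M.k := Nat.mul_le_mul hW2 hW1
  have hnk1 : 1 * M.k ≤ M.n * M.k := Nat.mul_le_mul hW2 le_rfl
  have hnk2 : M.n * 1 ≤ M.n * M.k := Nat.mul_le_mul le_rfl hW1
  have hℓ2 : ℓ ≤ M.n * ℓ := Nat.le_mul_of_pos_left _ hW2
  refine Ok.mono (B := 40 * (M.k + M.n + 1) + ((M.n * (71 * M.k + 60) + 7) + (2 + (6 +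
    ((69 * (2 * M.n - 1 - 0) + 200 * (ℓ + 1)) + (2 +
      (∑ s ∈ range M.n, (210 * M.width τ s + (200 * (ℓ + 1) + 116)) + 6))))))) ?_ ?_
      fun _ _ => id
  swap
  · have := Market.sum_width_le hk
    rw [sum_add_distrib, ← mul_sum, sum_const, card_range, smul_eq_mul]
    have e1 : M.n * (71 * M.k + 60) = 71 * (M.n * M.k) + 60 * M.n := by ring
    have e2 : M.n * (200 * (ℓ + 1) + 116) = 200 * (M.n * ℓ) + 316 * M.n := by ring
    have e3 : M.n * (M.k + ℓ + 1) = M.n * M.k + M.n * ℓ + M.n := by ring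
    have e4 : 3 * M.n * M.k = 3 * (M.n * M.k) := by ring
    rw [e1, e2, e3]
    rw [e4] at this
    omega
  refine Ok.seq (countSlots_ok hR hW' (by rwa [hτ])) ?_
  rintro t1 hF1 ⟨h1, h2⟩
  rw [hτ] at h1 h2
  have hR1 := hR.frame hF1 (by decide)
  refine Ok.seq (initLabels_ok (τ := τ) hR1 hW' h2 (by rwa [hF1.narr 4 (by decide)])) ?_
  rintro t2 hF2 ⟨g1, g2⟩
  have hR2 := hR1.frame hF2 (by decide)
  refine Ok.seq (Q := fun t => t.nvar 8 = 0) (Ok.of_wp_le (by decide) (by simp [wp, NExp.eval])) ?_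
  intro t3 hF3 v8
  have hR3 := hR2.frame hF3 (by decide)
  refine Ok.seq (Q := fun t => t.nvar 9 = 2 * M.n - 1) (Ok.of_wp_le (by decide) ?_) ?_
  · simp [wp, NExp.eval, hR3.n]; omega
  intro t4 hF4 v9
  have hR4 := hR3.frame hF4 (by decide)
  have a4 : t4.narr 4 = t2.narr 4 := by rw [hF4.narr 4 (by decide), hF3.narr 4 (by decide)]
  have q5 : t4.rarr 5 = t2.rarr 5 := by rw [hF4.rarr 5 (by decide), hF3.rarr 5 (by decide)]
  -- Starting the interval at `0` makes its first halving cover all inner nodes, so nothing need be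
  -- known about the old tree.
  have hpull := pullUp_ok (W := W) (s₀ := t4) (n := M.n) (a := 0) (b := 2 * M.n - 1)
    (by rw [hF4.nvar 8 (by decide), v8]) v9 (by omega) (by omega) (by omega)
    (by rwa [a4]) (by intro i h1 h2 h3; omega)
  refine Ok.seq (hpull.mono (by
    have : Nat.log 2 (2 * M.n - 1) ≤ ℓ := Nat.log_mono_right (by omega)
    omega) fun _ _ => id) ?_
  rintro t5 hF5 ⟨e1, e2, e3⟩
  have hR5 := hR4.frame hF5 (by decide)
  refine Ok.seq (Q := fun t => t.nvar 11 = 0) (Ok.of_wp_le (by decide) (by simp [wp, NExp.eval])) ?_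
  intro t6 hF6 v11
  have hR6 := hR5.frame hF6 (by decide)
  have k1 : t6.narr 1 = τ := by
    rw [hF6.narr 1 (by decide), hF5.narr 1 (by decide), hF4.narr 1 (by decide),
      hF3.narr 1 (by decide), hF2.narr 1 (by decide), hF1.narr 1 (by decide), hτ]
  have k2 : t6.narr 2 = t1.narr 2 := by
    rw [hF6.narr 2 (by decide), hF5.narr 2 (by decide), hF4.narr 2 (by decide),
      hF3.narr 2 (by decide), hF2.narr 2 (by decide)]
  have k3 : t6.rarr 3 = π := by
    rw [hF6.rarr 3 (by decide), hF5.rarr 3 (by decide), hF4.rarr 3 (by decide),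
      hF3.rarr 3 (by decide), hF2.rarr 3 (by decide), hF1.rarr 3 (by decide), hπ]
  have k4 : t6.narr 4 = t5.narr 4 := hF6.narr 4 (by decide)
  have k5 : t6.narr 5 = t2.narr 5 := by
    rw [hF6.narr 5 (by decide), hF5.narr 5 (by decide), hF4.narr 5 (by decide),
      hF3.narr 5 (by decide)]
  have k6 : t6.narr 6 = t2.narr 6 := by
    rw [hF6.narr 6 (by decide), hF5.narr 6 (by decide), hF4.narr 6 (by decide),
      hF3.narr 6 (by decide)]
  have m4 : t6.rarr 4 = t2.rarr 4 := by
    rw [hF6.rarr 4 (by decide), hF5.rarr 4 (by decide), hF4.rarr 4 (by decide),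
      hF3.rarr 4 (by decide)]
  have m5 : t6.rarr 5 = t5.rarr 5 := hF6.rarr 5 (by decide)
  have hr3 : t1.rarr 3 = π := (hF1.rarr 3 (by decide)).trans hπ
  have hinit : Searching M τ π ∅ (fun _ => 0) t6 := by
    constructor
    · rw [m4, k5, k6]
      exact ⟨fun j hj => (g1 j hj).2.2.2.2.1, by simp, fun j hj => Or.inl
        ⟨(g1 j hj).1, (g1 j hj).2.1, (g1 j hj).2.2.1, (g1 j hj).2.2.2.1⟩, by simp, by simp, by simp⟩
    · simp [v11]
    · simp
    · intro j hj _
      have := e2 (M.n + j) (by omega)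
      have hg := (g1 j hj).2.2.2.2.2
      rw [k4, m5, m4, this.1, this.2, a4, q5, ← hr3]
      exact hg
    · rwa [k4, m5]
    · rwa [k4]
  -- The budget charges each slot not yet extracted for its own width, so that the total is bounded
  -- by `sum_width_le`; `116` is the constant `110` of an extraction plus `6` for the loop test.
  refine (Ok.loop (Inv := fun r t => ∃ D rk, Searching M τ π D rk t ∧
    r = ∑ s ∈ range M.n \ D, (210 * M.width τ s + (200 * (ℓ + 1) + 116)) + 6)
    (Q := fun t => ∃ D rk, Searching M τ π D rk t ∧ M.n ≤ D.card) ?_ ?_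
    ⟨∅, fun _ => 0, hinit, by simp⟩).mono le_rfl ?_
  · rintro r t hF ⟨D, rk, hS, rfl⟩ hc
    have hRt := hR6.frame hF (by decide)
    simp only [BExp.holds, NExp.eval, hRt.n, hS.count] at hc
    obtain ⟨s, hs, hsD, hok⟩ := extract_ok (W := W) hRt hW' ((hF.narr 1 (by decide)).trans k1)
      ((hF.rarr 3 (by decide)).trans k3)
      (by rw [hF.narr 2 (by decide), k2]; exact h1) hk hswap hS hc
    have hsplit : range M.n \ D = insert s (range M.n \ insert s D) := by
      ext x
      simp only [mem_sdiff, mem_insert, mem_range, not_or]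
      constructor
      · rintro ⟨h1, h2⟩
        by_cases hx : x = s
        · exact Or.inl hx
        · exact Or.inr ⟨h1, hx, h2⟩
      · rintro (rfl | ⟨h1, -, h2⟩)
        · exact ⟨hs, hsD⟩
        · exact ⟨h1, h2⟩
    refine ⟨_, ∑ s ∈ range M.n \ insert s D, (210 * M.width τ s + (200 * (ℓ + 1) + 116)) + 6, ?_,
      hok.mono le_rfl fun t' _ ht' => ⟨_, _, ht', rfl⟩⟩
    rw [hsplit, sum_insert (by simp)]
    simp only [BExp.cost, NExp.cost]
    omega
  · rintro r t hF ⟨D, rk, hS, rfl⟩ hc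
    have hRt := hR6.frame hF (by decide)
    simp only [BExp.holds, NExp.eval, hRt.n, hS.count] at hc
    refine ⟨?_, D, rk, hS, by omega⟩
    simp only [BExp.cost, NExp.cost]
    omega
  · rintro t hF ⟨D, rk, hS, hD⟩
    exact ⟨⟨rk, hS.search.labels hD⟩, by rw [hF.narr 2 (by decide), k2]; exact h1, hS.le⟩

/-! ### The algorithm -/

/-- Exchange ads along the path that starts at the slot of variable `2`. -/
def augment : Program :=
  .seq (.nassign 12 (.add (.var 2) (.lit 1)))
    (.loop (.nle (.lit 1) (.var 12))
      (.seq (.nstore 1 (.sub (.var 12) (.lit 1)) (.get 5 (.sub (.var 12) (.lit 1))))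
        (.nassign 12 (.get 6 (.sub (.var 12) (.lit 1))))))

theorem augment_ok {t₀ : State} {τ rk : ℕ → ℕ} {L : ℕ → ℝ} {m : ℕ} (hW : Fits M W)
    (hm : t₀.nvar 2 = m) (hmn : m < M.n) (hτ : t₀.narr 1 = τ) (hk : ∀ j < M.n, τ j ≤ M.k)
    (hτm : ∀ j < M.n, τ j ≠ 0 ↔ j < m) (hL : M.Labels τ L (t₀.narr 5) (t₀.narr 6) rk) :
    Ok W augment t₀ (30 * M.n + 8) (fun t => ∃ p, M.Placement M.n (t.narr 1) p ∧
      M.val M.n (t.narr 1) p = M.val M.n τ (pos τ) + L m ∧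
      ∀ j < M.n, t.narr 1 j ≠ 0 ↔ j = m ∨ τ j ≠ 0) := by
  obtain ⟨hW1, hW2, hW3, hW4, hW5⟩ := hW
  have hτ0 : τ m = 0 := by
    by_contra hcon
    exact absurd ((hτm m hmn).1 hcon) (lt_irrefl _)
  -- Slot `m` is still empty, so no type is exhausted and the path ends with a genuine ad.
  have hcnt : ∀ c, 1 ≤ c → cnt τ M.n c < M.n := by
    intro c hc
    refine lt_of_le_of_ne (cnt_le _ _ _) fun hcon => ?_
    have := Nat.count_iff_forall.1 hcon m hmn
    omega
  refine Ok.mono (B := 4 + (30 * M.n + 4)) ?_ (by omega) fun _ _ => id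
  refine Ok.seq (Q := fun t => t.nvar 12 = m + 1) (Ok.of_wp_le (by decide) ?_) ?_
  · simp [wp, NExp.eval, hm]; omega
  intro t1 hF1 h1
  have a1 : t1.narr = t₀.narr := funext fun x => hF1.narr x rfl
  -- The positions `p` exist only in the proof; the program rewrites types alone. The rank of the
  -- vacant slot falls at each step and pays for the walk.
  refine (Ok.loop (Inv := fun r t =>
    (∃ y p, t.nvar 12 = y + 1 ∧ M.Exchange τ rk (t.narr 1) p y ∧
      M.val M.n (update (t.narr 1) y 0) p + L y = M.val M.n τ (pos τ) + L m ∧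
      (∀ j < M.n, j ≠ y → (t.narr 1 j ≠ 0 ↔ j = m ∨ τ j ≠ 0)) ∧ (y = m ∨ τ y ≠ 0) ∧
      r = 30 * (rk y + 1) + 4) ∨
    (t.nvar 12 = 0 ∧ r = 4 ∧ ∃ p, M.Placement M.n (t.narr 1) p ∧
      M.val M.n (t.narr 1) p = M.val M.n τ (pos τ) + L m ∧
      ∀ j < M.n, t.narr 1 j ≠ 0 ↔ j = m ∨ τ j ≠ 0)) (r := 30 * (rk m + 1) + 4) ?_ ?_ ?_).mono
    (by have := hL.rk_lt m hmn; omega) fun _ _ => id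
  · rintro r t hF (⟨y, p, hy, hex, hval, hne, hy0, rfl⟩ | ⟨h, -⟩) hc
    swap
    · simp [BExp.holds, NExp.eval, h] at hc
    have hyn := hex.lt
    have b5 : t.narr 5 = t₀.narr 5 := by rw [hF.narr 5 (by decide), a1]
    have b6 : t.narr 6 = t₀.narr 6 := by rw [hF.narr 6 (by decide), a1]
    rcases hL.parent y hyn with ⟨e1, e2, e3, e4⟩ | ⟨z, hz, e1, e2, e3, e4, e5⟩
    · refine ⟨13, 4, by simp only [BExp.cost, NExp.cost]; omega, Ok.of_wp_le (by decide) ?_⟩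
      simp only [wp, NExp.eval, hy, Nat.add_sub_cancel, b5, b6, setArr_apply]
      norm_num only [if_false, if_true]
      rw [e1, update_self]
      refine ⟨by omega, by omega, by omega, Or.inr ⟨rfl, trivial, ?_⟩⟩
      obtain ⟨f1, f2⟩ := hex.finish e2 e3 (hcnt _ e2)
      refine ⟨_, f1, by rw [f2, ← e4, hval], fun j hj => ?_⟩
      by_cases hjy : j = y
      · subst hjy
        rw [update_self]
        exact ⟨fun _ => hy0, fun _ => by omega⟩
      · rw [update_of_ne hjy]; exact hne j hj hjy
    · refine ⟨13, 30 * (rk z + 1) + 4, by simp only [BExp.cost, NExp.cost]; omega,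
        Ok.of_wp_le (by decide) ?_⟩
      simp only [wp, NExp.eval, hy, Nat.add_sub_cancel, b5, b6, setArr_apply]
      norm_num only [if_false, if_true]
      rw [e1, update_self]
      have := hk z hz
      refine ⟨by omega, by omega, by omega, Or.inl ⟨z, ?_⟩⟩
      obtain ⟨f1, f2⟩ := hex.step hz e2 e5 L
      rw [← e3] at f1 f2
      refine ⟨_, rfl, f1, by rw [f2, ← e4, hval], fun j hj hjz => ?_, Or.inr e2, rfl⟩
      by_cases hjy : j = y
      · subst hjy
        rw [update_self]
        exact ⟨fun _ => hy0, fun _ => by omega⟩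
      · rw [update_of_ne hjy]; exact hne j hj hjy
  · rintro r t hF (⟨y, p, hy, -⟩ | ⟨h, rfl, hp⟩) hc
    · simp [BExp.holds, NExp.eval, hy] at hc
    · exact ⟨by decide, hp⟩
  · refine Or.inl ⟨m, pos τ, h1, ?_, ?_, fun j hj hjm => ?_, Or.inl rfl, rfl⟩
    · rw [a1, hτ]; exact Market.exchange_start hk rk hmn
    · have : update τ m 0 = τ := by rw [← hτ0, update_eq_self]
      rw [a1, hτ, this]
    · rw [a1, hτ]; simp [hjm]

/-- Use the labels as the next potential. -/
def storeLabels : Program :=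
  .seq (.nassign 3 (.lit 0)) (forUp 3 (.var 1) (.rstore 3 (.var 3) (.get 4 (.var 3))))

theorem storeLabels_ok {t₀ : State} (hR : Reads M t₀) (hW : Fits M W) :
    Ok W storeLabels t₀ (20 * M.n + 7) (fun t => ∀ j < M.n, t.rarr 3 j = t₀.rarr 4 j) := by
  obtain ⟨hW1, hW2, hW3, hW4, hW5⟩ := hW
  refine Ok.mono (B := 2 + ((M.n - 0) * (4 + 1 + 8) + 1 + 4)) ?_ (by omega) fun _ _ => id
  refine Ok.seq (Q := fun s => s.nvar 3 = 0) (Ok.of_wp_le (by decide) ?_) ?_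
  · simp [wp, NExp.eval]
  rintro t1 hF1 h1
  have hR1 := hR.frame hF1 (by decide)
  refine (Ok.forUp (N := M.n) (i₀ := 0) (c := 4)
    (I := fun i t => t.nvar 3 = i ∧ ∀ j < i, t.rarr 3 j = t₀.rarr 4 j)
    (by omega) (by decide) ?_ ?_ (by omega) ⟨h1, fun j hj => by omega⟩).mono le_rfl
    fun t _ h => h.2
  · rintro i t hF ⟨h, -⟩
    exact ⟨h, by simp [NExp.eval, hF.nvar 1 (by decide), hR1.n]⟩
  · rintro i t - hi hF ⟨h, ht⟩
    have r4 : t.rarr 4 = t₀.rarr 4 := by rw [hF.rarr 4 (by decide), hF1.rarr 4 (by decide)]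
    refine Ok.of_wp_le (by decide) ?_
    simp only [wp, NExp.eval, RExp.eval, h, setArr_self, update_self, r4]
    refine ⟨by omega, trivial, fun j hj => ?_⟩
    by_cases hji : j = i
    · subst hji; rw [update_self]
    · rw [update_of_ne hji]; exact ht j (by omega)

/-- The slots before `m` carry an optimal placement. -/
structure Stage (M : Market) (m : ℕ) (t : State) : Prop where
  reads : Reads M t
  count : t.nvar 2 = m
  le : ∀ j < M.n, t.narr 1 j ≤ M.k
  ne_zero : ∀ j < M.n, t.narr 1 j ≠ 0 ↔ j < m
  tree_le : ∀ i, t.narr 4 i ≤ M.n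
  potential : M.Potential (t.narr 1) (t.rarr 3)
  prices : ∀ x, t.rarr 2 x = 0

theorem Market.Potential.congr {τ : ℕ → ℕ} {π π' : ℕ → ℝ} (h : M.Potential τ π)
    (hπ : ∀ j < M.n, π' j = π j) : M.Potential τ π' := by
  refine ⟨fun s hs h0 j hj => ?_, fun s hs h0 => ?_, fun s hs h0 c h1 hk => ?_⟩
  · have := h.swap_le s hs h0 j hj
    unfold Market.swap at this ⊢
    rwa [hπ s hs, hπ j hj]
  · rw [hπ s hs]; exact h.le s hs h0
  · rw [hπ s hs]; exact h.fresh_le s hs h0 c h1 hk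

theorem Market.Labels.nonneg {τ : ℕ → ℕ} {L : ℕ → ℝ} {pt ps rk : ℕ → ℕ}
    (h : M.Labels τ L pt ps rk) (hk : 1 ≤ M.k) : ∀ j < M.n, 0 ≤ L j := fun j hj =>
  (Market.fresh_nonneg le_rfl hk hj).trans (h.fresh_le j hj 1 le_rfl hk)

/-- Insert the slot of variable `2`. -/
def addSlot : Program := .seq findLabels (.seq augment storeLabels)

/-- Time bound for `findLabels`. -/
def Market.budget (M : Market) : ℕ := 2000 * (M.n * (M.k + Nat.log 2 (2 * M.n) + 1))

/-- The labels that guide the augmentation become the potential of the next stage, by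
`Dual.potential_of_val`. -/
theorem addSlot_ok {t₀ : State} {m : ℕ} (hW : Fits M W) (h : Stage M m t₀) (hm : m < M.n) :
    Ok W addSlot t₀ (M.budget + (50 * M.n + 15))
      (fun t => Stage M (m + 1) { t with nvar := update t.nvar 2 (m + 1) }) := by
  refine Ok.mono (B := M.budget + ((30 * M.n + 8) + (20 * M.n + 7))) ?_ (by omega) fun _ _ => id
  refine Ok.seq (findLabels_ok h.reads hW rfl rfl h.le h.tree_le h.potential.swap_le) ?_
  rintro t1 hF1 ⟨⟨rk, hL⟩, -, hT⟩
  have hR1 := h.reads.frame hF1 (by decide)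
  have a1 : t1.narr 1 = t₀.narr 1 := hF1.narr 1 (by decide)
  refine Ok.seq (augment_ok hW (by rw [hF1.nvar 2 (by decide), h.count]) hm a1 h.le h.ne_zero hL) ?_
  rintro t2 hF2 ⟨p, hp, hval, hne⟩
  have hR2 := hR1.frame hF2 (by decide)
  obtain ⟨U, hU⟩ := hL.exists_dual h.le h.potential
  have hm0 : t₀.narr 1 m = 0 := by
    by_contra hcon
    exact absurd ((h.ne_zero m hm).1 hcon) (lt_irrefl _)
  have hpot := hU.potential_of_val h.le (hL.nonneg hW.k_pos) hm hm0 hne hp hval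
  refine (storeLabels_ok hR2 hW).mono le_rfl ?_
  intro t hF ht
  have hR := hR2.frame hF (by decide)
  have b1 : t.narr 1 = t2.narr 1 := hF.narr 1 (by decide)
  refine ⟨⟨hR.k, hR.n, hR.V, hR.A⟩, by simp, fun j hj => ?_, fun j hj => ?_, fun i => ?_, ?_,
    fun x => ?_⟩
  · simp only [b1]; exact hp.le j hj
  · simp only [b1]
    rw [hne j hj, h.ne_zero j hj]
    omega
  · simp only [hF.narr 4 (by decide), hF2.narr 4 (by decide)]
    exact hT i
  · simp only [b1]
    refine hpot.congr fun j hj => ?_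
    rw [ht j hj, hF2.rarr 4 (by decide)]
  · simp only [hF.rarr 2 (by decide), hF2.rarr 2 (by decide), hF1.rarr 2 (by decide)]
    exact h.prices x

/-! ### Output and the whole program -/

/-- Write the allocation and the prices. -/
def writeOutput : Program :=
  .seq (.nassign 3 (.lit 0)) (forUp 3 (.var 1)
    (.seq (.nstore 0 (.var 3) (.add (.add (.mul (.var 1) (.sub (.get 1 (.var 3)) (.lit 1)))
        (.get 2 (.var 3))) (.lit 1)))
      (.rstore 2 (.add (.mul (.var 1) (.sub (.get 1 (.var 3)) (.lit 1))) (.get 2 (.var 3)))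
        (.get 4 (.var 3)))))

theorem index_inj {n c c' i i' : ℕ} (hi : i < n) (hi' : i' < n) (h : n * c + i = n * c' + i') :
    c = c' ∧ i = i' := by
  have hn : 0 < n := by omega
  have h1 : (n * c + i) / n = c := by
    rw [Nat.mul_add_div hn, Nat.div_eq_of_lt hi, Nat.add_zero]
  have h2 : (n * c' + i') / n = c' := by
    rw [Nat.mul_add_div hn, Nat.div_eq_of_lt hi', Nat.add_zero]
  have hc : c = c' := by rw [← h1, ← h2, h]
  subst hc
  exact ⟨rfl, by omega⟩

theorem writeOutput_ok {t₀ : State} {τ : ℕ → ℕ} (hR : Reads M t₀) (hW : Fits M W)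
    (hτ : t₀.narr 1 = τ) (hk : ∀ j < M.n, τ j ≠ 0 ∧ τ j ≤ M.k)
    (hpos : ∀ j < M.n, t₀.narr 2 j = pos τ j) (hprice : ∀ x, t₀.rarr 2 x = 0) :
    Ok W writeOutput t₀ (50 * M.n + 7) (fun t =>
      (∀ j < M.n, t.narr 0 j = M.n * (τ j - 1) + pos τ j + 1 ∧
        t.rarr 2 (M.n * (τ j - 1) + pos τ j) = t₀.rarr 4 j) ∧
      ∀ x, (∀ j < M.n, x ≠ M.n * (τ j - 1) + pos τ j) → t.rarr 2 x = 0) := by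
  obtain ⟨hW1, hW2, hW3, hW4, hW5⟩ := hW
  refine Ok.mono (B := 2 + ((M.n - 0) * (40 + 1 + 8) + 1 + 4)) ?_ (by omega) fun _ _ => id
  refine Ok.seq (Q := fun s => s.nvar 3 = 0) (Ok.of_wp_le (by decide) ?_) ?_
  · simp [wp, NExp.eval]
  rintro t1 hF1 h1
  have hR1 := hR.frame hF1 (by decide)
  refine (Ok.forUp (N := M.n) (i₀ := 0) (c := 40)
    (I := fun i t => t.nvar 3 = i ∧ (∀ j < i, t.narr 0 j = M.n * (τ j - 1) + pos τ j + 1 ∧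
        t.rarr 2 (M.n * (τ j - 1) + pos τ j) = t₀.rarr 4 j) ∧
      ∀ x, (∀ j < i, x ≠ M.n * (τ j - 1) + pos τ j) → t.rarr 2 x = 0)
    (by omega) (by decide) ?_ ?_ (by omega) ⟨h1, fun j hj => by omega, fun x _ => ?_⟩).mono le_rfl
    fun t _ h => h.2
  · rintro i t hF ⟨h, -⟩
    exact ⟨h, by simp [NExp.eval, hF.nvar 1 (by decide), hR1.n]⟩
  · rintro i t - hi hF ⟨h, ht, hx⟩
    have hRt := hR1.frame hF (by decide)
    have r4 : t.rarr 4 = t₀.rarr 4 := by rw [hF.rarr 4 (by decide), hF1.rarr 4 (by decide)]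
    have b1 : t.narr 1 = τ := by rw [hF.narr 1 (by decide), hF1.narr 1 (by decide), hτ]
    have b2 : t.narr 2 i = pos τ i := by
      rw [hF.narr 2 (by decide), hF1.narr 2 (by decide), hpos i hi]
    have hpi := pos_le τ i
    have hle : M.n * (τ i - 1) + pos τ i + 1 ≤ M.n * M.k := by
      have := hk i hi
      calc M.n * (τ i - 1) + pos τ i + 1 ≤ M.n * (τ i - 1) + M.n := by omega
        _ = M.n * (τ i - 1 + 1) := by ring
        _ ≤ M.n * M.k := Nat.mul_le_mul le_rfl (by omega)
    refine Ok.of_wp_le (by decide) ?_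
    simp only [wp, NExp.eval, RExp.eval, h, setArr_apply, r4, b1, b2, hRt.n]
    norm_num only [if_false, if_true]
    simp only [b2, update_self]
    refine ⟨by omega, by omega, by omega, trivial, fun j hj => ?_, fun x hxi => ?_⟩
    · by_cases hji : j = i
      · subst hji
        rw [update_self, update_self]
        exact ⟨rfl, rfl⟩
      · rw [update_of_ne hji, update_of_ne]
        · exact ht j (by omega)
        · intro hcon
          have hpj := pos_le τ j
          obtain ⟨e1, e2⟩ := index_inj (by omega) (by omega) hcon
          have h1 := hk i hi
          have h2 := hk j (by omega)
          exact hji (pos_inj τ (by omega) e2)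
    · rw [update_of_ne (hxi i (by omega))]
      exact hx x fun j hj => hxi j (by omega)
  · rw [hF1.rarr 2 (by decide), hprice]

/-- The algorithm. -/
def vcgProgram : Program :=
  .seq (.nassign 2 (.lit 0)) (.seq (forUp 2 (.var 1) addSlot) (.seq findLabels writeOutput))

theorem vcgProgram_ok {t₀ : State} (hR : Reads M t₀) (hW : Fits M W)
    (hτ : ∀ j, t₀.narr 1 j = 0) (hT : ∀ j, t₀.narr 4 j = 0) (hprice : ∀ x, t₀.rarr 2 x = 0) :
    Ok W vcgProgram t₀ (5000 * (M.n * (M.n * (M.k + Nat.log 2 (2 * M.n) + 1)))) (fun t =>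
      ∃ (τ : ℕ → ℕ) (L π : ℕ → ℝ) (pt ps rk : ℕ → ℕ), (∀ j < M.n, τ j ≠ 0 ∧ τ j ≤ M.k) ∧
      M.Potential τ π ∧ M.Labels τ L pt ps rk ∧
      (∀ j < M.n, t.narr 0 j = M.n * (τ j - 1) + pos τ j + 1 ∧
        t.rarr 2 (M.n * (τ j - 1) + pos τ j) = L j) ∧
      ∀ x, (∀ j < M.n, x ≠ M.n * (τ j - 1) + pos τ j) → t.rarr 2 x = 0) := by
  refine Ok.mono (B := 2 + (((M.n - 0) * (M.budget + (50 * M.n + 15) + 1 + 8) + 1 + 4) +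
    (M.budget + (50 * M.n + 7)))) ?_ ?_ fun _ _ => id
  swap
  · have h1 := hW.k_pos
    have h2 := hW.n_pos
    unfold Market.budget
    generalize Nat.log 2 (2 * M.n) = ℓ
    generalize hx : M.n * (M.k + ℓ + 1) = x
    have e1 : 2 * M.n ≤ x := by
      rw [← hx, mul_comm 2]; exact Nat.mul_le_mul le_rfl (by omega)
    have e2 : 1 * x ≤ M.n * x := Nat.mul_le_mul h2 le_rfl
    have e3 : M.n * (2 * M.n) ≤ M.n * x := Nat.mul_le_mul le_rfl e1
    have e4 : (M.n - 0) * (2000 * x + (50 * M.n + 15) + 1 + 8) =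
        2000 * (M.n * x) + 25 * (M.n * (2 * M.n)) + 24 * M.n := by
      rw [Nat.sub_zero]; ring
    rw [e4]
    omega
  refine Ok.seq (Q := fun s => s.nvar 2 = 0) (Ok.of_wp_le (by decide) ?_) ?_
  · simp [wp, NExp.eval]
  intro t1 hF1 h1
  have hR1 := hR.frame hF1 (by decide)
  have hτ1 : ∀ j, t1.narr 1 j = 0 := by rw [hF1.narr 1 (by decide)]; exact hτ
  have hnW := hW.n_le
  refine Ok.seq (Ok.forUp (N := M.n) (i₀ := 0) (c := M.budget + (50 * M.n + 15))
    (I := Stage M) (by omega) (by decide) ?_ ?_ (by omega) ?_) ?_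
  · rintro i t hF h
    exact ⟨h.count, by simp [NExp.eval, h.reads.n]⟩
  · rintro i t - hi hF h
    exact addSlot_ok hW h hi
  -- With no slot filled, the conditions on a potential are vacuous.
  · refine ⟨hR1, h1, fun j _ => by rw [hτ1]; omega, fun j _ => by simp [hτ1], fun i => ?_,
      ⟨fun s _ h => absurd (hτ1 s) h, fun s _ h => absurd (hτ1 s) h,
        fun s _ h => absurd (hτ1 s) h⟩, fun x => ?_⟩
    · rw [hF1.narr 4 (by decide), hT]; omega
    · rw [hF1.rarr 2 (by decide), hprice]
  intro t2 hF2 h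
  -- The stored potential consists of labels from before the last insertion; the prices need the
  -- labels of the completed placement.
  refine Ok.seq (findLabels_ok h.reads hW rfl rfl h.le h.tree_le h.potential.swap_le) ?_
  rintro t3 hF3 ⟨⟨rk, hL⟩, hpos, -⟩
  have hk : ∀ j < M.n, t2.narr 1 j ≠ 0 ∧ t2.narr 1 j ≤ M.k :=
    fun j hj => ⟨(h.ne_zero j hj).2 hj, h.le j hj⟩
  refine (writeOutput_ok (h.reads.frame hF3 (by decide)) hW (hF3.narr 1 (by decide)) hk hpos
    (by rw [hF3.rarr 2 (by decide)]; exact h.prices)).mono le_rfl ?_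
  rintro t - ⟨e1, e2⟩
  exact ⟨_, _, _, _, _, rk, hk, h.potential, hL, e1, e2⟩

variable {k n : ℕ}

/-! ### From natural-number indices to instances -/

theorem tableArray_apply (f : Fin k → Fin n → ℝ) (c : Fin k) (j : Fin n) :
    tableArray f (n * c + j) = f c j := by
  have hn : 0 < n := by have := j.2; omega
  have hlt : n * c + j < k * n := by
    calc n * (c : ℕ) + j < n * c + n := by have := j.2; omega
      _ = (c + 1) * n := by ring
      _ ≤ k * n := Nat.mul_le_mul (by have := c.2; omega) le_rfl
  rw [tableArray, dif_pos hlt]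
  congr 1
  · apply Fin.ext
    simp only [Fin.coe_divNat]
    rw [Nat.mul_add_div hn, Nat.div_eq_of_lt j.2, Nat.add_zero]
  · apply Fin.ext
    simp only [Fin.coe_modNat]
    rw [Nat.mul_add_mod, Nat.mod_eq_of_lt j.2]

theorem tableArray_eq (f : Fin k → Fin n → ℝ) {c j : ℕ} (h1 : 1 ≤ c) (hc : c ≤ k) (hj : j < n) :
    tableArray f (n * (c - 1) + j) = f ⟨c - 1, by omega⟩ ⟨j, hj⟩ :=
  tableArray_apply f ⟨c - 1, by omega⟩ ⟨j, hj⟩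

namespace Instance

variable (I : Instance k n)

/-- The instance with natural-number indices. -/
noncomputable def market : Market where
  n := n
  k := k
  A c j := tableArray I.discount (n * (c - 1) + j)
  V c i := tableArray I.value (n * (c - 1) + i)
  A_anti c h1 hk i j hij hj := by
    rw [tableArray_eq _ h1 hk hj, tableArray_eq _ h1 hk (lt_of_le_of_lt hij hj)]
    exact I.discount_antitone _ hij
  V_anti c h1 hk i j hij hj := by
    rw [tableArray_eq _ h1 hk hj, tableArray_eq _ h1 hk (lt_of_le_of_lt hij hj)]
    exact I.value_antitone _ hij
  A_nonneg c h1 hk j hj := by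
    rw [tableArray_eq _ h1 hk hj]; exact I.discount_nonneg _ _
  V_nonneg c h1 hk j hj := by
    rw [tableArray_eq _ h1 hk hj]; exact I.value_nonneg _ _

theorem reads_inputState : Reads I.market I.inputState :=
  ⟨by simp [inputState, market], by simp [inputState, market],
    fun c i => by simp [inputState, market], fun c j => by simp [inputState, market]⟩

theorem market_w (a : Ad k n) (j : Fin n) : I.market.w (a.1 + 1, a.2) j = I.weight a j := by
  simp only [Market.w, market, weight, Nat.add_sub_cancel]
  rw [tableArray_apply, tableArray_apply]

theorem adValue_of_eq {A : Allocation k n} {a : Ad k n} {j : Fin n} (h : A j = some a) :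
    I.adValue A a = I.weight a j := by
  have := (PEquiv.eq_some_iff A).2 h
  simp only [adValue, this]

theorem adValue_of_none {A : Allocation k n} {a : Ad k n} (h : A.symm a = none) :
    I.adValue A a = 0 := by
  simp only [adValue, h]

theorem welfare_eq_sum_slots (A : Allocation k n) :
    I.welfare A = ∑ j, (A j).elim 0 fun a => I.weight a j := by
  have h1 : ∀ a, I.adValue A a = ∑ j, if A j = some a then I.weight a j else 0 := by
    intro a
    rcases h : A.symm a with _ | j
    · rw [I.adValue_of_none h]
      refine (sum_eq_zero fun j _ => if_neg fun hc => ?_).symm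
      rw [← PEquiv.eq_some_iff, h] at hc
      simp at hc
    · have hj := (PEquiv.eq_some_iff A).1 h
      rw [I.adValue_of_eq hj, sum_eq_single j]
      · rw [if_pos hj]
      · intro i _ hij
        refine if_neg fun hc => hij ?_
        have := (PEquiv.eq_some_iff A).2 hc
        rw [h] at this
        exact (Option.some_injective _ this).symm
      · simp
  simp only [welfare, h1]
  rw [sum_comm]
  refine sum_congr rfl fun j _ => ?_
  rcases h : A j with _ | a
  · simp
  · simp

end Instance

/-- Types of the slots in an allocation. -/
def slotType (A : Allocation k n) (j : ℕ) : ℕ :=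
  if h : j < n then (A ⟨j, h⟩).elim 0 (fun a => a.1 + 1) else 0

/-- Positions of the ads that the slots show in an allocation. -/
def slotPos (A : Allocation k n) (j : ℕ) : ℕ :=
  if h : j < n then (A ⟨j, h⟩).elim 0 (fun a => a.2) else 0

theorem slot_cases (A : Allocation k n) {j : ℕ} (hj : j < n) :
    (A ⟨j, hj⟩ = none ∧ slotType A j = 0) ∨
    ∃ a, A ⟨j, hj⟩ = some a ∧ slotType A j = a.1 + 1 ∧ slotPos A j = a.2 := by
  simp only [slotType, slotPos, dif_pos hj]
  rcases A ⟨j, hj⟩ with _ | a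
  · left; simp
  · right; exact ⟨a, by simp⟩

theorem placement_slot (I : Instance k n) (A : Allocation k n) :
    I.market.Placement n (slotType A) (slotPos A) := by
  refine ⟨fun j hj => ?_, fun j hj h0 => ?_, fun i hi j hj h0 hij hp => ?_⟩
  · rcases slot_cases A hj with ⟨-, h⟩ | ⟨a, -, h, -⟩
    · rw [h]; exact Nat.zero_le _
    · rw [h]; exact a.1.2
  · rcases slot_cases A hj with ⟨-, h⟩ | ⟨a, -, -, h⟩
    · exact absurd h h0
    · rw [h]; exact a.2.2
  · rcases slot_cases A hi with ⟨-, h⟩ | ⟨a, ha, ha1, ha2⟩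
    · exact absurd h h0
    rcases slot_cases A hj with ⟨-, h⟩ | ⟨b, hb, hb1, hb2⟩
    · rw [hij] at h0; exact absurd h h0
    have hab : a = b := by
      refine Prod.ext (Fin.ext ?_) (Fin.ext ?_) <;> omega
    subst hab
    have := A.inj ha hb
    simpa using this

theorem val_slot (I : Instance k n) (A : Allocation k n) :
    I.market.val n (slotType A) (slotPos A) = I.welfare A := by
  rw [I.welfare_eq_sum_slots, Market.val, sum_range]
  refine sum_congr rfl fun j _ => ?_
  rcases slot_cases A j.2 with ⟨h, h'⟩ | ⟨a, h, h1, h2⟩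
  · rw [Fin.eta] at h
    rw [if_pos h', h]; rfl
  · rw [Fin.eta] at h
    rw [if_neg (by omega), h, h1, h2]
    exact I.market_w a j

theorem exists_allocation (I : Instance k n) {τ p : ℕ → ℕ} (h : I.market.Placement n τ p) :
    ∃ A : Allocation k n, I.welfare A = I.market.val n τ p ∧
      ∀ (j : Fin n) (a : Ad k n), A j = some a ↔ τ j = a.1 + 1 ∧ p j = a.2 := by
  classical
  have hk : ∀ j : Fin n, τ j ≤ k := fun j => h.le j j.2
  have hp : ∀ j : Fin n, τ j ≠ 0 → p j < n := fun j => h.lt j j.2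
  let f : Fin n → Option (Ad k n) := fun j =>
    if h0 : τ j ≠ 0 then some (⟨τ j - 1, by have := hk j; omega⟩, ⟨p j, hp j h0⟩) else none
  have hf : ∀ j a, f j = some a ↔ τ j = a.1 + 1 ∧ p j = a.2 := by
    intro j a
    by_cases h0 : τ j ≠ 0
    · simp only [f, dif_pos h0, Option.some.injEq, Prod.ext_iff, Fin.ext_iff]
      omega
    · simp only [f, dif_neg h0, reduceCtorEq, false_iff]
      omega
  have hinj : ∀ i j a, f i = some a → f j = some a → i = j := by
    intro i j a hi hj
    rw [hf] at hi hj
    exact Fin.ext (h.inj i i.2 j j.2 (by omega) (by omega) (by omega))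
  let A : Allocation k n :=
    { toFun := f
      invFun := fun a => if hx : ∃ j, f j = some a then some hx.choose else none
      inv := by
        intro j a
        constructor
        · intro hx
          split_ifs at hx with hy
          · rw [Option.some.injEq] at hx
            rw [← hx]
            exact hy.choose_spec
        · intro hx
          have hy : ∃ j, f j = some a := ⟨j, hx⟩
          rw [dif_pos hy, Option.some.injEq]
          exact hinj _ _ a hy.choose_spec hx }
  have hA : ∀ (j : Fin n) (a : Ad k n), A j = some a ↔ τ j = a.1 + 1 ∧ p j = a.2 := hf
  refine ⟨A, ?_, hA⟩
  rw [I.welfare_eq_sum_slots, Market.val, sum_range]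
  refine sum_congr rfl fun j _ => ?_
  rcases hj : A j with _ | a
  · have h0 : τ j = 0 := by
      by_contra h0
      have : f j = none := hj
      simp [f, h0] at this
    simp [h0]
  · obtain ⟨h1, h2⟩ := (hA j a).1 hj
    rw [if_neg (by omega), h1, h2]
    exact (I.market_w a j).symm

/-! ### Optimality and VCG prices -/

section Output

variable (I : Instance k n) {τ : ℕ → ℕ} {π L : ℕ → ℝ} {pt ps rk : ℕ → ℕ}

theorem sum_filled_le {X : Finset ℕ} (hX : X ⊆ range n) (hL : ∀ j < n, 0 ≤ L j) :
    ∑ j ∈ X, L j ≤ ∑ j ∈ range n, L j :=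
  sum_le_sum_of_subset_of_nonneg hX fun j hj _ => hL j (mem_range.1 hj)

/-- A placement with labels yields an optimal allocation, whose VCG prices are the labels. -/
theorem exists_optimal (hk : 1 ≤ k) (hτ : ∀ j < n, τ j ≠ 0 ∧ τ j ≤ k)
    (hπ : I.market.Potential τ π) (hL : I.market.Labels τ L pt ps rk) :
    ∃ A : Allocation k n, (∀ (j : Fin n) (a : Ad k n), A j = some a ↔ τ j = a.1 + 1 ∧ pos τ j = a.2) ∧
      I.IsOptimal A ∧ ∀ a, I.IsVCGPrice A a ((A.symm a).elim 0 fun j => L j) := by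
  have hτk : ∀ j < n, τ j ≤ k := fun j hj => (hτ j hj).2
  obtain ⟨U, hU⟩ := hL.exists_dual hτk hπ
  have hLn : ∀ j < n, 0 ≤ L j := hL.nonneg hk
  have hpl : I.market.Placement n τ (pos τ) := Market.placement_pos le_rfl hτk
  have hfill : I.market.filled τ = range n := by
    ext j
    rw [Market.mem_filled, mem_range]
    exact ⟨fun h => h.1, fun h => ⟨h, (hτ j h).1⟩⟩
  have hval := hU.val_eq hτk
  rw [hfill] at hval
  have hsub : ∀ σ, I.market.filled σ ⊆ range n := fun σ => filter_subset _ _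
  obtain ⟨A, hA1, hA2⟩ := exists_allocation I hpl
  have hopt : I.IsOptimal A := by
    intro A'
    rw [hA1, ← val_slot]
    have h1 := hU.val_le (placement_slot I A') _ (Subset.refl _)
      fun j hj h0 => (placement_slot I A').mem_ads hj h0
    have h2 := sum_filled_le (hsub (slotType A')) hLn
    change I.market.val I.market.n _ _ ≤ I.market.val I.market.n _ _
    linarith
  refine ⟨A, hA2, hopt, fun a => ?_⟩
  have herase : ∑ b ∈ univ.erase a, I.adValue A b = I.welfare A - I.adValue A a := by
    rw [Instance.welfare, ← add_sum_erase _ _ (mem_univ a)]; ring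
  rcases ha : A.symm a with _ | y
  -- An ad that is not shown imposes no externality: `A` itself is optimal without it.
  · refine ⟨A, ⟨ha, fun A' _ => hopt A'⟩, ?_⟩
    rw [herase, I.adValue_of_none ha]
    simp
  have hy := (PEquiv.eq_some_iff A).1 ha
  obtain ⟨hy1, hy2⟩ := (hA2 y a).1 hy
  have hyn : (y : ℕ) < n := y.2
  have hne : τ y ≠ 0 := by omega
  set b : ℕ × ℕ := (τ y, pos τ y) with hb
  have hbmem : b ∈ I.market.ads := hpl.mem_ads hyn hne
  -- Lower bound for the welfare without the ad: vacate `y` and follow its exchange path.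
  obtain ⟨σ, p, hp, hpv, hpb⟩ := hL.exists_alternative b (pos_lt_cnt τ hyn) _ τ (pos τ) y
    (Market.exchange_start hτk rk hyn) (Nat.lt_succ_self _) (by
      intro j hj hjy h0 hcon
      simp only [hb, Prod.mk.injEq] at hcon
      exact hjy (pos_inj τ hcon.1 hcon.2))
  have hvac : I.market.val n (update τ y 0) (pos τ) =
      I.market.val n τ (pos τ) - I.market.w b y := by
    rw [Market.val_eq_of_eq_off (τ := τ) (p := pos τ) hyn (fun j _ hj => by simp [hj])]
    simp [hne, hb]
    ring
  have hw : I.market.w b y = I.weight a y := by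
    rw [hb, hy1, hy2]; exact I.market_w a y
  obtain ⟨A₀, hA₀1, hA₀2⟩ := exists_allocation I hp
  have hshow : ∀ A' : Allocation k n, (∀ j, A' j ≠ some a) ↔ A'.symm a = none := by
    intro A'
    rw [Option.eq_none_iff_forall_ne_some]
    refine forall_congr' fun j => not_congr ?_
    exact (PEquiv.eq_some_iff A').symm
  have hW₀ : I.welfare A₀ = I.welfare A - I.weight a y + L y := by
    rw [hA₀1, hA1, ← hw]
    have : I.market.val n σ p = I.market.val n (update τ y 0) (pos τ) + L y := hpv
    rw [this, hvac]
  refine ⟨A₀, ⟨(hshow A₀).1 fun j hj => ?_, fun A' hA' => ?_⟩, ?_⟩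
  · obtain ⟨h1, h2⟩ := (hA₀2 j a).1 hj
    refine hpb j j.2 (by omega) ?_
    rw [hb, h1, h2, hy1, hy2]
  · rw [hW₀, ← val_slot]
    -- Upper bound: the dual objective without the utility of `b`, which by tightness is its weight
    -- in slot `y` minus `L y`.
    have h1 := hU.val_le (placement_slot I A') (I.market.ads.erase b) (erase_subset _ _) (by
      intro j hj h0
      refine mem_erase.2 ⟨fun hcon => ?_, (placement_slot I A').mem_ads hj h0⟩
      rcases slot_cases A' hj with ⟨-, h⟩ | ⟨a', ha', h1, h2⟩
      · exact h0 h
      · simp only [hb, Prod.mk.injEq] at hcon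
        have haa : a' = a := by
          refine Prod.ext (Fin.ext ?_) (Fin.ext ?_) <;> omega
        subst haa
        exact (hshow A').2 hA' _ ha')
    have h2 := sum_filled_le (hsub (slotType A')) hLn
    have h3 := add_sum_erase I.market.ads U hbmem
    have h4 := hU.tight y hyn hne
    rw [← hb, hw] at h4
    have h5 : I.welfare A = I.market.val I.market.n τ (pos τ) := hA1
    change I.market.val I.market.n _ _ ≤ _
    rw [h5]
    linarith
  · rw [herase, hW₀, I.adValue_of_eq hy]
    simp

end Output

theorem time_bound (hk : 1 ≤ k) (hn : 1 ≤ n) {t : ℕ}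
    (ht : t ≤ 5000 * (n * (n * (k + Nat.log 2 (2 * n) + 1)))) :
    (t : ℝ) ≤ 15000 * ((n : ℝ) ^ 2 * ((k : ℝ) + Real.log n)) := by
  -- The factor `2` suffices since `log 2 > 1/2`. The additive constants are absorbed by `k ≥ 1`,
  -- which also covers `n = 1`, where the logarithm vanishes.
  have hlog : (Nat.log 2 n : ℝ) ≤ 2 * Real.log n := by
    have h1 : ((2 : ℝ) ^ Nat.log 2 n) ≤ n := by
      exact_mod_cast Nat.pow_log_le_self 2 (by omega)
    have h2 := Real.log_le_log (by positivity) h1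
    rw [Real.log_pow] at h2
    have h3 := Real.log_two_gt_d9
    have h4 : (0 : ℝ) ≤ Nat.log 2 n := Nat.cast_nonneg _
    nlinarith
  have h2n : Nat.log 2 (2 * n) = Nat.log 2 n + 1 := by
    rw [mul_comm]; exact Nat.log_mul_base (by norm_num) (by omega)
  rw [h2n] at ht
  have ht' : (t : ℝ) ≤ 5000 * (n * (n * (k + (Nat.log 2 n + 1) + 1))) := by exact_mod_cast ht
  have hk' : (1 : ℝ) ≤ k := by exact_mod_cast hk
  have hlog0 : 0 ≤ Real.log n := Real.log_natCast_nonneg n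
  have : (n : ℝ) ^ 2 * (k + (Nat.log 2 n + 1) + 1) ≤ (n : ℝ) ^ 2 * (3 * (k + Real.log n)) :=
    mul_le_mul_of_nonneg_left (by linarith) (by positivity)
  nlinarith

end AdTypes

theorem corollary1 :
    ∃ (prog : AdTypes.Program) (C : ℝ) (c : ℕ),
      ∀ (k n : ℕ), 1 ≤ k → 1 ≤ n → ∀ I : AdTypes.Instance k n,
        ∃ (t : ℕ) (s : AdTypes.State) (M : AdTypes.Allocation k n) (p : AdTypes.Ad k n → ℝ),
          AdTypes.Run ((k + n + 1) ^ c) prog I.inputState t s ∧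
          (t : ℝ) ≤ C * ((n : ℝ) ^ 2 * ((k : ℝ) + Real.log n)) ∧
          AdTypes.IsOutput s M p ∧
          I.IsOptimal M ∧
          ∀ a : AdTypes.Ad k n, I.IsVCGPrice M a (p a) := by
  refine ⟨AdTypes.vcgProgram, 15000, 2, fun k n hk hn I => ?_⟩
  -- The largest numbers needed are of the order of the `n * k` ad indices, so a quadratic word
  -- bound is enough.
  have hfits : AdTypes.Fits I.market ((k + n + 1) ^ 2) := by
    refine ⟨hk, hn, ?_, ?_, ?_⟩ <;> dsimp only [AdTypes.Instance.market] <;> nlinarith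
  obtain ⟨t, s, hrun, ht, τ, L, π, pt, ps, rk, hτ, hπ, hL, hs1, hs2⟩ :=
    AdTypes.vcgProgram_ok I.reads_inputState hfits (fun j => rfl) (fun j => rfl)
      (fun x => by simp [AdTypes.Instance.inputState])
  obtain ⟨A, hA, hopt, hvcg⟩ := AdTypes.exists_optimal I hk hτ hπ hL
  refine ⟨t, s, A, _, hrun, AdTypes.time_bound hk hn ht, ⟨fun j => ?_, fun a => ?_⟩, hopt, hvcg⟩
  · have hτj := hτ j j.2
    rw [(hs1 j j.2).1]
    rcases hj : A j with _ | a
    -- This case is impossible, as every slot is filled in the final placement.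
    · have hpn : AdTypes.pos τ j < n := by
        have := AdTypes.pos_le τ j
        have := j.2
        omega
      have hτk : τ j ≤ k := hτj.2
      have := (hA j (⟨τ j - 1, by omega⟩, ⟨AdTypes.pos τ j, hpn⟩)).2 ⟨by dsimp only; omega, rfl⟩
      rw [hj] at this
      simp at this
    · obtain ⟨h1, h2⟩ := (hA j a).1 hj
      rw [h1, h2]
      rfl
  · rcases ha : A.symm a with _ | j
    · refine hs2 _ fun j hj hcon => ?_
      have hpn : AdTypes.pos τ j < n := lt_of_le_of_lt (AdTypes.pos_le τ j) hj
      obtain ⟨e1, e2⟩ := AdTypes.index_inj a.2.2 hpn hcon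
      have h0 := (hτ j hj).1
      have := (hA ⟨j, hj⟩ a).2 ⟨by dsimp only; omega, e2.symm⟩
      rw [← PEquiv.eq_some_iff, ha] at this
      simp at this
    · have hj := (PEquiv.eq_some_iff A).1 ha
      obtain ⟨h1, h2⟩ := (hA j a).1 hj
      have := (hs1 j j.2).2
      rw [h1, h2] at this
      exact this
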